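/- **Setting.** Consider equations $$u_{tx}=g(t,x)\,u_x+f(t,x,u),\qquad g_x\neq 0,\quad f_{uu}\neq 0, \tag{E}$$ on a domain (nonempty connected open set) $\Omega\subset\mathbb R^3$ of the space of the variables $(t,x,u)$, where $f$ is smooth on $\Omega$, $g$ is smooth on the projection of $\Omega$ to the $(t,x)$-plane, and the conditions $g_x\ne0$, $f_{uu}\neq 0$ mean that neither $g_x$ nor $f_{uu}$ vanishes identically on any nonempty open subset of $\Omega$. The symmetry algebra $L$ of (E) on $\Omega$ is the space of all smooth vector fields $Q=\tau(t,x,u)\partial_t+\xi(t,x,u)\partial_x+\eta(t,x,u)\partial_u$ on $\Omega$ that satisfy Lie's invariance criterion, i.e. whose second prolongation annihilates $u_{tx}-gu_x-f$ at all points of the jet space over $\Omega$ with $u_{tx}=gu_x+f$. The equation has nontrivial symmetry if $L\neq0$. An equivalence transformation is a smooth invertible transformation of one of the two forms 1. $\bar t=T(t),\ \bar x=X(x),\ v=U(t)u+Y(t,x)$, with $T'X'U\ne0$; 2. $\bar t=T(x),\ \bar x=X(t),\ v=\Psi(x)\exp\!\big(-\!\int g\,dt\big)\,u+Y(t,x)$,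 with $T'X'\Psi\neq0$. **Theorem.** Let (E) be an equation of this class. Then $\dim L\le 2$. If $L\neq 0$, then there is a dense open subset of $\Omega$ each point of which has a neighbourhood $W\subset\Omega$ on which (E) is taken, by an equivalence transformation $\Phi$ on $W$ whose differential carries $L|_W$ onto the algebra indicated, to one of the following equations (on $\Phi(W)$, where all the expressions are defined and the stated inequalities hold at every point). *If $\dim L=1$:* * $\langle t\partial_t+x\partial_x\rangle$: $g=t^{-1}\tilde g(\omega)$, $f=t^{-2}\tilde f(u,\omega)$, $\omega=tx^{-1}$, $\tilde g_\omega\ne0$, $\tilde f_{uu}\neq0$; * $\langle\partial_t\rangle$: $g=\tilde g(x)$, $f=\tilde f(x,u)$, $\tilde g'\ne0$, $\tilde f_{uu}\ne0$; * $\langle\partial_x+tu\partial_u\rangle$: $g=x+\tilde g(t)$, $f=e^{tx}\tilde f(t,\omega)$, $\omega=e^{-tx}u$, $\tilde f_{\omega\omega}\ne0$. *If $\dim L=2$* (with constants $m,k\in\mathbb R$; in each case $L$ is non-commutative): * $\langle t\partial_t+x\partial_x,\ t^2\partial_t+x^2\partial_x+mtu\partial_u\rangle$: $g=[mt+(k-m)x]\,t^{-1}(t-x)^{-1}$,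 $k\neq0$, $f=|t-x|^{m-2}|x|^{-m}\tilde f(\omega)$, $\omega=u|t-x|^{-m}|x|^m$, $\tilde f_{\omega\omega}\ne0$; * $\langle t\partial_t+x\partial_x,\ t^2\partial_t+mtu\partial_u\rangle$: $g=t^{-2}(kx+mt)$, $k\neq0$, $f=|t|^{m-2}|x|^{-m}\tilde f(\omega)$, $\omega=|t|^{-m}|x|^mu$, $\tilde f_{\omega\omega}\neq0$; * $\langle t\partial_t+x\partial_x,\ x^2\partial_x+tu\partial_u\rangle$: $g=(tx)^{-1}(mx-t)$, $f=x^{-2}e^{-t/x}\tilde f(\omega)$, $\omega=ue^{t/x}$, $\tilde f_{\omega\omega}\ne0$. -/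

import Mathlib

open Set
open scoped ContDiff Topology

noncomputable section

namespace GroupClass

/-- Points `(t, x, u)` of the space of independent and dependent variables. Vector fields
`τ ∂_t + ξ ∂_x + η ∂_u` are represented by maps `Pt → Pt`, `P ↦ (τ P, ξ P, η P)`. -/
abbrev Pt : Type := ℝ × ℝ × ℝ

/-- The projection `(t, x, u) ↦ (t, x)`. -/
def base (P : Pt) : ℝ × ℝ := (P.1, P.2.1)

/-- The equation `u_tx = g(t, x) u_x + f(t, x, u)`. -/
structure Equation where
  g : ℝ × ℝ → ℝ
  f : Pt → ℝ

namespace Equation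

/-- The derivative `g_x`. -/
def gx (e : Equation) (z : ℝ × ℝ) : ℝ := fderiv ℝ e.g z (0, 1)

/-- The second derivative `f_uu`. -/
def fuu (e : Equation) (P : Pt) : ℝ :=
  fderiv ℝ (fun R => fderiv ℝ e.f R (0, 0, 1)) P (0, 0, 1)

/-- The equation belongs to the class on `Ω`: `f` and `g` are smooth there, and neither `g_x` nor
`f_uu` vanishes identically on any nonempty open subset of `Ω`. -/
structure InClass (e : Equation) (Ω : TopologicalSpace.Opens Pt) : Prop where
  smooth_g : ∀ P ∈ Ω, ContDiffAt ℝ ∞ e.g (base P)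
  smooth_f : ∀ P ∈ Ω, ContDiffAt ℝ ∞ e.f P
  gx_ne : (Ω : Set Pt) ⊆ closure {P | P ∈ Ω ∧ e.gx (base P) ≠ 0}
  fuu_ne : (Ω : Set Pt) ⊆ closure {P | P ∈ Ω ∧ e.fuu P ≠ 0}

/-- The function `u` satisfies the equation at the point `z = (t, x)`. -/
def SolvesAt (e : Equation) (u : ℝ × ℝ → ℝ) (z : ℝ × ℝ) : Prop :=
  fderiv ℝ (fun w => fderiv ℝ u w (0, 1)) z (1, 0)
    = e.g z * fderiv ℝ u z (0, 1) + e.f (z.1, z.2, u z)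

end Equation

/-! ### Infinitesimal symmetries -/

/-- First-order jets `(t, x, u, u_t, u_x)`. -/
abbrev Jet : Type := ℝ × ℝ × ℝ × ℝ × ℝ

/-- The point `(t, x, u)` below a first-order jet. -/
def jetPt (j : Jet) : Pt := (j.1, j.2.1, j.2.2.1)

/-- `(D_x τ, D_x ξ, D_x η)`, where `D_x = ∂_x + u_x ∂_u` on functions of `(t, x, u)`. -/
def totX (Q : Pt → Pt) (j : Jet) : Pt := fderiv ℝ Q (jetPt j) (0, 1, j.2.2.2.2)

/-- `(D_t τ, D_t ξ, D_t η)`, where `D_t = ∂_t + u_t ∂_u` on functions of `(t, x, u)`. -/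
def totT (Q : Pt → Pt) (j : Jet) : Pt := fderiv ℝ Q (jetPt j) (1, 0, j.2.2.2.1)

/-- `φ^x = D_x η - u_t D_x τ - u_x D_x ξ`. -/
def phiX (Q : Pt → Pt) (j : Jet) : ℝ :=
  (totX Q j).2.2 - j.2.2.2.1 * (totX Q j).1 - j.2.2.2.2 * (totX Q j).2.1

/-- `φ^{tx} = D_t φ^x - u_tx D_t τ - u_xx D_t ξ`, where
`D_t = ∂_t + u_t ∂_u + u_tt ∂_{u_t} + u_tx ∂_{u_x}` on functions of first-order jets. -/
def phiTX (Q : Pt → Pt) (j : Jet) (utt utx uxx : ℝ) : ℝ :=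
  fderiv ℝ (phiX Q) j (1, 0, j.2.2.2.1, utt, utx)
    - utx * (totT Q j).1 - uxx * (totT Q j).2.1

/-- Lie's infinitesimal invariance criterion on `Ω`: the second prolongation of `Q` annihilates
`u_tx - g u_x - f` at all second-order jets over `Ω` with `u_tx = g u_x + f`. -/
def IsInfSymmetry (e : Equation) (Ω : TopologicalSpace.Opens Pt) (Q : Pt → Pt) : Prop :=
  ∀ j : Jet, jetPt j ∈ Ω → ∀ utt uxx : ℝ,
    phiTX Q j utt (e.g (base (jetPt j)) * j.2.2.2.2 + e.f (jetPt j)) uxx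
      - e.g (base (jetPt j)) * phiX Q j
      - fderiv ℝ e.g (base (jetPt j)) (base (Q (jetPt j))) * j.2.2.2.2
      - fderiv ℝ e.f (jetPt j) (Q (jetPt j)) = 0

theorem contDiff_jetPt : ContDiff ℝ ∞ jetPt := by
  unfold jetPt; fun_prop

theorem jet_eventually {Ω : TopologicalSpace.Opens Pt} {j : Jet} (hj : jetPt j ∈ Ω) :
    ∀ᶠ k in 𝓝 j, jetPt k ∈ Ω :=
  contDiff_jetPt.continuous.continuousAt.eventually (Ω.isOpen.mem_nhds hj)

theorem field_differentiableAt {Ω : TopologicalSpace.Opens Pt} {Q : Pt → Pt}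
    (hQ : ContDiffOn ℝ ∞ Q Ω) {P : Pt} (hP : P ∈ Ω) : DifferentiableAt ℝ Q P :=
  (hQ.contDiffAt (Ω.isOpen.mem_nhds hP)).differentiableAt (by simp)

theorem totX_differentiableAt {Ω : TopologicalSpace.Opens Pt} {Q : Pt → Pt}
    (hQ : ContDiffOn ℝ ∞ Q Ω) {j : Jet} (hj : jetPt j ∈ Ω) :
    DifferentiableAt ℝ (totX Q) j := by
  have h1 : ContDiffAt ℝ 1 (fderiv ℝ Q) (jetPt j) :=
    (hQ.contDiffAt (Ω.isOpen.mem_nhds hj)).fderiv_right (by norm_cast)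
  have h2 : DifferentiableAt ℝ (fun k => fderiv ℝ Q (jetPt k)) j :=
    (h1.differentiableAt (by simp)).comp j
      (contDiff_jetPt.contDiffAt.differentiableAt (by simp))
  have h3 : DifferentiableAt ℝ (fun k : Jet => ((0, 1, k.2.2.2.2) : Pt)) j := by fun_prop
  exact h2.clm_apply h3

theorem phiX_differentiableAt {Ω : TopologicalSpace.Opens Pt} {Q : Pt → Pt}
    (hQ : ContDiffOn ℝ ∞ Q Ω) {j : Jet} (hj : jetPt j ∈ Ω) :
    DifferentiableAt ℝ (phiX Q) j := by
  have h := totX_differentiableAt hQ hj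
  unfold phiX
  fun_prop

theorem phiX_add {Ω : TopologicalSpace.Opens Pt} {Q R : Pt → Pt}
    (hQ : ContDiffOn ℝ ∞ Q Ω) (hR : ContDiffOn ℝ ∞ R Ω) {j : Jet} (hj : jetPt j ∈ Ω) :
    phiX (Q + R) j = phiX Q j + phiX R j := by
  simp only [phiX, totX, fderiv_add (field_differentiableAt hQ hj) (field_differentiableAt hR hj),
    add_apply, Prod.fst_add, Prod.snd_add]
  ring

theorem phiTX_add {Ω : TopologicalSpace.Opens Pt} {Q R : Pt → Pt}
    (hQ : ContDiffOn ℝ ∞ Q Ω) (hR : ContDiffOn ℝ ∞ R Ω) {j : Jet} (hj : jetPt j ∈ Ω)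
    (a b c : ℝ) : phiTX (Q + R) j a b c = phiTX Q j a b c + phiTX R j a b c := by
  have h : phiX (Q + R) =ᶠ[𝓝 j] phiX Q + phiX R :=
    (jet_eventually hj).mono fun k hk => phiX_add hQ hR hk
  simp only [phiTX, totT, h.fderiv_eq,
    fderiv_add (phiX_differentiableAt hQ hj) (phiX_differentiableAt hR hj),
    fderiv_add (field_differentiableAt hQ hj) (field_differentiableAt hR hj),
    add_apply, Prod.fst_add, Prod.snd_add]
  ring

theorem phiX_smul (c : ℝ) (Q : Pt → Pt) : phiX (c • Q) = c • phiX Q := by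
  funext j
  simp only [phiX, totX, fderiv_const_smul_field, smul_apply, Pi.smul_apply,
    Prod.smul_fst, Prod.smul_snd, smul_eq_mul]
  ring

theorem phiTX_smul (d : ℝ) (Q : Pt → Pt) (j : Jet) (a b c : ℝ) :
    phiTX (d • Q) j a b c = d * phiTX Q j a b c := by
  simp only [phiTX, totT, phiX_smul, fderiv_const_smul_field, smul_apply,
    Pi.smul_apply, Prod.smul_fst, Prod.smul_snd, smul_eq_mul]
  ring

/-- The (maximal) symmetry algebra of the equation on `Ω`: all smooth vector fields on `Ω` that
satisfy Lie's criterion. A vector field on `Ω` is represented by its extension by zero. -/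
def symAlg (e : Equation) (Ω : TopologicalSpace.Opens Pt) : Submodule ℝ (Pt → Pt) where
  carrier := {Q | ContDiffOn ℝ ∞ Q Ω ∧ (∀ P, P ∉ Ω → Q P = 0) ∧ IsInfSymmetry e Ω Q}
  zero_mem' := by
    refine ⟨contDiffOn_const, fun _ _ => rfl, fun j _ a c => ?_⟩
    have h0 : (0 : Pt → Pt) = (0 : ℝ) • (0 : Pt → Pt) := by simp
    rw [h0, phiTX_smul, phiX_smul]
    have hb : base (((0 : ℝ) • (0 : Pt → Pt)) (jetPt j)) = 0 := by simp [base]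
    rw [hb, map_zero]
    simp
  add_mem' := by
    rintro Q R ⟨hQ, hQ0, hQs⟩ ⟨hR, hR0, hRs⟩
    refine ⟨hQ.add hR, fun P hP => by simp [hQ0 P hP, hR0 P hP], fun j hj a c => ?_⟩
    have h1 := hQs j hj a c
    have h2 := hRs j hj a c
    have hb : base ((Q + R) (jetPt j)) = base (Q (jetPt j)) + base (R (jetPt j)) := rfl
    have hc : (Q + R) (jetPt j) = Q (jetPt j) + R (jetPt j) := rfl
    rw [phiTX_add hQ hR hj, phiX_add hQ hR hj, hb, hc, map_add, map_add]
    linear_combination h1 + h2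
  smul_mem' := by
    rintro d Q ⟨hQ, hQ0, hQs⟩
    refine ⟨contDiffOn_const.smul hQ, fun P hP => by simp [hQ0 P hP], fun j hj a c => ?_⟩
    have h1 := hQs j hj a c
    have hb : base ((d • Q) (jetPt j)) = d • base (Q (jetPt j)) := rfl
    have hc : (d • Q) (jetPt j) = d • Q (jetPt j) := rfl
    rw [phiTX_smul, phiX_smul, hb, hc, map_smul, map_smul]
    simp only [Pi.smul_apply, smul_eq_mul]
    linear_combination d * h1

/-! ### Equivalence transformations -/

/-- The part over `D` of the graph of `u`. -/
def graphOver (u : ℝ × ℝ → ℝ) (D : Set (ℝ × ℝ)) : Set Pt :=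
  (fun z : ℝ × ℝ => ((z.1, z.2, u z) : Pt)) '' D

/-- The point transformation `Φ`, defined on `W`, takes `e` to `e'`: whenever it maps the graph of
a smooth function `u` onto the graph of a smooth function `v`, the function `u` satisfies `e` at a
point iff `v` satisfies `e'` at the corresponding point. -/
def TransformsInto (Φ : Pt → Pt) (W : Set Pt) (e e' : Equation) : Prop :=
  ∀ (u v : ℝ × ℝ → ℝ) (D D' : Set (ℝ × ℝ)), IsOpen D → IsOpen D' →
    ContDiffOn ℝ ∞ u D → ContDiffOn ℝ ∞ v D' →
    graphOver u D ⊆ W → Φ '' graphOver u D = graphOver v D' →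
    ∀ z ∈ D, ∀ z' ∈ D', Φ (z.1, z.2, u z) = (z'.1, z'.2, v z') →
      (e.SolvesAt u z ↔ e'.SolvesAt v z')

/-- First kind: `t̄ = T(t)`, `x̄ = X(x)`, `v = U(t) u + Y(t, x)` with `T' X' U ≠ 0`. -/
def IsFirstKind (Φ : Pt → Pt) (W : Set Pt) : Prop :=
  ∃ (T X U : ℝ → ℝ) (Y : ℝ × ℝ → ℝ), ∀ t x u : ℝ, (t, x, u) ∈ W →
    ContDiffAt ℝ ∞ T t ∧ ContDiffAt ℝ ∞ X x ∧ ContDiffAt ℝ ∞ U t ∧ ContDiffAt ℝ ∞ Y (t, x) ∧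
    deriv T t ≠ 0 ∧ deriv X x ≠ 0 ∧ U t ≠ 0 ∧
    Φ (t, x, u) = (T t, X x, U t * u + Y (t, x))

/-- Second kind: `t̄ = T(x)`, `x̄ = X(t)`, `v = Ψ(x) exp(-∫ g dt) u + Y(t, x)` with `T' X' Ψ ≠ 0`;
here `B` is the antiderivative `∫ g dt`. -/
def IsSecondKind (e : Equation) (Φ : Pt → Pt) (W : Set Pt) : Prop :=
  ∃ (T X Ψ : ℝ → ℝ) (B Y : ℝ × ℝ → ℝ), ∀ t x u : ℝ, (t, x, u) ∈ W →
    ContDiffAt ℝ ∞ T x ∧ ContDiffAt ℝ ∞ X t ∧ ContDiffAt ℝ ∞ Ψ x ∧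
    ContDiffAt ℝ ∞ B (t, x) ∧ ContDiffAt ℝ ∞ Y (t, x) ∧
    deriv T x ≠ 0 ∧ deriv X t ≠ 0 ∧ Ψ x ≠ 0 ∧
    fderiv ℝ B (t, x) (1, 0) = e.g (t, x) ∧
    Φ (t, x, u) = (T x, X t, Ψ x * Real.exp (-B (t, x)) * u + Y (t, x))

/-- `Φ` is an (invertible) equivalence transformation on `W` that takes `e` to `e'`. -/
def IsEquivalence (Φ : Pt → Pt) (W : Set Pt) (e e' : Equation) : Prop :=
  InjOn Φ W ∧ (IsFirstKind Φ W ∨ IsSecondKind e Φ W) ∧ TransformsInto Φ W e e'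

/-- The differential of `Φ` maps the restrictions to `W` of the vector fields in `L` onto the
restrictions to `Φ(W)` of the vector fields in `V`. -/
def CarriesOnto (Φ : Pt → Pt) (W : Set Pt) (L V : Submodule ℝ (Pt → Pt)) : Prop :=
  (∀ Q ∈ L, ∃ R ∈ V, ∀ P ∈ W, fderiv ℝ Φ P (Q P) = R (Φ P)) ∧
  (∀ R ∈ V, ∃ Q ∈ L, ∀ P ∈ W, fderiv ℝ Φ P (Q P) = R (Φ P))

/-! ### The list of invariant equations -/

/-- The operator `t ∂_t + x ∂_x`. -/
def dilation : Pt → Pt := fun P => (P.1, P.2.1, 0)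

/-- The equations with the symmetry `t ∂_t + x ∂_x`. -/
def FormA11 (e : Equation) (Ω : Set Pt) : Prop :=
  ∃ (G : ℝ → ℝ) (F : ℝ → ℝ → ℝ), ∀ t x u : ℝ, (t, x, u) ∈ Ω → t ≠ 0 ∧ x ≠ 0 ∧
    ContDiffAt ℝ ∞ G (t / x) ∧ deriv G (t / x) ≠ 0 ∧
    ContDiffAt ℝ ∞ (Function.uncurry F) (u, t / x) ∧
    iteratedDeriv 2 (fun v => F v (t / x)) u ≠ 0 ∧
    e.g (t, x) = t⁻¹ * G (t / x) ∧ e.f (t, x, u) = (t ^ 2)⁻¹ * F u (t / x)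

/-- The equations with the symmetry `∂_t`. -/
def FormA12 (e : Equation) (Ω : Set Pt) : Prop :=
  ∃ (G : ℝ → ℝ) (F : ℝ → ℝ → ℝ), ∀ t x u : ℝ, (t, x, u) ∈ Ω →
    ContDiffAt ℝ ∞ G x ∧ deriv G x ≠ 0 ∧
    ContDiffAt ℝ ∞ (Function.uncurry F) (x, u) ∧ iteratedDeriv 2 (F x) u ≠ 0 ∧
    e.g (t, x) = G x ∧ e.f (t, x, u) = F x u

/-- The equations with the symmetry `∂_x + t u ∂_u`. -/
def FormA13 (e : Equation) (Ω : Set Pt) : Prop :=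
  ∃ (G : ℝ → ℝ) (F : ℝ → ℝ → ℝ), ∀ t x u : ℝ, (t, x, u) ∈ Ω →
    ContDiffAt ℝ ∞ G t ∧
    ContDiffAt ℝ ∞ (Function.uncurry F) (t, Real.exp (-(t * x)) * u) ∧
    iteratedDeriv 2 (F t) (Real.exp (-(t * x)) * u) ≠ 0 ∧
    e.g (t, x) = x + G t ∧
    e.f (t, x, u) = Real.exp (t * x) * F t (Real.exp (-(t * x)) * u)

/-- On `Ω` the equation `e` is one of the three equations with a one-dimensional algebra, and `V`
is the algebra listed with it. -/
def ListedOne (e : Equation) (Ω : Set Pt) (V : Submodule ℝ (Pt → Pt)) : Prop :=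
  (FormA11 e Ω ∧ V = Submodule.span ℝ {dilation}) ∨
  (FormA12 e Ω ∧ V = Submodule.span ℝ {fun _ => (1, 0, 0)}) ∨
  (FormA13 e Ω ∧ V = Submodule.span ℝ {fun P => (0, 1, P.1 * P.2.2)})

/-- The equations with the symmetries `t ∂_t + x ∂_x`, `t² ∂_t + x² ∂_x + m t u ∂_u`. -/
def FormA221 (m k : ℝ) (e : Equation) (Ω : Set Pt) : Prop :=
  ∃ F : ℝ → ℝ, ∀ t x u : ℝ, (t, x, u) ∈ Ω → t ≠ 0 ∧ x ≠ 0 ∧ t ≠ x ∧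
    ContDiffAt ℝ ∞ F (u * |t - x| ^ (-m) * |x| ^ m) ∧
    iteratedDeriv 2 F (u * |t - x| ^ (-m) * |x| ^ m) ≠ 0 ∧
    e.g (t, x) = (m * t + (k - m) * x) * t⁻¹ * (t - x)⁻¹ ∧
    e.f (t, x, u) = |t - x| ^ (m - 2) * |x| ^ (-m) * F (u * |t - x| ^ (-m) * |x| ^ m)

/-- The equations with the symmetries `t ∂_t + x ∂_x`, `t² ∂_t + m t u ∂_u`. -/
def FormA222 (m k : ℝ) (e : Equation) (Ω : Set Pt) : Prop :=
  ∃ F : ℝ → ℝ, ∀ t x u : ℝ, (t, x, u) ∈ Ω → t ≠ 0 ∧ x ≠ 0 ∧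
    ContDiffAt ℝ ∞ F (|t| ^ (-m) * |x| ^ m * u) ∧
    iteratedDeriv 2 F (|t| ^ (-m) * |x| ^ m * u) ≠ 0 ∧
    e.g (t, x) = (t ^ 2)⁻¹ * (k * x + m * t) ∧
    e.f (t, x, u) = |t| ^ (m - 2) * |x| ^ (-m) * F (|t| ^ (-m) * |x| ^ m * u)

/-- The equations with the symmetries `t ∂_t + x ∂_x`, `x² ∂_x + t u ∂_u`. -/
def FormA223 (m : ℝ) (e : Equation) (Ω : Set Pt) : Prop :=
  ∃ F : ℝ → ℝ, ∀ t x u : ℝ, (t, x, u) ∈ Ω → t ≠ 0 ∧ x ≠ 0 ∧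
    ContDiffAt ℝ ∞ F (u * Real.exp (t / x)) ∧
    iteratedDeriv 2 F (u * Real.exp (t / x)) ≠ 0 ∧
    e.g (t, x) = (t * x)⁻¹ * (m * x - t) ∧
    e.f (t, x, u) = (x ^ 2)⁻¹ * Real.exp (-(t / x)) * F (u * Real.exp (t / x))

/-- On `Ω` the equation `e` is one of the three equations invariant under the two-dimensional
non-commutative Lie algebra, and `V` is the algebra listed with it. -/
def ListedTwo (e : Equation) (Ω : Set Pt) (V : Submodule ℝ (Pt → Pt)) : Prop :=
  (∃ m k : ℝ, k ≠ 0 ∧ FormA221 m k e Ω ∧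
    V = Submodule.span ℝ {dilation, fun P => (P.1 ^ 2, P.2.1 ^ 2, m * P.1 * P.2.2)}) ∨
  (∃ m k : ℝ, k ≠ 0 ∧ FormA222 m k e Ω ∧
    V = Submodule.span ℝ {dilation, fun P => (P.1 ^ 2, 0, m * P.1 * P.2.2)}) ∨
  (∃ m : ℝ, FormA223 m e Ω ∧
    V = Submodule.span ℝ {dilation, fun P => (0, P.2.1 ^ 2, P.1 * P.2.2)})

/-- On a dense open subset of `Ω`, the equation `e` is locally equivalent to an equation of the
list `Listed`, by an equivalence transformation that carries the symmetry algebra of `e` on `Ω`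
onto the algebra listed with that equation. -/
def LocallyListed (Listed : Equation → Set Pt → Submodule ℝ (Pt → Pt) → Prop)
    (e : Equation) (Ω : TopologicalSpace.Opens Pt) : Prop :=
  ∃ O : Set Pt, IsOpen O ∧ O ⊆ Ω ∧ (Ω : Set Pt) ⊆ closure O ∧
    ∀ P ∈ O, ∃ (W : Set Pt) (Φ : Pt → Pt) (e' : Equation) (V : Submodule ℝ (Pt → Pt)),
      IsOpen W ∧ P ∈ W ∧ W ⊆ Ω ∧ IsEquivalence Φ W e e' ∧
      Listed e' (Φ '' W) V ∧ CarriesOnto Φ W (symAlg e Ω) V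

end GroupClass

end

/-! Lie's criterion is polynomial in the jet coordinates. Comparing coefficients gives, on every
box, `Q = τ(t) ∂_t + ξ(x) ∂_x + (h(t) u + μ(t, x)) ∂_u` with one equation for `g` and one for `f`
(`exists_boxForm`). The `x`-derivative of the first says that the area form `g_x dt dx` is
invariant. The `u`-derivative of the second says that `f_u` has the same weight as `g_x`, so `J =
f_u / g_x` is an invariant function, and `J_u = f_uu / g_x` is nonzero where the two conditions of
the class hold.

Every symmetry is therefore tangent to a level surface `u = σ(t, x)` of `J`, and a single
translation of `u` removes `μ` from all of them at once. On that surface put `ℓ = log |J_u|`; then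
`h = -(τ ℓ_t + ξ ℓ_x)`, so `h` is determined by `τ` and `ξ` (`BoxForm.chartForm`). Since `h` depends
on `t` only, the one-forms `β = ℓ_x dx` and `γ = (ℓ_t + g) dt` are invariant as well
(`Chart.preserves`). Their coefficients satisfy `∂_x (ℓ_t + g) = ∂_t ℓ_x + g_x` (`Chart.dx_gam`), so
they cannot both vanish identically.

A field that vanishes at a point of the plane and preserves a nowhere zero one of these forms and
the area form is zero (`Preserves.eq_zero`). A symmetry vanishing on an open set vanishes on the
whole domain (`symAlg_eq_zero_of_eqOn`). Hence evaluation of `(τ, ξ)` at one point embeds `L` into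
the plane, and `dim L ≤ 2`. If the dimension is two, the action on the plane is transitive, and the
same identity between the forms excludes commuting fields; this yields a basis with `[Q₁, Q₂] = Q₂`
(`exists_nonabelian_basis`).

It remains to straighten the fields. Transformations of the first kind suffice: `T` and `X` come
from primitives of `1/τ`, `1/ξ`, from the quotients `τ₂/τ₁`, `ξ₂/ξ₁`, or from `h` itself when the
`t`-component is zero, while `U` absorbs the vertical part. The determining equations are
transported to the new equation (`Pushed.reduced`) and integrated along the normalised fields
(`exists_formA11` and its companions, `exists_form_of_two_fields`). As this works inside every
nonempty open subset, the union of the neighbourhoods found is dense (`locallyListed_of`). -/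

noncomputable section

namespace GroupClass

/-! ### Partial derivatives -/

section

/-- `∂_t` on functions of `(t, x)`. -/
def dt (F : ℝ × ℝ → ℝ) (z : ℝ × ℝ) : ℝ := fderiv ℝ F z (1, 0)

/-- `∂_x` on functions of `(t, x)`. -/
def dx (F : ℝ × ℝ → ℝ) (z : ℝ × ℝ) : ℝ := fderiv ℝ F z (0, 1)

/-- `∂_t` on functions of `(t, x, u)`. -/
def d1 (F : Pt → ℝ) (P : Pt) : ℝ := fderiv ℝ F P (1, 0, 0)

/-- `∂_x` on functions of `(t, x, u)`. -/
def d2 (F : Pt → ℝ) (P : Pt) : ℝ := fderiv ℝ F P (0, 1, 0)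

/-- `∂_u` on functions of `(t, x, u)`. -/
def d3 (F : Pt → ℝ) (P : Pt) : ℝ := fderiv ℝ F P (0, 0, 1)

section general

variable {E : Type*} [NormedAddCommGroup E] [NormedSpace ℝ E]

theorem _root_.ContDiffAt.diff {G : Type*} [NormedAddCommGroup G] [NormedSpace ℝ G] {F : E → G} {z : E}
    (h : ContDiffAt ℝ ∞ F z) : DifferentiableAt ℝ F z := h.differentiableAt (by simp)

theorem contDiffAt_fderiv_apply {G : Type*} [NormedAddCommGroup G] [NormedSpace ℝ G]
    {F : E → G} {z : E} (h : ContDiffAt ℝ ∞ F z) (v : E) :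
    ContDiffAt ℝ ∞ (fun w => fderiv ℝ F w v) z :=
  (h.fderiv_right (m := ∞) (by simp)).clm_apply contDiffAt_const

theorem fderiv_fderiv_apply {G : Type*} [NormedAddCommGroup G] [NormedSpace ℝ G]
    {F : E → G} {z : E} (h : ContDiffAt ℝ ∞ F z) (v w : E) :
    fderiv ℝ (fun y => fderiv ℝ F y v) z w = fderiv ℝ (fderiv ℝ F) z w v := by
  have h1 : DifferentiableAt ℝ (fderiv ℝ F) z := (h.fderiv_right (m := ∞) (by simp)).diff
  rw [fderiv_clm_apply h1 (differentiableAt_const v)]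
  simp

theorem fderiv_fderiv_comm {G : Type*} [NormedAddCommGroup G] [NormedSpace ℝ G]
    {F : E → G} {z : E} (h : ContDiffAt ℝ ∞ F z) (v w : E) :
    fderiv ℝ (fderiv ℝ F) z w v = fderiv ℝ (fderiv ℝ F) z v w :=
  (h.isSymmSndFDerivAt (by simp only [minSmoothness_of_isRCLikeNormedField]; norm_cast)).eq w v

theorem fderiv_apply_comm {F : E → ℝ} {z : E} (h : ContDiffAt ℝ ∞ F z) (v w : E) :
    fderiv ℝ (fun y => fderiv ℝ F y v) z w = fderiv ℝ (fun y => fderiv ℝ F y w) z v := by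
  rw [fderiv_fderiv_apply h, fderiv_fderiv_apply h, fderiv_fderiv_comm h]

end general

theorem contDiffAt_deriv {F : ℝ → ℝ} {t : ℝ} (h : ContDiffAt ℝ ∞ F t) :
    ContDiffAt ℝ ∞ (deriv F) t := contDiffAt_fderiv_apply h 1

variable {F : ℝ × ℝ → ℝ} {z : ℝ × ℝ} {H : Pt → ℝ} {P : Pt}

theorem contDiffAt_dt (h : ContDiffAt ℝ ∞ F z) : ContDiffAt ℝ ∞ (dt F) z :=
  contDiffAt_fderiv_apply h _
theorem contDiffAt_dx (h : ContDiffAt ℝ ∞ F z) : ContDiffAt ℝ ∞ (dx F) z :=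
  contDiffAt_fderiv_apply h _
theorem contDiffAt_d1 (h : ContDiffAt ℝ ∞ H P) : ContDiffAt ℝ ∞ (d1 H) P :=
  contDiffAt_fderiv_apply h _
theorem contDiffAt_d2 (h : ContDiffAt ℝ ∞ H P) : ContDiffAt ℝ ∞ (d2 H) P :=
  contDiffAt_fderiv_apply h _
theorem contDiffAt_d3 (h : ContDiffAt ℝ ∞ H P) : ContDiffAt ℝ ∞ (d3 H) P :=
  contDiffAt_fderiv_apply h _

theorem dt_dx (h : ContDiffAt ℝ ∞ F z) : dt (dx F) z = dx (dt F) z := fderiv_apply_comm h _ _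
theorem d1_d3 (h : ContDiffAt ℝ ∞ H P) : d1 (d3 H) P = d3 (d1 H) P := fderiv_apply_comm h _ _
theorem d2_d3 (h : ContDiffAt ℝ ∞ H P) : d2 (d3 H) P = d3 (d2 H) P := fderiv_apply_comm h _ _

theorem fderiv_eq_dt_dx (F : ℝ × ℝ → ℝ) (z : ℝ × ℝ) (a b : ℝ) :
    fderiv ℝ F z (a, b) = a * dt F z + b * dx F z := by
  have : ((a, b) : ℝ × ℝ) = a • (1, 0) + b • (0, 1) := by simp
  rw [this, map_add, map_smul, map_smul]; rfl

theorem fderiv_eq_d (F : Pt → ℝ) (P : Pt) (a b c : ℝ) :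
    fderiv ℝ F P (a, b, c) = a * d1 F P + b * d2 F P + c * d3 F P := by
  have : ((a, b, c) : Pt) = a • (1, 0, 0) + b • (0, 1, 0) + c • (0, 0, 1) := by simp
  rw [this, map_add, map_add, map_smul, map_smul, map_smul]; rfl

/-! Slices -/

theorem hasDerivAt_dt {t x : ℝ} (h : DifferentiableAt ℝ F (t, x)) :
    HasDerivAt (fun s => F (s, x)) (dt F (t, x)) t :=
  h.hasFDerivAt.comp_hasDerivAt t ((hasDerivAt_id t).prodMk (hasDerivAt_const t x))

theorem hasDerivAt_dx {t x : ℝ} (h : DifferentiableAt ℝ F (t, x)) :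
    HasDerivAt (fun s => F (t, s)) (dx F (t, x)) x :=
  h.hasFDerivAt.comp_hasDerivAt x ((hasDerivAt_const x t).prodMk (hasDerivAt_id x))

theorem hasDerivAt_d1 {t x u : ℝ} (h : DifferentiableAt ℝ H (t, x, u)) :
    HasDerivAt (fun s => H (s, x, u)) (d1 H (t, x, u)) t :=
  h.hasFDerivAt.comp_hasDerivAt t
    ((hasDerivAt_id t).prodMk ((hasDerivAt_const t x).prodMk (hasDerivAt_const t u)))

theorem hasDerivAt_d2 {t x u : ℝ} (h : DifferentiableAt ℝ H (t, x, u)) :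
    HasDerivAt (fun s => H (t, s, u)) (d2 H (t, x, u)) x :=
  h.hasFDerivAt.comp_hasDerivAt x
    ((hasDerivAt_const x t).prodMk ((hasDerivAt_id x).prodMk (hasDerivAt_const x u)))

theorem hasDerivAt_d3 {t x u : ℝ} (h : DifferentiableAt ℝ H (t, x, u)) :
    HasDerivAt (fun s => H (t, x, s)) (d3 H (t, x, u)) u :=
  h.hasFDerivAt.comp_hasDerivAt u
    ((hasDerivAt_const u t).prodMk ((hasDerivAt_const u x).prodMk (hasDerivAt_id u)))

/-- Chain rule along a curve in the `(t, x)`-plane. -/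
theorem hasDerivAt_curve {a b : ℝ → ℝ} {a' b' s : ℝ} (h : DifferentiableAt ℝ F (a s, b s))
    (ha : HasDerivAt a a' s) (hb : HasDerivAt b b' s) :
    HasDerivAt (fun r => F (a r, b r)) (a' * dt F (a s, b s) + b' * dx F (a s, b s)) s := by
  rw [← fderiv_eq_dt_dx]
  exact h.hasFDerivAt.comp_hasDerivAt s (ha.prodMk hb)

/-- Chain rule along a curve in the `(t, x, u)`-space. -/
theorem hasDerivAt_curve₃ {a b c : ℝ → ℝ} {a' b' c' s : ℝ}
    (h : DifferentiableAt ℝ H (a s, b s, c s))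
    (ha : HasDerivAt a a' s) (hb : HasDerivAt b b' s) (hc : HasDerivAt c c' s) :
    HasDerivAt (fun r => H (a r, b r, c r))
      (a' * d1 H (a s, b s, c s) + b' * d2 H (a s, b s, c s) + c' * d3 H (a s, b s, c s)) s := by
  rw [← fderiv_eq_d]
  exact h.hasFDerivAt.comp_hasDerivAt s (ha.prodMk (hb.prodMk hc))

/-- A function that vanishes near a point has derivative zero there. -/
theorem _root_.HasDerivAt.eq_zero_of_eqOn {f : ℝ → ℝ} {c t : ℝ} {I : Set ℝ} (hf : HasDerivAt f c t)
    (hI : IsOpen I) (ht : t ∈ I) (h : ∀ s ∈ I, f s = 0) : c = 0 :=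
  hf.unique ((hasDerivAt_const t (0 : ℝ)).congr_of_eventuallyEq
    (Filter.eventually_of_mem (hI.mem_nhds ht) h))

theorem eq_of_hasDerivAt_zero {f : ℝ → ℝ} {I : Set ℝ} (hI : IsOpen I) (hc : IsPreconnected I)
    (hf : ∀ s ∈ I, HasDerivAt f 0 s) {s t : ℝ} (hs : s ∈ I) (ht : t ∈ I) : f s = f t :=
  hI.is_const_of_deriv_eq_zero hc
    (fun r hr => (hf r hr).differentiableAt.differentiableWithinAt)
    (fun r hr => (hf r hr).deriv) hs ht

/-! ### Intervals and boxes -/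

/-- Nonempty open intervals. -/
structure IsIntvl (I : Set ℝ) : Prop where
  isOpen : IsOpen I
  conn : IsPreconnected I
  nonempty : I.Nonempty

theorem isIntvl_ball (t : ℝ) {r : ℝ} (hr : 0 < r) : IsIntvl (Metric.ball t r) :=
  ⟨Metric.isOpen_ball, (convex_ball t r).isPreconnected, ⟨t, Metric.mem_ball_self hr⟩⟩

theorem exists_intvl_subset {S : Set ℝ} {t : ℝ} (hS : S ∈ 𝓝 t) :
    ∃ I, IsIntvl I ∧ t ∈ I ∧ I ⊆ S := by
  obtain ⟨r, hr, h⟩ := Metric.mem_nhds_iff.1 hS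
  exact ⟨_, isIntvl_ball t hr, Metric.mem_ball_self hr, h⟩

theorem exists_box_subset₂ {S : Set (ℝ × ℝ)} {t x : ℝ} (hS : S ∈ 𝓝 (t, x)) :
    ∃ I A, IsIntvl I ∧ IsIntvl A ∧ t ∈ I ∧ x ∈ A ∧ I ×ˢ A ⊆ S := by
  obtain ⟨r, hr, h⟩ := Metric.mem_nhds_iff.1 hS
  exact ⟨_, _, isIntvl_ball t hr, isIntvl_ball x hr, Metric.mem_ball_self hr,
    Metric.mem_ball_self hr, by rwa [ball_prod_same]⟩

theorem exists_box_subset₃ {S : Set Pt} {t x u : ℝ} (hS : S ∈ 𝓝 ((t, x, u) : Pt)) :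
    ∃ I A C, IsIntvl I ∧ IsIntvl A ∧ IsIntvl C ∧ t ∈ I ∧ x ∈ A ∧ u ∈ C ∧ I ×ˢ A ×ˢ C ⊆ S := by
  obtain ⟨r, hr, h⟩ := Metric.mem_nhds_iff.1 hS
  exact ⟨_, _, _, isIntvl_ball t hr, isIntvl_ball x hr, isIntvl_ball u hr,
    Metric.mem_ball_self hr, Metric.mem_ball_self hr, Metric.mem_ball_self hr,
    by rwa [ball_prod_same, ball_prod_same]⟩

/-- A smooth function on an interval has a smooth primitive. -/
theorem exists_primitive {I : Set ℝ} (hI : IsIntvl I) {f : ℝ → ℝ}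
    (hf : ∀ t ∈ I, ContDiffAt ℝ ∞ f t) :
    ∃ p : ℝ → ℝ, (∀ t ∈ I, ContDiffAt ℝ ∞ p t) ∧ ∀ t ∈ I, deriv p t = f t := by
  obtain ⟨a, ha⟩ := hI.nonempty
  have hc : ContinuousOn f I := fun t ht => (hf t ht).continuousAt.continuousWithinAt
  have hd : ∀ t ∈ I, HasDerivAt (fun t => ∫ s in a..t, f s) (f t) t := by
    intro t ht
    have hsub : uIcc a t ⊆ I := hI.conn.ordConnected.uIcc_subset ha ht
    exact intervalIntegral.integral_hasDerivAt_right
      ((hc.mono hsub).intervalIntegrable)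
      (hc.stronglyMeasurableAtFilter hI.isOpen t ht) (hf t ht).continuousAt
  have hs : ContDiffOn ℝ ∞ (fun t => ∫ s in a..t, f s) I := by
    refine (contDiffOn_infty_iff_deriv_of_isOpen hI.isOpen).2
      ⟨fun t ht => (hd t ht).differentiableAt.differentiableWithinAt, ?_⟩
    exact ContDiffOn.congr (fun t ht => (hf t ht).contDiffWithinAt) fun t ht => (hd t ht).deriv
  exact ⟨_, fun t ht => hs.contDiffAt (hI.isOpen.mem_nhds ht), fun t ht => (hd t ht).deriv⟩

/-- A smooth function with nonzero derivative has a smooth local inverse. -/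
theorem exists_local_inverse {I : Set ℝ} (hI : IsOpen I) {T : ℝ → ℝ} {t : ℝ} (ht : t ∈ I)
    (hT : ∀ s ∈ I, ContDiffAt ℝ ∞ T s) (hT' : ∀ s ∈ I, deriv T s ≠ 0) :
    ∃ (I₁ J₁ : Set ℝ) (S : ℝ → ℝ), IsOpen I₁ ∧ IsOpen J₁ ∧ t ∈ I₁ ∧ I₁ ⊆ I ∧
      (∀ s ∈ I₁, T s ∈ J₁ ∧ S (T s) = s) ∧
      (∀ r ∈ J₁, S r ∈ I₁ ∧ T (S r) = r) ∧ ∀ r ∈ J₁, ContDiffAt ℝ ∞ S r := by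
  have hd : HasFDerivAt T ((ContinuousLinearEquiv.unitsEquivAut ℝ
      (Units.mk0 _ (hT' t ht)) : ℝ ≃L[ℝ] ℝ) : ℝ →L[ℝ] ℝ) t :=
    (hT t ht).diff.hasDerivAt.hasFDerivAt_equiv (hT' t ht)
  -- Restricting the source to `I` keeps `T' ≠ 0` at every point of the source, so the inverse is
  -- smooth on the whole target and not only at `T t`.
  set p := ((hT t ht).toOpenPartialHomeomorph T hd (by simp)).restrOpen I hI with hp
  have hpT : ∀ s, p s = T s := fun s => rfl
  have hsrc : p.source ⊆ I := fun s hs => by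
    rw [hp, OpenPartialHomeomorph.restrOpen_source] at hs; exact hs.2
  refine ⟨p.source, p.target, p.symm, p.open_source, p.open_target, ?_, hsrc,
    fun s hs => ⟨p.map_source hs, p.left_inv hs⟩,
    fun r hr => ⟨p.map_target hr, p.right_inv hr⟩, fun r hr => ?_⟩
  · rw [hp, OpenPartialHomeomorph.restrOpen_source]
    exact ⟨ContDiffAt.mem_toOpenPartialHomeomorph_source _ _ _, ht⟩
  · have h1 := hsrc (p.map_target hr)
    exact p.contDiffAt_symm_deriv (hT' _ h1) hr (hT _ h1).diff.hasDerivAt (hT _ h1)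

end

section

theorem contDiffAt_slice₁ {H : Pt → ℝ} {t x u : ℝ} (h : ContDiffAt ℝ ∞ H (t, x, u)) :
    ContDiffAt ℝ ∞ (fun s => H (s, x, u)) t :=
  ContDiffAt.comp (f := fun s : ℝ => ((s, x, u) : Pt)) t h
    (contDiffAt_id.prodMk (contDiffAt_const.prodMk contDiffAt_const))

theorem contDiffAt_slice₂ {H : Pt → ℝ} {t x u : ℝ} (h : ContDiffAt ℝ ∞ H (t, x, u)) :
    ContDiffAt ℝ ∞ (fun s => H (t, s, u)) x :=
  ContDiffAt.comp (f := fun s : ℝ => ((t, s, u) : Pt)) x h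
    (contDiffAt_const.prodMk (contDiffAt_id.prodMk contDiffAt_const))

/-! ### The determining equations -/

/-- The jet enters `totX Q` twice: through the base point of the derivative of `Q`, and through
`u_x` in the direction. The two summands are these two contributions. -/
theorem fderiv_totX {Q : Pt → Pt} {j : Jet} (hQ : ContDiffAt ℝ ∞ Q (jetPt j)) (d : Jet) :
    fderiv ℝ (totX Q) j d = fderiv ℝ (fderiv ℝ Q) (jetPt j) (jetPt d) (0, 1, j.2.2.2.2)
      + fderiv ℝ Q (jetPt j) (0, 0, d.2.2.2.2) := by
  have h1 : HasFDerivAt (fderiv ℝ Q) (fderiv ℝ (fderiv ℝ Q) (jetPt j)) (jetPt j) :=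
    (hQ.fderiv_right (m := ∞) (by simp)).diff.hasFDerivAt
  let pr : Jet →L[ℝ] Pt := (ContinuousLinearMap.fst ℝ ℝ _).prod
    (((ContinuousLinearMap.fst ℝ ℝ _).comp (ContinuousLinearMap.snd ℝ ℝ _)).prod
      ((ContinuousLinearMap.fst ℝ ℝ _).comp
        ((ContinuousLinearMap.snd ℝ ℝ _).comp (ContinuousLinearMap.snd ℝ ℝ _))))
  have h2 : HasFDerivAt jetPt pr j := pr.hasFDerivAt
  let lam : Jet →L[ℝ] Pt := (0 : Jet →L[ℝ] ℝ).prod ((0 : Jet →L[ℝ] ℝ).prod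
      ((ContinuousLinearMap.snd ℝ ℝ ℝ).comp
        ((ContinuousLinearMap.snd ℝ ℝ _).comp
          ((ContinuousLinearMap.snd ℝ ℝ _).comp (ContinuousLinearMap.snd ℝ ℝ _)))))
  have h3 : HasFDerivAt (fun k : Jet => ((0, 1, k.2.2.2.2) : Pt)) lam j := by
    have : (fun k : Jet => ((0, 1, k.2.2.2.2) : Pt)) = fun k => (0, 1, 0) + lam k := by
      funext k; simp [lam]
    rw [this]
    exact lam.hasFDerivAt.const_add _
  have h4 := (h1.comp j h2).clm_apply h3
  have h5 : fderiv ℝ (totX Q) j = _ := h4.fderiv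
  rw [h5]
  simp [pr, lam, jetPt, add_comm]

/-- Written in this way the prolongation is visibly affine in `u_tt`, `u_tx` and `u_xx`, which
permits comparison of coefficients. -/
theorem phiTX_eq {Q : Pt → Pt} {t x u ut ux : ℝ} (hQ : ContDiffAt ℝ ∞ Q (t, x, u))
    (utt utx uxx : ℝ) :
    phiTX Q (t, x, u, ut, ux) utt utx uxx =
      (fderiv ℝ (fderiv ℝ Q) (t, x, u) (1, 0, ut) (0, 1, ux)
          + fderiv ℝ Q (t, x, u) (0, 0, utx)).2.2
        - utt * (fderiv ℝ Q (t, x, u) (0, 1, ux)).1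
        - ut * (fderiv ℝ (fderiv ℝ Q) (t, x, u) (1, 0, ut) (0, 1, ux)
          + fderiv ℝ Q (t, x, u) (0, 0, utx)).1
        - utx * (fderiv ℝ Q (t, x, u) (0, 1, ux)).2.1
        - ux * (fderiv ℝ (fderiv ℝ Q) (t, x, u) (1, 0, ut) (0, 1, ux)
          + fderiv ℝ Q (t, x, u) (0, 0, utx)).2.1
        - utx * (fderiv ℝ Q (t, x, u) (1, 0, ut)).1
        - uxx * (fderiv ℝ Q (t, x, u) (1, 0, ut)).2.1 := by
  set j : Jet := (t, x, u, ut, ux) with hj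
  have hd : DifferentiableAt ℝ (totX Q) j := by
    have h2 : DifferentiableAt ℝ (fun k => fderiv ℝ Q (jetPt k)) j :=
      (show ContDiffAt ℝ ∞ (fderiv ℝ Q) (jetPt j) from
        hQ.fderiv_right (m := ∞) (by simp)).diff.comp j (contDiff_jetPt.contDiffAt.diff)
    have h3 : DifferentiableAt ℝ (fun k : Jet => ((0, 1, k.2.2.2.2) : Pt)) j := by fun_prop
    exact h2.clm_apply h3
  have h := hd.hasFDerivAt
  have hut : HasFDerivAt (fun k : Jet => k.2.2.2.1) _ j :=
    (hasFDerivAt_id (𝕜 := ℝ) j).snd.snd.snd.fst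
  have hux : HasFDerivAt (fun k : Jet => k.2.2.2.2) _ j :=
    (hasFDerivAt_id (𝕜 := ℝ) j).snd.snd.snd.snd
  have hphi := ((h.snd.snd).sub (hut.mul h.fst)).sub (hux.mul h.snd.fst)
  have hphi' : fderiv ℝ (phiX Q) j = _ := hphi.fderiv
  have hT := fderiv_totX (j := j) hQ (1, 0, ut, utt, utx)
  unfold phiTX
  rw [hphi']
  simp only [ContinuousLinearMap.comp_apply, sub_apply, add_apply, smul_apply,
    ContinuousLinearMap.coe_snd', ContinuousLinearMap.coe_fst', hj] at hT ⊢
  rw [hT]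
  simp only [totX, totT, jetPt, smul_eq_mul, ContinuousLinearMap.id_apply]
  ring

variable {e : Equation} {Ω : TopologicalSpace.Opens Pt} {Q : Pt → Pt} {P : Pt}

theorem symAlg_contDiffAt (hQ : Q ∈ symAlg e Ω) (hP : P ∈ Ω) : ContDiffAt ℝ ∞ Q P :=
  hQ.1.contDiffAt (Ω.isOpen.mem_nhds hP)

theorem contDiffAt_comp₁ (h : ContDiffAt ℝ ∞ Q P) : ContDiffAt ℝ ∞ (fun R => (Q R).1) P := h.fst
theorem contDiffAt_comp₂ (h : ContDiffAt ℝ ∞ Q P) : ContDiffAt ℝ ∞ (fun R => (Q R).2.1) P :=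
  h.snd.fst
theorem contDiffAt_comp₃ (h : ContDiffAt ℝ ∞ Q P) : ContDiffAt ℝ ∞ (fun R => (Q R).2.2) P :=
  h.snd.snd

theorem fderiv_comp₁ (h : ContDiffAt ℝ ∞ Q P) (v : Pt) :
    (fderiv ℝ Q P v).1 = fderiv ℝ (fun R => (Q R).1) P v := by
  rw [h.diff.hasFDerivAt.fst.fderiv]; rfl
theorem fderiv_comp₂ (h : ContDiffAt ℝ ∞ Q P) (v : Pt) :
    (fderiv ℝ Q P v).2.1 = fderiv ℝ (fun R => (Q R).2.1) P v := by
  rw [h.diff.hasFDerivAt.snd.fst.fderiv]; rfl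
theorem fderiv_comp₃ (h : ContDiffAt ℝ ∞ Q P) (v : Pt) :
    (fderiv ℝ Q P v).2.2 = fderiv ℝ (fun R => (Q R).2.2) P v := by
  rw [h.diff.hasFDerivAt.snd.snd.fderiv]; rfl

/-- The coefficients of the free coordinates `u_tt` and `u_xx` are `-D_x τ` and `-D_t ξ`. Both must
vanish, and the values `0` and `1` of `u_x`, respectively `u_t`, separate the two partial
derivatives in each. -/
theorem symAlg_first_order (hQ : Q ∈ symAlg e Ω) (hP : P ∈ Ω) :
    d2 (fun R => (Q R).1) P = 0 ∧ d3 (fun R => (Q R).1) P = 0 ∧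
      d1 (fun R => (Q R).2.1) P = 0 ∧ d3 (fun R => (Q R).2.1) P = 0 := by
  obtain ⟨t, x, u⟩ := P
  have hc := symAlg_contDiffAt hQ hP
  have key := fun ut ux utt uxx => hQ.2.2 (t, x, u, ut, ux) hP utt uxx
  have hs : ∀ ut ux utt utx uxx, phiTX Q (t, x, u, ut, ux) utt utx uxx = _ :=
    fun ut ux utt utx uxx => phiTX_eq hc utt utx uxx
  simp only [jetPt, hs] at key
  have e1 := key 0 0 0 0
  have e2 := key 0 0 1 0
  have e3 := key 0 0 0 1
  have e4 := key 0 1 0 0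
  have e5 := key 0 1 1 0
  have e6 := key 1 0 0 0
  have e7 := key 1 0 0 1
  have a1 : (fderiv ℝ Q (t, x, u) (0, 1, 0)).1 = 0 := by linarith
  have a2 : (fderiv ℝ Q (t, x, u) (1, 0, 0)).2.1 = 0 := by linarith
  have a3 : (fderiv ℝ Q (t, x, u) (0, 1, 1)).1 = 0 := by linarith
  have a4 : (fderiv ℝ Q (t, x, u) (1, 0, 1)).2.1 = 0 := by linarith
  rw [fderiv_comp₁ hc, fderiv_eq_d] at a1 a3
  rw [fderiv_comp₂ hc, fderiv_eq_d] at a2 a4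
  refine ⟨?_, ?_, ?_, ?_⟩ <;> linarith

/-- Once `τ = τ(t)` and `ξ = ξ(x)`, the criterion is a polynomial in `u_t`, `u_x` of degree at most
one in each. The four conclusions are its coefficients at `u_t u_x`, `u_t`, `u_x` and `1`. -/
theorem symAlg_second_order (hQ : Q ∈ symAlg e Ω) (hP : P ∈ Ω) :
    d3 (d3 fun R => (Q R).2.2) P = 0 ∧ d2 (d3 fun R => (Q R).2.2) P = 0 ∧
    d1 (d3 fun R => (Q R).2.2) P = (Q P).1 * dt e.g (base P) + (Q P).2.1 * dx e.g (base P)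
      + d1 (fun R => (Q R).1) P * e.g (base P) ∧
    d1 (d2 fun R => (Q R).2.2) P
      + e.f P * (d3 (fun R => (Q R).2.2) P - d2 (fun R => (Q R).2.1) P - d1 (fun R => (Q R).1) P)
      - e.g (base P) * d2 (fun R => (Q R).2.2) P
      - ((Q P).1 * d1 e.f P + (Q P).2.1 * d2 e.f P + (Q P).2.2 * d3 e.f P) = 0 := by
  obtain ⟨t, x, u⟩ := P
  have hc := symAlg_contDiffAt hQ hP
  have hfo := fun R (hR : R ∈ Ω) => symAlg_first_order hQ hR
  obtain ⟨b1, b2, b3, b4⟩ := hfo _ hP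
  have hev : ∀ᶠ R in 𝓝 ((t, x, u) : Pt), R ∈ Ω := Ω.isOpen.mem_nhds hP
  have hA1 : ∀ ut ux, (fderiv ℝ (fderiv ℝ Q) (t, x, u) (1, 0, ut) (0, 1, ux)).1 = 0 := by
    intro ut ux
    rw [← fderiv_fderiv_apply hc, fderiv_comp₁ (contDiffAt_fderiv_apply hc _)]
    have : (fun R => (fderiv ℝ Q R (0, 1, ux)).1) =ᶠ[𝓝 ((t, x, u) : Pt)] fun _ => 0 := by
      filter_upwards [hev] with R hR
      rw [fderiv_comp₁ (symAlg_contDiffAt hQ hR), fderiv_eq_d]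
      obtain ⟨b1, b2, -, -⟩ := hfo _ hR
      rw [b1, b2]; ring
    rw [this.fderiv_eq]; simp
  -- For `ξ` it is the derivative along `(1, 0, u_t)` that vanishes nearby, so the order of
  -- differentiation is interchanged first.
  have hA2 : ∀ ut ux, (fderiv ℝ (fderiv ℝ Q) (t, x, u) (1, 0, ut) (0, 1, ux)).2.1 = 0 := by
    intro ut ux
    rw [fderiv_fderiv_comm hc, ← fderiv_fderiv_apply hc,
      fderiv_comp₂ (contDiffAt_fderiv_apply hc _)]
    have : (fun R => (fderiv ℝ Q R (1, 0, ut)).2.1) =ᶠ[𝓝 ((t, x, u) : Pt)] fun _ => 0 := by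
      filter_upwards [hev] with R hR
      rw [fderiv_comp₂ (symAlg_contDiffAt hQ hR), fderiv_eq_d]
      obtain ⟨-, -, b1, b2⟩ := hfo _ hR
      rw [b1, b2]; ring
    rw [this.fderiv_eq]; simp
  have hA3 : ∀ ut ux, (fderiv ℝ (fderiv ℝ Q) (t, x, u) (1, 0, ut) (0, 1, ux)).2.2
      = d1 (d2 fun R => (Q R).2.2) (t, x, u) + ut * d2 (d3 fun R => (Q R).2.2) (t, x, u)
        + ux * d1 (d3 fun R => (Q R).2.2) (t, x, u)
        + ut * ux * d3 (d3 fun R => (Q R).2.2) (t, x, u) := by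
    intro ut ux
    rw [← fderiv_fderiv_apply hc, fderiv_comp₃ (contDiffAt_fderiv_apply hc _)]
    have : (fun R => (fderiv ℝ Q R (0, 1, ux)).2.2) =ᶠ[𝓝 ((t, x, u) : Pt)]
        fun R => d2 (fun R => (Q R).2.2) R + ux * d3 (fun R => (Q R).2.2) R := by
      filter_upwards [hev] with R hR
      rw [fderiv_comp₃ (symAlg_contDiffAt hQ hR), fderiv_eq_d]
      ring
    have hc3 := contDiffAt_comp₃ hc
    rw [this.fderiv_eq, fderiv_fun_add (contDiffAt_d2 hc3).diff
      ((contDiffAt_d3 hc3).diff.const_mul _), fderiv_const_mul (contDiffAt_d3 hc3).diff]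
    simp only [add_apply, smul_apply, fderiv_eq_d, smul_eq_mul, d2_d3 hc3]
    ring
  have key := fun ut ux => hQ.2.2 (t, x, u, ut, ux) hP 0 0
  have hs : ∀ ut ux utt utx uxx, phiTX Q (t, x, u, ut, ux) utt utx uxx = _ :=
    fun ut ux utt utx uxx => phiTX_eq hc utt utx uxx
  have hb : base (Q (t, x, u)) = ((Q (t, x, u)).1, (Q (t, x, u)).2.1) := rfl
  have hb' : Q (t, x, u) = ((Q (t, x, u)).1, (Q (t, x, u)).2.1, (Q (t, x, u)).2.2) := rfl
  simp only [jetPt, hs, Prod.fst_add, Prod.snd_add, hA1, hA2, hA3, phiX, totX, hb,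
    fderiv_comp₁ hc, fderiv_comp₂ hc, fderiv_comp₃ hc, fderiv_eq_dt_dx, fderiv_eq_d,
    b1, b2, b3, b4] at key
  have hff : fderiv ℝ e.f (t, x, u) (Q (t, x, u)) = (Q (t, x, u)).1 * d1 e.f (t, x, u)
      + (Q (t, x, u)).2.1 * d2 e.f (t, x, u) + (Q (t, x, u)).2.2 * d3 e.f (t, x, u) := by
    conv_lhs => rw [hb']
    exact fderiv_eq_d _ _ _ _ _
  rw [hff] at key
  -- A polynomial of degree at most one in each of two variables is determined by its values at the
  -- four vertices of the unit square.
  have e1 := key 0 0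
  have e2 := key 0 1
  have e3 := key 1 0
  have e4 := key 1 1
  ring_nf at e1 e2 e3 e4
  refine ⟨?_, ?_, ?_, ?_⟩ <;> ring_nf <;> linarith

/-- The components of a symmetry on a box: `Q = τ(t) ∂_t + ξ(x) ∂_x + (h(t) u + μ(t, x)) ∂_u`,
together with the determining equations. -/
structure BoxForm (e : Equation) (Q : Pt → Pt) (I A C : Set ℝ) (τ ξ h : ℝ → ℝ)
    (μ : ℝ × ℝ → ℝ) : Prop where
  smooth_τ : ∀ t ∈ I, ContDiffAt ℝ ∞ τ t
  smooth_ξ : ∀ x ∈ A, ContDiffAt ℝ ∞ ξ x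
  smooth_h : ∀ t ∈ I, ContDiffAt ℝ ∞ h t
  smooth_μ : ∀ t ∈ I, ∀ x ∈ A, ContDiffAt ℝ ∞ μ (t, x)
  eq : ∀ t ∈ I, ∀ x ∈ A, ∀ u ∈ C, Q (t, x, u) = (τ t, ξ x, h t * u + μ (t, x))
  det_g : ∀ t ∈ I, ∀ x ∈ A, deriv h t
    = τ t * dt e.g (t, x) + ξ x * dx e.g (t, x) + deriv τ t * e.g (t, x)
  det_f : ∀ t ∈ I, ∀ x ∈ A, ∀ u ∈ C,
    dt (dx μ) (t, x) + e.f (t, x, u) * (h t - deriv ξ x - deriv τ t)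
      - e.g (t, x) * dx μ (t, x) - (τ t * d1 e.f (t, x, u) + ξ x * d2 e.f (t, x, u)
        + (h t * u + μ (t, x)) * d3 e.f (t, x, u)) = 0

theorem eq_of_d_zero {I A C : Set ℝ} (hA : IsIntvl A) (hC : IsIntvl C)
    {H : Pt → ℝ} (hH : ∀ t ∈ I, ∀ x ∈ A, ∀ u ∈ C, DifferentiableAt ℝ H (t, x, u))
    {x x' u u' t : ℝ} (ht : t ∈ I) (hx : x ∈ A) (hx' : x' ∈ A) (hu : u ∈ C) (hu' : u' ∈ C)
    (h2 : ∀ t ∈ I, ∀ x ∈ A, ∀ u ∈ C, d2 H (t, x, u) = 0)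
    (h3 : ∀ t ∈ I, ∀ x ∈ A, ∀ u ∈ C, d3 H (t, x, u) = 0) : H (t, x, u) = H (t, x', u') := by
  have e1 : H (t, x, u) = H (t, x', u) :=
    eq_of_hasDerivAt_zero hA.isOpen hA.conn
      (fun s hs => h2 t ht s hs u hu ▸ hasDerivAt_d2 (hH t ht s hs u hu)) hx hx'
  have e2 : H (t, x', u) = H (t, x', u') :=
    eq_of_hasDerivAt_zero hC.isOpen hC.conn
      (fun s hs => h3 t ht x' hx' s hs ▸ hasDerivAt_d3 (hH t ht x' hx' s hs)) hu hu'
  rw [e1, e2]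

/-- On a box all coordinate slices are intervals, so the vanishing partial derivatives can be
integrated: `τ`, `ξ` and `η_u` depend only on `t`, `x` and `t` respectively, and may be read off
with the other coordinates frozen. -/
theorem exists_boxForm (hQ : Q ∈ symAlg e Ω) {I A C : Set ℝ}
    (hI : IsIntvl I) (hA : IsIntvl A) (hC : IsIntvl C)
    (hΩ : ∀ t ∈ I, ∀ x ∈ A, ∀ u ∈ C, (t, x, u) ∈ Ω) :
    ∃ τ ξ h μ, BoxForm e Q I A C τ ξ h μ := by
  obtain ⟨t₀, ht₀⟩ := hI.nonempty
  obtain ⟨x₀, hx₀⟩ := hA.nonempty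
  obtain ⟨u₀, hu₀⟩ := hC.nonempty
  have hc : ∀ t ∈ I, ∀ x ∈ A, ∀ u ∈ C, ContDiffAt ℝ ∞ Q (t, x, u) :=
    fun t ht x hx u hu => symAlg_contDiffAt hQ (hΩ t ht x hx u hu)
  have hc1 := fun t ht x hx u hu => contDiffAt_comp₁ (hc t ht x hx u hu)
  have hc2 := fun t ht x hx u hu => contDiffAt_comp₂ (hc t ht x hx u hu)
  have hc3 := fun t ht x hx u hu => contDiffAt_comp₃ (hc t ht x hx u hu)
  have hfo := fun t ht x hx u hu => symAlg_first_order hQ (hΩ t ht x hx u hu)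
  have hso := fun t ht x hx u hu => symAlg_second_order hQ (hΩ t ht x hx u hu)
  set q1 : Pt → ℝ := fun R => (Q R).1 with hq1
  set q2 : Pt → ℝ := fun R => (Q R).2.1 with hq2
  set q3 : Pt → ℝ := fun R => (Q R).2.2 with hq3
  set τ : ℝ → ℝ := fun t => q1 (t, x₀, u₀) with hτ
  set ξ : ℝ → ℝ := fun x => q2 (t₀, x, u₀) with hξ
  set h : ℝ → ℝ := fun t => d3 q3 (t, x₀, u₀) with hh
  -- The difference `η - h u` does not depend on `u`; its value at `u₀` serves as `μ`.
  set μ : ℝ × ℝ → ℝ := fun z => q3 (z.1, z.2, u₀) - h z.1 * u₀ with hμ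
  have Hτ : ∀ t ∈ I, ∀ x ∈ A, ∀ u ∈ C, q1 (t, x, u) = τ t := fun t ht x hx u hu =>
    eq_of_d_zero hA hC (fun t ht x hx u hu => (hc1 t ht x hx u hu).diff) ht hx hx₀ hu hu₀
      (fun t ht x hx u hu => (hfo t ht x hx u hu).1)
      (fun t ht x hx u hu => (hfo t ht x hx u hu).2.1)
  have Hξ : ∀ t ∈ I, ∀ x ∈ A, ∀ u ∈ C, q2 (t, x, u) = ξ x := by
    intro t ht x hx u hu
    have e1 : q2 (t, x, u) = q2 (t₀, x, u) :=
      eq_of_hasDerivAt_zero (f := fun s => q2 (s, x, u)) hI.isOpen hI.conn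
        (fun s hs => (hfo s hs x hx u hu).2.2.1 ▸ hasDerivAt_d1 (hc2 s hs x hx u hu).diff) ht ht₀
    have e2 : q2 (t₀, x, u) = q2 (t₀, x, u₀) :=
      eq_of_hasDerivAt_zero (f := fun s => q2 (t₀, x, s)) hC.isOpen hC.conn
        (fun s hs => (hfo t₀ ht₀ x hx s hs).2.2.2 ▸ hasDerivAt_d3 (hc2 t₀ ht₀ x hx s hs).diff)
        hu hu₀
    rw [e1, e2]
  have Hh : ∀ t ∈ I, ∀ x ∈ A, ∀ u ∈ C, d3 q3 (t, x, u) = h t := fun t ht x hx u hu =>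
    eq_of_d_zero hA hC (fun t ht x hx u hu => (contDiffAt_d3 (hc3 t ht x hx u hu)).diff)
      ht hx hx₀ hu hu₀
      (fun t ht x hx u hu => (hso t ht x hx u hu).2.1)
      (fun t ht x hx u hu => (hso t ht x hx u hu).1)
  have Hμ : ∀ t ∈ I, ∀ x ∈ A, ∀ u ∈ C, q3 (t, x, u) = h t * u + μ (t, x) := by
    intro t ht x hx u hu
    have := eq_of_hasDerivAt_zero (f := fun s => q3 (t, x, s) - h t * s) hC.isOpen hC.conn
      (fun s hs => by
        have := (hasDerivAt_d3 (hc3 t ht x hx s hs).diff).fun_sub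
          ((hasDerivAt_id s).const_mul (h t))
        rwa [Hh t ht x hx s hs, mul_one, sub_self] at this) hu hu₀
    simp only [hμ]
    linarith
  have sτ : ∀ t ∈ I, ContDiffAt ℝ ∞ τ t := fun t ht =>
    contDiffAt_slice₁ (hc1 t ht x₀ hx₀ u₀ hu₀)
  have sξ : ∀ x ∈ A, ContDiffAt ℝ ∞ ξ x := fun x hx =>
    contDiffAt_slice₂ (hc2 t₀ ht₀ x hx u₀ hu₀)
  have sh : ∀ t ∈ I, ContDiffAt ℝ ∞ h t := fun t ht =>
    contDiffAt_slice₁ (contDiffAt_d3 (hc3 t ht x₀ hx₀ u₀ hu₀))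
  have sμ : ∀ t ∈ I, ∀ x ∈ A, ContDiffAt ℝ ∞ μ (t, x) := fun t ht x hx =>
    (ContDiffAt.comp (f := fun z : ℝ × ℝ => ((z.1, z.2, u₀) : Pt)) (t, x)
      (hc3 t ht x hx u₀ hu₀)
      (contDiffAt_fst.prodMk (contDiffAt_snd.prodMk contDiffAt_const))).sub
      (((sh t ht).comp (t, x) contDiffAt_fst).mul contDiffAt_const)
  have dτ : ∀ t ∈ I, ∀ x ∈ A, ∀ u ∈ C, d1 q1 (t, x, u) = deriv τ t := by
    intro t ht x hx u hu
    refine (((sτ t ht).diff.hasDerivAt.congr_of_eventuallyEq ?_).unique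
      (hasDerivAt_d1 (hc1 t ht x hx u hu).diff)).symm
    exact Filter.eventually_of_mem (hI.isOpen.mem_nhds ht) fun s hs => Hτ s hs x hx u hu
  have dξ : ∀ t ∈ I, ∀ x ∈ A, ∀ u ∈ C, d2 q2 (t, x, u) = deriv ξ x := by
    intro t ht x hx u hu
    refine (((sξ x hx).diff.hasDerivAt.congr_of_eventuallyEq ?_).unique
      (hasDerivAt_d2 (hc2 t ht x hx u hu).diff)).symm
    exact Filter.eventually_of_mem (hA.isOpen.mem_nhds hx) fun s hs => Hξ t ht s hs u hu
  have dh : ∀ t ∈ I, ∀ x ∈ A, ∀ u ∈ C, d1 (d3 q3) (t, x, u) = deriv h t := by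
    intro t ht x hx u hu
    refine (((sh t ht).diff.hasDerivAt.congr_of_eventuallyEq ?_).unique
      (hasDerivAt_d1 (contDiffAt_d3 (hc3 t ht x hx u hu)).diff)).symm
    exact Filter.eventually_of_mem (hI.isOpen.mem_nhds ht) fun s hs => Hh s hs x hx u hu
  have dμ : ∀ t ∈ I, ∀ x ∈ A, ∀ u ∈ C, d2 q3 (t, x, u) = dx μ (t, x) := by
    intro t ht x hx u hu
    refine ((((hasDerivAt_dx (sμ t ht x hx).diff).const_add
      (h t * u)).congr_of_eventuallyEq ?_).unique
      (hasDerivAt_d2 (hc3 t ht x hx u hu).diff)).symm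
    exact Filter.eventually_of_mem (hA.isOpen.mem_nhds hx) fun s hs => Hμ t ht s hs u hu
  have dμ' : ∀ t ∈ I, ∀ x ∈ A, ∀ u ∈ C, d1 (d2 q3) (t, x, u) = dt (dx μ) (t, x) := by
    intro t ht x hx u hu
    refine (((hasDerivAt_dt (contDiffAt_dx (sμ t ht x hx)).diff).congr_of_eventuallyEq ?_).unique
      (hasDerivAt_d1 (contDiffAt_d2 (hc3 t ht x hx u hu)).diff)).symm
    exact Filter.eventually_of_mem (hI.isOpen.mem_nhds ht) fun s hs => dμ s hs x hx u hu
  have HQ : ∀ t ∈ I, ∀ x ∈ A, ∀ u ∈ C, Q (t, x, u) = (τ t, ξ x, h t * u + μ (t, x)) := by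
    intro t ht x hx u hu
    rw [← Hτ t ht x hx u hu, ← Hξ t ht x hx u hu, ← Hμ t ht x hx u hu]
  refine ⟨τ, ξ, h, μ, sτ, sξ, sh, sμ, HQ, fun t ht x hx => ?_, fun t ht x hx u hu => ?_⟩
  · have := (hso t ht x hx u₀ hu₀).2.2.1
    rw [dh t ht x hx u₀ hu₀, dτ t ht x hx u₀ hu₀, HQ t ht x hx u₀ hu₀] at this
    exact this
  · have := (hso t ht x hx u hu).2.2.2
    rw [dμ' t ht x hx u hu, dμ t ht x hx u hu, dτ t ht x hx u hu, dξ t ht x hx u hu,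
      Hh t ht x hx u hu, HQ t ht x hx u hu] at this
    exact this

end

/-! ### Unique continuation of symmetries -/

section

variable {e : Equation} {Ω : TopologicalSpace.Opens Pt} {Q : Pt → Pt}

/-- The density `g_x dt dx` is invariant under the flow of `τ ∂_t + ξ ∂_x`. -/
theorem density_of_det {g : ℝ × ℝ → ℝ} {I A : Set ℝ} {τ ξ h : ℝ → ℝ} (hA : IsOpen A)
    (hξ : ∀ x ∈ A, ContDiffAt ℝ ∞ ξ x) (hg : ∀ t ∈ I, ∀ x ∈ A, ContDiffAt ℝ ∞ g (t, x))
    (hdet : ∀ t ∈ I, ∀ x ∈ A, deriv h t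
      = τ t * dt g (t, x) + ξ x * dx g (t, x) + deriv τ t * g (t, x))
    {t x : ℝ} (ht : t ∈ I) (hx : x ∈ A) :
    deriv τ t * dx g (t, x) + τ t * dt (dx g) (t, x)
      + (deriv ξ x * dx g (t, x) + ξ x * dx (dx g) (t, x)) = 0 := by
  have hgx := hg t ht x hx
  have h1 := (((((hasDerivAt_dx (contDiffAt_dt hgx).diff).const_mul (τ t)).fun_add
    ((hξ x hx).diff.hasDerivAt.fun_mul (hasDerivAt_dx (contDiffAt_dx hgx).diff))).fun_add
    ((hasDerivAt_dx hgx.diff).const_mul (deriv τ t))).sub_const (deriv h t)).eq_zero_of_eqOn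
    hA hx (fun s hs => by rw [hdet t ht s hs]; ring)
  rw [dt_dx hgx]
  linarith

namespace BoxForm

variable {I A C : Set ℝ} {τ ξ h : ℝ → ℝ} {μ : ℝ × ℝ → ℝ}

theorem density (b : BoxForm e Q I A C τ ξ h μ) (hA : IsOpen A)
    (hg : ∀ t ∈ I, ∀ x ∈ A, ContDiffAt ℝ ∞ e.g (t, x)) {t x : ℝ} (ht : t ∈ I) (hx : x ∈ A) :
    deriv τ t * dx e.g (t, x) + τ t * dt (dx e.g) (t, x)
      + (deriv ξ x * dx e.g (t, x) + ξ x * dx (dx e.g) (t, x)) = 0 :=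
  density_of_det hA b.smooth_ξ hg b.det_g ht hx

/-- The `u`-derivative of the determining equation for `f`, in which the terms in `μ_tx` and `g μ_x`
drop out. The weight of `f_u` equals that of `g_x`, and this makes `f_u / g_x` invariant. -/
theorem det_fu (b : BoxForm e Q I A C τ ξ h μ) (hC : IsOpen C)
    (hf : ∀ t ∈ I, ∀ x ∈ A, ∀ u ∈ C, ContDiffAt ℝ ∞ e.f (t, x, u))
    {t x u : ℝ} (ht : t ∈ I) (hx : x ∈ A) (hu : u ∈ C) :
    τ t * d1 (d3 e.f) (t, x, u) + ξ x * d2 (d3 e.f) (t, x, u)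
      + (h t * u + μ (t, x)) * d3 (d3 e.f) (t, x, u)
      = -(deriv τ t + deriv ξ x) * d3 e.f (t, x, u) := by
  have hfx := hf t ht x hx u hu
  have hlin : HasDerivAt (fun s => h t * s + μ (t, x)) (h t) u := by
    simpa using ((hasDerivAt_id u).const_mul (h t)).add_const (μ (t, x))
  have h1 := ((((hasDerivAt_d3 hfx.diff).mul_const (h t - deriv ξ x - deriv τ t)).const_add
    (dt (dx μ) (t, x))).sub_const (e.g (t, x) * dx μ (t, x))).fun_sub
    ((((hasDerivAt_d3 (contDiffAt_d1 hfx).diff).const_mul (τ t)).fun_add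
    ((hasDerivAt_d3 (contDiffAt_d2 hfx).diff).const_mul (ξ x))).fun_add
    (hlin.fun_mul (hasDerivAt_d3 (contDiffAt_d3 hfx).diff)))
  have h2 := h1.eq_zero_of_eqOn hC hu (fun s hs => b.det_f t ht x hx s hs)
  rw [d1_d3 hfx, d2_d3 hfx]
  linarith

/-- With `τ = ξ = 0` the preceding identity reads `(h u + μ) f_uu = 0`. If `h u + μ` were nonzero at
a point, it would be nonzero nearby, and `f_uu` would vanish on an open set. -/
theorem vertical_eq_zero (b : BoxForm e Q I A C τ ξ h μ) (hI : IsOpen I) (hA : IsOpen A)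
    (hC : IsOpen C)
    (hf : ∀ t ∈ I, ∀ x ∈ A, ∀ u ∈ C, ContDiffAt ℝ ∞ e.f (t, x, u))
    (hfuu : ∀ S : Set Pt, IsOpen S → S.Nonempty → S ⊆ I ×ˢ A ×ˢ C → ∃ P ∈ S, e.fuu P ≠ 0)
    (hτ : ∀ t ∈ I, τ t = 0) (hξ : ∀ x ∈ A, ξ x = 0) {t x u : ℝ} (ht : t ∈ I) (hx : x ∈ A)
    (hu : u ∈ C) : Q (t, x, u) = 0 := by
  have key : ∀ t ∈ I, ∀ x ∈ A, ∀ u ∈ C,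
      (h t * u + μ (t, x)) * d3 (d3 e.f) (t, x, u) = 0 := by
    intro t ht x hx u hu
    have h1 := b.det_fu hC hf ht hx hu
    have h2 := (b.smooth_τ t ht).diff.hasDerivAt.eq_zero_of_eqOn hI ht hτ
    have h3 := (b.smooth_ξ x hx).diff.hasDerivAt.eq_zero_of_eqOn hA hx hξ
    rw [h2, h3, hτ t ht, hξ x hx] at h1
    linarith
  rw [b.eq t ht x hx u hu, hτ t ht, hξ x hx]
  suffices h t * u + μ (t, x) = 0 by rw [this]; rfl
  by_contra hne
  have hcont : ContinuousAt (fun P : Pt => h P.1 * P.2.2 + μ (P.1, P.2.1)) (t, x, u) := by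
    have c1 : ContinuousAt (fun P : Pt => h P.1) (t, x, u) :=
      ContinuousAt.comp (f := fun P : Pt => P.1) (b.smooth_h t ht).continuousAt (by fun_prop)
    have c2 : ContinuousAt (fun P : Pt => μ (P.1, P.2.1)) (t, x, u) :=
      ContinuousAt.comp (f := fun P : Pt => (P.1, P.2.1)) (b.smooth_μ t ht x hx).continuousAt
        (by fun_prop)
    have c3 : ContinuousAt (fun P : Pt => P.2.2) (t, x, u) := by fun_prop
    exact (c1.mul c3).add c2
  have hnhds := (hcont.eventually_ne hne).and
    (((hI.prod (hA.prod hC)).mem_nhds (show ((t, x, u) : Pt) ∈ I ×ˢ A ×ˢ C from ⟨ht, hx, hu⟩)))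
  obtain ⟨S, hS, hSo, hmem⟩ := mem_nhds_iff.1 hnhds
  obtain ⟨⟨t', x', u'⟩, hP, hPne⟩ := hfuu S hSo ⟨_, hmem⟩ fun R hR => (hS hR).2
  obtain ⟨hne', ht', hx', hu'⟩ := hS hP
  rcases mul_eq_zero.1 (key t' ht' x' hx' u' hu') with h0 | h0
  · exact hne' h0
  · exact hPne h0

/-- A symmetry whose components vanish on small intervals vanishes on the box. -/
theorem unique_continuation (b : BoxForm e Q I A C τ ξ h μ) (hI : IsIntvl I) (hA : IsIntvl A)
    (hC : IsIntvl C)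
    (hg : ∀ t ∈ I, ∀ x ∈ A, ContDiffAt ℝ ∞ e.g (t, x))
    (hf : ∀ t ∈ I, ∀ x ∈ A, ∀ u ∈ C, ContDiffAt ℝ ∞ e.f (t, x, u))
    (hgx : ∀ S : Set Pt, IsOpen S → S.Nonempty → S ⊆ I ×ˢ A ×ˢ C → ∃ P ∈ S, e.gx (base P) ≠ 0)
    (hfuu : ∀ S : Set Pt, IsOpen S → S.Nonempty → S ⊆ I ×ˢ A ×ˢ C → ∃ P ∈ S, e.fuu P ≠ 0)
    {I' A' : Set ℝ} (hI' : IsIntvl I') (hA' : A'.Nonempty) (hII : I' ⊆ I) (hAA : A' ⊆ A)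
    (hτ : ∀ t ∈ I', τ t = 0) (hξ : ∀ x ∈ A', ξ x = 0) {t x u : ℝ} (ht : t ∈ I) (hx : x ∈ A)
    (hu : u ∈ C) : Q (t, x, u) = 0 := by
  obtain ⟨x₁, hx₁⟩ := hA'
  obtain ⟨t₁, ht₁⟩ := hI'.nonempty
  have dξK : ∀ t ∈ I, ∀ x ∈ A, HasDerivAt (fun s => ξ s * dx e.g (t, s))
      (deriv ξ x * dx e.g (t, x) + ξ x * dx (dx e.g) (t, x)) x := fun t ht x hx =>
    (b.smooth_ξ x hx).diff.hasDerivAt.fun_mul (hasDerivAt_dx (contDiffAt_dx (hg t ht x hx)).diff)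
  have dτK : ∀ t ∈ I, ∀ x ∈ A, HasDerivAt (fun s => τ s * dx e.g (s, x))
      (deriv τ t * dx e.g (t, x) + τ t * dt (dx e.g) (t, x)) t := fun t ht x hx =>
    (b.smooth_τ t ht).diff.hasDerivAt.fun_mul (hasDerivAt_dt (contDiffAt_dx (hg t ht x hx)).diff)
  -- For `t ∈ I'` the terms with `τ` drop out of the invariance of `g_x dt dx`, leaving `(ξ g_x)_x =
  -- 0`. The constant `ξ g_x` is zero at `x₁ ∈ A'`.
  have hξK : ∀ t ∈ I', ∀ x ∈ A, ξ x * dx e.g (t, x) = 0 := by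
    intro t ht x hx
    have hz : ∀ s ∈ A, HasDerivAt (fun s => ξ s * dx e.g (t, s)) 0 s := by
      intro s hs
      have h1 := b.density hA.isOpen hg (hII ht) hs
      have h2 := (b.smooth_τ t (hII ht)).diff.hasDerivAt.eq_zero_of_eqOn hI'.isOpen ht hτ
      rw [h2, hτ t ht, zero_mul, zero_mul, zero_add, zero_add] at h1
      exact h1 ▸ dξK t (hII ht) s hs
    have := eq_of_hasDerivAt_zero hA.isOpen hA.conn hz hx (hAA hx₁)
    rw [this, hξ x₁ hx₁, zero_mul]
  -- Here `g_x` may have zeros, but not on an open set; a nonzero value of `ξ` would persist on an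
  -- interval and force `g_x = 0` on an open box.
  have hξ0 : ∀ x ∈ A, ξ x = 0 := by
    intro x hx
    by_contra hne
    obtain ⟨A₁, hA₁, hxA₁, hsub⟩ := exists_intvl_subset
      (((b.smooth_ξ x hx).continuousAt.eventually_ne hne).and (hA.isOpen.mem_nhds hx))
    obtain ⟨⟨t', x', u'⟩, ⟨ht', hx', -⟩, hPne⟩ := hgx (I' ×ˢ A₁ ×ˢ C)
      (hI'.isOpen.prod (hA₁.isOpen.prod hC.isOpen)) ⟨(t₁, x, u), ht₁, hxA₁, hu⟩
      fun R hR => ⟨hII hR.1, (hsub hR.2.1).2, hR.2.2⟩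
    rcases mul_eq_zero.1 (hξK t' ht' x' (hsub hx').2) with h0 | h0
    · exact (hsub hx').1 h0
    · exact hPne h0
  -- Now `ξ = 0` on all of `A`, so the same argument runs in the `t`-direction.
  have hτK : ∀ t ∈ I, ∀ x ∈ A, τ t * dx e.g (t, x) = 0 := by
    intro t ht x hx
    have hz : ∀ s ∈ I, HasDerivAt (fun s => τ s * dx e.g (s, x)) 0 s := by
      intro s hs
      have h1 := b.density hA.isOpen hg hs hx
      have h2 := (b.smooth_ξ x hx).diff.hasDerivAt.eq_zero_of_eqOn hA.isOpen hx hξ0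
      rw [h2, hξ0 x hx, zero_mul, zero_mul, add_zero, add_zero] at h1
      exact h1 ▸ dτK s hs x hx
    have := eq_of_hasDerivAt_zero (f := fun s => τ s * dx e.g (s, x)) hI.isOpen hI.conn hz ht
      (hII ht₁)
    rw [this, hτ t₁ ht₁, zero_mul]
  have hτ0 : ∀ t ∈ I, τ t = 0 := by
    intro t ht
    by_contra hne
    obtain ⟨I₁, hI₁, htI₁, hsub⟩ := exists_intvl_subset
      (((b.smooth_τ t ht).continuousAt.eventually_ne hne).and (hI.isOpen.mem_nhds ht))
    obtain ⟨⟨t', x', u'⟩, ⟨ht', hx', -⟩, hPne⟩ := hgx (I₁ ×ˢ A ×ˢ C)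
      (hI₁.isOpen.prod (hA.isOpen.prod hC.isOpen)) ⟨(t, x, u), htI₁, hx, hu⟩
      fun R hR => ⟨(hsub hR.1).2, hR.2.1, hR.2.2⟩
    rcases mul_eq_zero.1 (hτK t' (hsub ht').2 x' hx') with h0 | h0
    · exact (hsub ht').1 h0
    · exact hPne h0
  exact b.vertical_eq_zero hI.isOpen hA.isOpen hC.isOpen hf hfuu hτ0 hξ0 ht hx hu

end BoxForm

theorem Equation.InClass.exists_gx_ne (he : e.InClass Ω) {S : Set Pt} (hS : IsOpen S)
    (hne : S.Nonempty) (hSΩ : S ⊆ Ω) : ∃ P ∈ S, e.gx (base P) ≠ 0 := by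
  obtain ⟨P, hP⟩ := hne
  obtain ⟨R, hR, -, hR'⟩ := mem_closure_iff.1 (he.gx_ne (hSΩ hP)) S hS hP
  exact ⟨R, hR, hR'⟩

theorem Equation.InClass.exists_fuu_ne (he : e.InClass Ω) {S : Set Pt} (hS : IsOpen S)
    (hne : S.Nonempty) (hSΩ : S ⊆ Ω) : ∃ P ∈ S, e.fuu P ≠ 0 := by
  obtain ⟨P, hP⟩ := hne
  obtain ⟨R, hR, -, hR'⟩ := mem_closure_iff.1 (he.fuu_ne (hSΩ hP)) S hS hP
  exact ⟨R, hR, hR'⟩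

/-- A symmetry that vanishes on a nonempty open subset of a domain vanishes. -/
theorem symAlg_eq_zero_of_eqOn (hΩ : IsConnected (Ω : Set Pt)) (he : e.InClass Ω)
    (hQ : Q ∈ symAlg e Ω) {S : Set Pt} (hS : IsOpen S) (hne : S.Nonempty) (hSΩ : S ⊆ Ω)
    (h0 : ∀ P ∈ S, Q P = 0) : Q = 0 := by
  set Z : Set Pt := interior {P | Q P = 0} with hZ
  have hSZ : S ⊆ Z := interior_maximal (fun P hP => h0 P hP) hS
  have hsub : (Ω : Set Pt) ⊆ Z := by
    -- The interior of the zero set is relatively closed in `Ω`: a box around a limit point meets it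
    -- in a smaller box, and the zero spreads from there to the whole box.
    refine hΩ.isPreconnected.subset_of_closure_inter_subset isOpen_interior ?_ ?_
    · obtain ⟨P, hP⟩ := hne
      exact ⟨P, hSΩ hP, hSZ hP⟩
    · rintro ⟨t, x, u⟩ ⟨hcl, hP⟩
      obtain ⟨I, A, C, hI, hA, hC, ht, hx, hu, hbox⟩ :=
        exists_box_subset₃ (Ω.isOpen.mem_nhds hP)
      have hbox' : ∀ t ∈ I, ∀ x ∈ A, ∀ u ∈ C, (t, x, u) ∈ Ω :=
        fun t ht x hx u hu => hbox ⟨ht, hx, hu⟩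
      obtain ⟨τ, ξ, h, μ, b⟩ := exists_boxForm hQ hI hA hC hbox'
      have hBo : IsOpen (I ×ˢ A ×ˢ C) := hI.isOpen.prod (hA.isOpen.prod hC.isOpen)
      obtain ⟨⟨t₁, x₁, u₁⟩, hB₁, hZ₁⟩ := mem_closure_iff.1 hcl _ hBo ⟨ht, hx, hu⟩
      obtain ⟨I', A', C', hI', hA', hC', ht₁, hx₁, hu₁, hsub'⟩ :=
        exists_box_subset₃ ((hBo.inter isOpen_interior).mem_nhds ⟨hB₁, hZ₁⟩)
      have hz : ∀ t ∈ I', ∀ x ∈ A', τ t = 0 ∧ ξ x = 0 := by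
        intro t ht x hx
        obtain ⟨⟨m1, m2, m3⟩, m4⟩ := hsub' (show ((t, x, u₁) : Pt) ∈ _ from ⟨ht, hx, hu₁⟩)
        have h1 : Q (t, x, u₁) = 0 := interior_subset (s := {P | Q P = 0}) m4
        rw [b.eq t m1 x m2 u₁ m3] at h1
        exact ⟨congrArg Prod.fst h1, congrArg (fun p : Pt => p.2.1) h1⟩
      have hall : ∀ R ∈ I ×ˢ A ×ˢ C, Q R = 0 := by
        rintro ⟨t', x', u'⟩ ⟨ht', hx', hu'⟩
        exact b.unique_continuation hI hA hC
          (fun t ht x hx => he.smooth_g _ (hbox' t ht x hx u hu))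
          (fun t ht x hx u hu => he.smooth_f _ (hbox' t ht x hx u hu))
          (fun S hS hne hsub => he.exists_gx_ne hS hne (hsub.trans hbox))
          (fun S hS hne hsub => he.exists_fuu_ne hS hne (hsub.trans hbox))
          hI' hA'.nonempty
          (fun t ht => (hsub' (show ((t, x₁, u₁) : Pt) ∈ _ from ⟨ht, hx₁, hu₁⟩)).1.1)
          (fun x hx => (hsub' (show ((t₁, x, u₁) : Pt) ∈ _ from ⟨ht₁, hx, hu₁⟩)).1.2.1)
          (fun t ht => (hz t ht x₁ hx₁).1) (fun x hx => (hz t₁ ht₁ x hx).2) ht' hx' hu'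
      exact mem_interior.2 ⟨_, hall, hBo, ⟨ht, hx, hu⟩⟩
  funext P
  by_cases hP : P ∈ Ω
  · exact interior_subset (s := {P | Q P = 0}) (hsub hP)
  · exact hQ.2.1 P hP

end

/-! ### Level surfaces -/

section

theorem isInvertible_of_ne_zero {L : ℝ →L[ℝ] ℝ} (h : L 1 ≠ 0) : L.IsInvertible := by
  refine ⟨ContinuousLinearEquiv.unitsEquivAut ℝ (Units.mk0 _ h), ?_⟩
  ext
  simp

/-- Reassociation of the coordinates `((t, x), u)`. -/
def assoc (w : (ℝ × ℝ) × ℝ) : Pt := (w.1.1, w.1.2, w.2)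

theorem contDiff_assoc : ContDiff ℝ ∞ assoc := by unfold assoc; fun_prop

/-- This is the implicit function theorem, with smoothness of `σ` at every point of a box and not
merely at the base point. -/
theorem exists_level_surface {J : Pt → ℝ} {N : Set Pt} (hN : IsOpen N) {t₀ x₀ u₀ : ℝ}
    (hP : ((t₀, x₀, u₀) : Pt) ∈ N) (hJ : ∀ P ∈ N, ContDiffAt ℝ ∞ J P)
    (hJu : ∀ P ∈ N, d3 J P ≠ 0) :
    ∃ (I A C : Set ℝ) (σ : ℝ × ℝ → ℝ), IsIntvl I ∧ IsIntvl A ∧ IsIntvl C ∧ I ×ˢ A ×ˢ C ⊆ N ∧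
      ∀ t ∈ I, ∀ x ∈ A, ContDiffAt ℝ ∞ σ (t, x) ∧ σ (t, x) ∈ C ∧
        J (t, x, σ (t, x)) = J (t₀, x₀, u₀) := by
  set f : (ℝ × ℝ) × ℝ → ℝ := fun w => J (assoc w) with hf
  have cdf : ∀ w, assoc w ∈ N → ContDiffAt ℝ ∞ f w := fun w hw =>
    (hJ _ hw).comp w contDiff_assoc.contDiffAt
  have if₂ : ∀ w, assoc w ∈ N →
      (fderiv ℝ f w ∘L ContinuousLinearMap.inr ℝ (ℝ × ℝ) ℝ).IsInvertible := by
    rintro ⟨z, u⟩ hw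
    refine isInvertible_of_ne_zero ?_
    have h1 : HasDerivAt (fun s => f (z, s)) (fderiv ℝ f (z, u) (0, 1)) u :=
      HasFDerivAt.comp_hasDerivAt (f := fun s => (z, s)) u (cdf (z, u) hw).diff.hasFDerivAt
        ((hasDerivAt_const u z).prodMk (hasDerivAt_id u))
    have h2 := h1.unique (hasDerivAt_d3 (hJ _ hw).diff)
    have h3 : (fderiv ℝ f (z, u) ∘L ContinuousLinearMap.inr ℝ (ℝ × ℝ) ℝ) 1
        = d3 J (assoc (z, u)) := by
      rw [← show _ = d3 J (assoc (z, u)) from h2]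
      simp
    rw [h3]
    exact hJu _ hw
  have hn : (∞ : ℕ∞ω) ≠ 0 := by simp
  set w₀ : (ℝ × ℝ) × ℝ := ((t₀, x₀), u₀) with hw₀
  have hw₀N : assoc w₀ ∈ N := hP
  set σ := (cdf w₀ hw₀N).implicitFunction hn (if₂ w₀ hw₀N) with hσ
  have hσ0 : σ (t₀, x₀) = u₀ := (cdf w₀ hw₀N).implicitFunction_apply_self hn (if₂ w₀ hw₀N)
  have hσs : ContDiffAt ℝ ∞ σ (t₀, x₀) :=
    (cdf w₀ hw₀N).contDiffAt_implicitFunction hn (if₂ w₀ hw₀N)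
  obtain ⟨I, A, C, hI, hA, hC, ht, hx, hu, hbox⟩ := exists_box_subset₃ (hN.mem_nhds hP)
  -- `ContDiffAt` of order `∞` at one point gives only each finite order nearby. Continuity is all
  -- that is extracted here; full smoothness is recovered below point by point.
  have hcont : ∀ᶠ z in 𝓝 (t₀, x₀), ContinuousAt σ z :=
    ((hσs.of_le (m := 1) (by norm_cast)).eventually (by simp)).mono
      fun z hz => hz.continuousAt
  have hC' : ∀ᶠ z in 𝓝 (t₀, x₀), σ z ∈ C :=
    hσs.continuousAt.eventually (hC.isOpen.mem_nhds (by rwa [hσ0]))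
  have hlev : ∀ᶠ z in 𝓝 (t₀, x₀), f (z, σ z) = f w₀ :=
    (cdf w₀ hw₀N).eventually_apply_implicitFunction hn (if₂ w₀ hw₀N)
  have hIA : ∀ᶠ z in 𝓝 (t₀, x₀), z ∈ I ×ˢ A := (hI.isOpen.prod hA.isOpen).mem_nhds ⟨ht, hx⟩
  obtain ⟨I', A', hI', hA', ht', hx', hsub⟩ := exists_box_subset₂
    (hcont.and (hC'.and (hlev.and hIA)))
  refine ⟨I', A', C, σ, hI', hA', hC, fun R hR => hbox ?_, fun t ht x hx => ⟨?_, ?_, ?_⟩⟩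
  · have h1 := (hsub (show ((R.1, R.2.1) : ℝ × ℝ) ∈ I' ×ˢ A' from ⟨hR.1, hR.2.1⟩)).2.2.2
    exact ⟨h1.1, h1.2, hR.2.2⟩
  · obtain ⟨h1, h2, h3, h4⟩ := hsub (show ((t, x) : ℝ × ℝ) ∈ I' ×ˢ A' from ⟨ht, hx⟩)
    set w : (ℝ × ℝ) × ℝ := ((t, x), σ (t, x)) with hw
    have hwN : assoc w ∈ N := hbox ⟨h4.1, h4.2, h2⟩
    -- By local uniqueness, `σ` agrees near `(t, x)` with the implicit function constructed at `(t,
    -- x)` itself, which is smooth there.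
    have hev : ∀ᶠ z in 𝓝 (t, x),
        f (z, σ z) = f w ↔ (cdf w hwN).implicitFunction hn (if₂ w hwN) z = σ z := by
      have hc : ContinuousAt (fun z : ℝ × ℝ => (z, σ z)) (t, x) := continuousAt_id.prodMk h1
      exact hc.eventually
        ((cdf w hwN).eventually_apply_eq_iff_implicitFunction hn (if₂ w hwN))
    refine ((cdf w hwN).contDiffAt_implicitFunction hn (if₂ w hwN)).congr_of_eventuallyEq ?_
    filter_upwards [hev, (hI'.isOpen.prod hA'.isOpen).mem_nhds ⟨ht, hx⟩] with z hz hz'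
    exact (hz.1 ((hsub hz').2.2.1.trans h3.symm)).symm
  · exact (hsub (show ((t, x) : ℝ × ℝ) ∈ I' ×ˢ A' from ⟨ht, hx⟩)).2.1
  · exact (hsub (show ((t, x) : ℝ × ℝ) ∈ I' ×ˢ A' from ⟨ht, hx⟩)).2.2.1

/-! ### Normalising charts -/

/-- The value of `∂_t ∂_x - g ∂_x` on `σ`. -/
def defect (g σ : ℝ × ℝ → ℝ) (z : ℝ × ℝ) : ℝ := dt (dx σ) z - g z * dx σ z

/-- On a box, `Q = τ(t) ∂_t + ξ(x) ∂_x + η ∂_u` is tangent to the surface `u = σ(t, x)`, multiplies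
`u - σ` by `h(t)`, and `h` is the derivative of `-ℓ` along `τ ∂_t + ξ ∂_x`. -/
structure ChartForm (e : Equation) (Q : Pt → Pt) (I A C : Set ℝ) (σ ℓ : ℝ × ℝ → ℝ)
    (τ ξ h : ℝ → ℝ) : Prop where
  smooth_τ : ∀ t ∈ I, ContDiffAt ℝ ∞ τ t
  smooth_ξ : ∀ x ∈ A, ContDiffAt ℝ ∞ ξ x
  smooth_h : ∀ t ∈ I, ContDiffAt ℝ ∞ h t
  eq : ∀ t ∈ I, ∀ x ∈ A, ∀ u ∈ C, Q (t, x, u)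
    = (τ t, ξ x, h t * (u - σ (t, x)) + (τ t * dt σ (t, x) + ξ x * dx σ (t, x)))
  log : ∀ t ∈ I, ∀ x ∈ A, h t = -(τ t * dt ℓ (t, x) + ξ x * dx ℓ (t, x))
  det_g : ∀ t ∈ I, ∀ x ∈ A, deriv h t
    = τ t * dt e.g (t, x) + ξ x * dx e.g (t, x) + deriv τ t * e.g (t, x)
  det_f : ∀ t ∈ I, ∀ x ∈ A, ∀ u ∈ C,
    τ t * d1 e.f (t, x, u) + ξ x * d2 e.f (t, x, u)
      + (h t * (u - σ (t, x)) + (τ t * dt σ (t, x) + ξ x * dx σ (t, x))) * d3 e.f (t, x, u)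
      - (τ t * dt (defect e.g σ) (t, x) + ξ x * dx (defect e.g σ) (t, x))
      = (h t - deriv ξ x - deriv τ t) * (e.f (t, x, u) - defect e.g σ (t, x))

/-- A box on which all fields of `L` are normalised by the same `σ` and `ℓ`. -/
structure Chart (e : Equation) (L : Submodule ℝ (Pt → Pt)) (I A C : Set ℝ)
    (σ ℓ : ℝ × ℝ → ℝ) : Prop where
  intvl_I : IsIntvl I
  intvl_A : IsIntvl A
  intvl_C : IsIntvl C
  smooth_g : ∀ t ∈ I, ∀ x ∈ A, ContDiffAt ℝ ∞ e.g (t, x)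
  smooth_f : ∀ t ∈ I, ∀ x ∈ A, ∀ u ∈ C, ContDiffAt ℝ ∞ e.f (t, x, u)
  gx_ne : ∀ t ∈ I, ∀ x ∈ A, dx e.g (t, x) ≠ 0
  fuu_ne : ∀ t ∈ I, ∀ x ∈ A, ∀ u ∈ C, d3 (d3 e.f) (t, x, u) ≠ 0
  smooth_σ : ∀ t ∈ I, ∀ x ∈ A, ContDiffAt ℝ ∞ σ (t, x)
  smooth_ℓ : ∀ t ∈ I, ∀ x ∈ A, ContDiffAt ℝ ∞ ℓ (t, x)
  sym : ∀ Q ∈ L, ∃ τ ξ h, ChartForm e Q I A C σ ℓ τ ξ h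

theorem ChartForm.mono {e : Equation} {Q : Pt → Pt} {I A C I' A' C' : Set ℝ} {σ ℓ : ℝ × ℝ → ℝ}
    {τ ξ h : ℝ → ℝ} (c : ChartForm e Q I A C σ ℓ τ ξ h) (hI : I' ⊆ I) (hA : A' ⊆ A)
    (hC : C' ⊆ C) : ChartForm e Q I' A' C' σ ℓ τ ξ h where
  smooth_τ t ht := c.smooth_τ t (hI ht)
  smooth_ξ x hx := c.smooth_ξ x (hA hx)
  smooth_h t ht := c.smooth_h t (hI ht)
  eq t ht x hx u hu := c.eq t (hI ht) x (hA hx) u (hC hu)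
  log t ht x hx := c.log t (hI ht) x (hA hx)
  det_g t ht x hx := c.det_g t (hI ht) x (hA hx)
  det_f t ht x hx u hu := c.det_f t (hI ht) x (hA hx) u (hC hu)

theorem Chart.mono {e : Equation} {L : Submodule ℝ (Pt → Pt)} {I A C I' A' C' : Set ℝ}
    {σ ℓ : ℝ × ℝ → ℝ} (c : Chart e L I A C σ ℓ) (hI' : IsIntvl I') (hA' : IsIntvl A')
    (hC' : IsIntvl C') (hI : I' ⊆ I) (hA : A' ⊆ A) (hC : C' ⊆ C) : Chart e L I' A' C' σ ℓ where
  intvl_I := hI'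
  intvl_A := hA'
  intvl_C := hC'
  smooth_g t ht x hx := c.smooth_g t (hI ht) x (hA hx)
  smooth_f t ht x hx u hu := c.smooth_f t (hI ht) x (hA hx) u (hC hu)
  gx_ne t ht x hx := c.gx_ne t (hI ht) x (hA hx)
  fuu_ne t ht x hx u hu := c.fuu_ne t (hI ht) x (hA hx) u (hC hu)
  smooth_σ t ht x hx := c.smooth_σ t (hI ht) x (hA hx)
  smooth_ℓ t ht x hx := c.smooth_ℓ t (hI ht) x (hA hx)
  sym Q hQ := by
    obtain ⟨τ, ξ, h, f⟩ := c.sym Q hQ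
    exact ⟨τ, ξ, h, f.mono hI hA hC⟩

theorem contDiffAt_defect {g σ : ℝ × ℝ → ℝ} {z : ℝ × ℝ} (hg : ContDiffAt ℝ ∞ g z)
    (hσ : ContDiffAt ℝ ∞ σ z) : ContDiffAt ℝ ∞ (defect g σ) z :=
  (contDiffAt_dt (contDiffAt_dx hσ)).sub (hg.mul (contDiffAt_dx hσ))

/-- A symmetry on a box is tangent to the level surfaces of `J = f_u / g_x`. -/
theorem BoxForm.chartForm {e : Equation} {Q : Pt → Pt} {I A C : Set ℝ} {τ ξ h : ℝ → ℝ}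
    {μ σ : ℝ × ℝ → ℝ} {k : ℝ} (b : BoxForm e Q I A C τ ξ h μ) (hI : IsOpen I) (hA : IsOpen A)
    (hC : IsOpen C)
    (hg : ∀ t ∈ I, ∀ x ∈ A, ContDiffAt ℝ ∞ e.g (t, x))
    (hf : ∀ t ∈ I, ∀ x ∈ A, ∀ u ∈ C, ContDiffAt ℝ ∞ e.f (t, x, u))
    (hgx : ∀ t ∈ I, ∀ x ∈ A, dx e.g (t, x) ≠ 0)
    (hfuu : ∀ t ∈ I, ∀ x ∈ A, ∀ u ∈ C, d3 (d3 e.f) (t, x, u) ≠ 0)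
    (hσ : ∀ t ∈ I, ∀ x ∈ A, ContDiffAt ℝ ∞ σ (t, x)) (hσC : ∀ t ∈ I, ∀ x ∈ A, σ (t, x) ∈ C)
    (hJ : ∀ t ∈ I, ∀ x ∈ A, d3 e.f (t, x, σ (t, x)) = k * dx e.g (t, x)) :
    ChartForm e Q I A C σ
      (fun z => Real.log (d3 (d3 e.f) (z.1, z.2, σ z) / dx e.g z)) τ ξ h := by
  have hslt : ∀ t ∈ I, ∀ x ∈ A, HasDerivAt (fun s => σ (s, x)) (dt σ (t, x)) t :=
    fun t ht x hx => hasDerivAt_dt (hσ t ht x hx).diff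
  have hslx : ∀ t ∈ I, ∀ x ∈ A, HasDerivAt (fun s => σ (t, s)) (dx σ (t, x)) x :=
    fun t ht x hx => hasDerivAt_dx (hσ t ht x hx).diff
  -- derivatives of the defining equation of the surface
  have ht1 : ∀ t ∈ I, ∀ x ∈ A, d1 (d3 e.f) (t, x, σ (t, x))
      + dt σ (t, x) * d3 (d3 e.f) (t, x, σ (t, x)) = k * dt (dx e.g) (t, x) := by
    intro t ht x hx
    have hF := contDiffAt_d3 (hf t ht x hx _ (hσC t ht x hx))
    have h1 := ((hasDerivAt_curve₃ hF.diff (hasDerivAt_id t) (hasDerivAt_const t x)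
      (hslt t ht x hx)).fun_sub ((hasDerivAt_dt
        (contDiffAt_dx (hg t ht x hx)).diff).const_mul k)).eq_zero_of_eqOn hI ht
        (fun s hs => by simp [hJ s hs x hx])
    simp only [id] at h1
    linarith
  have hx1 : ∀ t ∈ I, ∀ x ∈ A, d2 (d3 e.f) (t, x, σ (t, x))
      + dx σ (t, x) * d3 (d3 e.f) (t, x, σ (t, x)) = k * dx (dx e.g) (t, x) := by
    intro t ht x hx
    have hF := contDiffAt_d3 (hf t ht x hx _ (hσC t ht x hx))
    have h1 := ((hasDerivAt_curve₃ hF.diff (hasDerivAt_const x t) (hasDerivAt_id x)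
      (hslx t ht x hx)).fun_sub ((hasDerivAt_dx
        (contDiffAt_dx (hg t ht x hx)).diff).const_mul k)).eq_zero_of_eqOn hA hx
        (fun s hs => by simp [hJ t ht s hs])
    simp only [id] at h1
    linarith
  -- Differentiating `f_u = k g_x` along the surface and inserting the invariance of `f_u` and `g_x`
  -- cancels all weights. What remains is the component of `Q` transversal to the surface,
  -- multiplied by the nonzero `f_uu`.
  have htan : ∀ t ∈ I, ∀ x ∈ A, μ (t, x) = τ t * dt σ (t, x) + ξ x * dx σ (t, x)
      - h t * σ (t, x) := by
    intro t ht x hx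
    have h1 := b.det_fu hC hf ht hx (hσC t ht x hx)
    have h2 := b.density hA hg ht hx
    have h3 := hfuu t ht x hx _ (hσC t ht x hx)
    rw [hJ t ht x hx] at h1
    have h4 : (h t * σ (t, x) + μ (t, x) - (τ t * dt σ (t, x) + ξ x * dx σ (t, x)))
        * d3 (d3 e.f) (t, x, σ (t, x)) = 0 := by
      linear_combination h1 - τ t * ht1 t ht x hx - ξ x * hx1 t ht x hx - k * h2
    have := (mul_eq_zero.1 h4).resolve_right h3
    linarith
  refine ⟨b.smooth_τ, b.smooth_ξ, b.smooth_h, fun t ht x hx u hu => ?_, fun t ht x hx => ?_,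
    b.det_g, fun t ht x hx u hu => ?_⟩
  · rw [b.eq t ht x hx u hu, htan t ht x hx]
    congr 2
    ring
  · -- the logarithmic derivative
    have hfx := hf t ht x hx _ (hσC t ht x hx)
    have hF := contDiffAt_d3 (contDiffAt_d3 hfx)
    have hK := contDiffAt_dx (hg t ht x hx)
    have hK0 := hgx t ht x hx
    have hF0 := hfuu t ht x hx _ (hσC t ht x hx)
    have hj : DifferentiableAt ℝ
        (fun z : ℝ × ℝ => d3 (d3 e.f) (z.1, z.2, σ z) / dx e.g z) (t, x) := by
      have c1 : ContDiffAt ℝ ∞ (fun z : ℝ × ℝ => ((z.1, z.2, σ z) : Pt)) (t, x) :=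
        contDiffAt_fst.prodMk (contDiffAt_snd.prodMk (hσ t ht x hx))
      have c2 : ContDiffAt ℝ ∞ (fun z : ℝ × ℝ => d3 (d3 e.f) (z.1, z.2, σ z)) (t, x) :=
        ContDiffAt.comp (f := fun z : ℝ × ℝ => ((z.1, z.2, σ z) : Pt)) (t, x) hF c1
      exact (c2.div hK hK0).diff
    have hj0 : d3 (d3 e.f) (t, x, σ (t, x)) / dx e.g (t, x) ≠ 0 := div_ne_zero hF0 hK0
    have hlt := (hasDerivAt_dt (hj.log hj0)).unique
      (((hasDerivAt_curve₃ hF.diff (hasDerivAt_id t) (hasDerivAt_const t x)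
      (hslt t ht x hx)).fun_div (hasDerivAt_dt hK.diff) hK0).log hj0)
    have hlx := (hasDerivAt_dx (hj.log hj0)).unique
      (((hasDerivAt_curve₃ hF.diff (hasDerivAt_const x t) (hasDerivAt_id x)
      (hslx t ht x hx)).fun_div (hasDerivAt_dx hK.diff) hK0).log hj0)
    -- the derivative in `u` of the invariance of `f_u`
    have hlin : HasDerivAt (fun s => h t * s + μ (t, x)) (h t) (σ (t, x)) := by
      simpa using ((hasDerivAt_id (σ (t, x))).const_mul (h t)).add_const (μ (t, x))
    have hu1 := (((((hasDerivAt_d3 (contDiffAt_d1 (contDiffAt_d3 hfx)).diff).const_mul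
      (τ t)).fun_add ((hasDerivAt_d3 (contDiffAt_d2 (contDiffAt_d3 hfx)).diff).const_mul
      (ξ x))).fun_add (hlin.fun_mul (hasDerivAt_d3 hF.diff))).fun_sub
      ((hasDerivAt_d3 (contDiffAt_d3 hfx).diff).const_mul
        (-(deriv τ t + deriv ξ x)))).eq_zero_of_eqOn hC (hσC t ht x hx)
        (fun s hs => sub_eq_zero.2 (b.det_fu hC hf ht hx hs))
    rw [← d1_d3 (contDiffAt_d3 hfx), ← d2_d3 (contDiffAt_d3 hfx), htan t ht x hx] at hu1
    have h2 := b.density hA hg ht hx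
    rw [hlt, hlx]
    simp only [id]
    field_simp
    linear_combination (dx e.g (t, x)) * hu1 - d3 (d3 e.f) (t, x, σ (t, x)) * h2
  -- Write `D` for the defect of `σ`. Inserting `μ = τ σ_t + ξ σ_x - h σ` and the equation for `g`
  -- gives `μ_tx - g μ_x = τ D_t + ξ D_x - (h - ξ' - τ') D`, so the equation for `f` becomes one for
  -- `f - D`.
  · have hs := hσ t ht x hx
    have hgs := hg t ht x hx
    have hμx : ∀ t ∈ I, ∀ x ∈ A, dx μ (t, x) = τ t * dx (dt σ) (t, x)
        + (deriv ξ x * dx σ (t, x) + ξ x * dx (dx σ) (t, x)) - h t * dx σ (t, x) := by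
      intro t ht x hx
      have hs := hσ t ht x hx
      refine (hasDerivAt_dx (b.smooth_μ t ht x hx).diff).unique (HasDerivAt.congr_of_eventuallyEq
        ((((hasDerivAt_dx (contDiffAt_dt hs).diff).const_mul (τ t)).fun_add
        ((b.smooth_ξ x hx).diff.hasDerivAt.fun_mul
          (hasDerivAt_dx (contDiffAt_dx hs).diff))).fun_sub
        ((hasDerivAt_dx hs.diff).const_mul (h t))) ?_)
      exact Filter.eventually_of_mem (hA.mem_nhds hx) fun s hs => htan t ht s hs
    have hμtx : dt (dx μ) (t, x) = _ :=
      (hasDerivAt_dt (contDiffAt_dx (b.smooth_μ t ht x hx)).diff).unique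
      (HasDerivAt.congr_of_eventuallyEq
        ((((b.smooth_τ t ht).diff.hasDerivAt.fun_mul
          (hasDerivAt_dt (contDiffAt_dx (contDiffAt_dt hs)).diff)).fun_add
        (((hasDerivAt_dt (contDiffAt_dx hs).diff).const_mul (deriv ξ x)).fun_add
          ((hasDerivAt_dt (contDiffAt_dx (contDiffAt_dx hs)).diff).const_mul (ξ x)))).fun_sub
        ((b.smooth_h t ht).diff.hasDerivAt.fun_mul (hasDerivAt_dt (contDiffAt_dx hs).diff)))
        (Filter.eventually_of_mem (hI.mem_nhds ht) fun s hs => hμx s hs x hx))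
    have hdt : dt (defect e.g σ) (t, x) = _ :=
      (hasDerivAt_dt (contDiffAt_defect hgs hs).diff).unique
      ((hasDerivAt_dt (contDiffAt_dt (contDiffAt_dx hs)).diff).fun_sub
        ((hasDerivAt_dt hgs.diff).fun_mul (hasDerivAt_dt (contDiffAt_dx hs).diff)))
    have hdx : dx (defect e.g σ) (t, x) = _ :=
      (hasDerivAt_dx (contDiffAt_defect hgs hs).diff).unique
      ((hasDerivAt_dx (contDiffAt_dt (contDiffAt_dx hs)).diff).fun_sub
        ((hasDerivAt_dx hgs.diff).fun_mul (hasDerivAt_dx (contDiffAt_dx hs).diff)))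
    have hsym : ∀ t ∈ I, ∀ x ∈ A, dt (dx σ) (t, x) = dx (dt σ) (t, x) :=
      fun t ht x hx => dt_dx (hσ t ht x hx)
    have h4 : dt (dx (dt σ)) (t, x) = dt (dt (dx σ)) (t, x) := by
      have hev : (dx (dt σ)) =ᶠ[𝓝 (t, x)] dt (dx σ) := by
        filter_upwards [(hI.prod hA).mem_nhds ⟨ht, hx⟩] with z hz
        exact (hsym z.1 hz.1 z.2 hz.2).symm
      simp only [dt] at hev ⊢
      rw [hev.fderiv_eq]
    have h5 : dt (dx (dx σ)) (t, x) = dx (dt (dx σ)) (t, x) := dt_dx (contDiffAt_dx hs)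
    have hd := b.det_f t ht x hx u hu
    rw [hμtx, hμx t ht x hx, htan t ht x hx, h4, h5, ← hsym t ht x hx] at hd
    rw [hdt, hdx, defect]
    have hh := b.det_g t ht x hx
    linear_combination -hd - dx σ (t, x) * hh

/-- Near a point with `g_x ≠ 0` and `f_uu ≠ 0` the function `J = f_u / g_x` has `J_u ≠ 0`, and its
level surface provides `σ`. The construction involves only the equation, so one `σ` and one `ℓ`
serve all symmetries. -/
theorem exists_chart {e : Equation} {Ω : TopologicalSpace.Opens Pt} (he : e.InClass Ω)
    {N : Set Pt} (hN : IsOpen N) (hne : N.Nonempty) (hNΩ : N ⊆ Ω) :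
    ∃ I A C σ ℓ, I ×ˢ A ×ˢ C ⊆ N ∧ Chart e (symAlg e Ω) I A C σ ℓ := by
  have hcb : Continuous base := by unfold base; fun_prop
  have hsK : ∀ P ∈ Ω, ContDiffAt ℝ ∞ (fun R => dx e.g (base R)) P := fun P hP =>
    (contDiffAt_dx (he.smooth_g P hP)).comp P
      (show ContDiff ℝ ∞ base by unfold base; fun_prop).contDiffAt
  obtain ⟨P₁, hP₁, hK₁⟩ := he.exists_gx_ne hN hne hNΩ
  obtain ⟨N₁, hN₁, hN₁o, hP₁'⟩ := mem_nhds_iff.1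
    (((hsK P₁ (hNΩ hP₁)).continuousAt.eventually_ne hK₁).and (hN.mem_nhds hP₁))
  have hN₁Ω : N₁ ⊆ Ω := fun P hP => hNΩ (hN₁ hP).2
  obtain ⟨P₂, hP₂, hF₂⟩ := he.exists_fuu_ne hN₁o ⟨P₁, hP₁'⟩ hN₁Ω
  have hsF : ∀ P ∈ Ω, ContDiffAt ℝ ∞ (d3 (d3 e.f)) P := fun P hP =>
    contDiffAt_d3 (contDiffAt_d3 (he.smooth_f P hP))
  obtain ⟨N₂, hN₂, hN₂o, hP₂'⟩ := mem_nhds_iff.1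
    (((hsF P₂ (hN₁Ω hP₂)).continuousAt.eventually_ne hF₂).and (hN₁o.mem_nhds hP₂))
  have hN₂Ω : N₂ ⊆ Ω := fun P hP => hN₁Ω (hN₂ hP).2
  have hN₂K : ∀ P ∈ N₂, dx e.g (base P) ≠ 0 := fun P hP => (hN₁ (hN₂ hP).2).1
  have hN₂F : ∀ P ∈ N₂, d3 (d3 e.f) P ≠ 0 := fun P hP => (hN₂ hP).1
  have hJs : ∀ P ∈ N₂, ContDiffAt ℝ ∞ (fun R => d3 e.f R / dx e.g (base R)) P := fun P hP =>
    (contDiffAt_d3 (he.smooth_f P (hN₂Ω hP))).div (hsK P (hN₂Ω hP)) (hN₂K P hP)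
  obtain ⟨t₀, x₀, u₀⟩ := P₂
  obtain ⟨I, A, C, σ, hI, hA, hC, hsub, hσ⟩ := exists_level_surface hN₂o hP₂' hJs (by
    rintro ⟨t, x, u⟩ hP
    have h1 := (hasDerivAt_d3 (hJs _ hP).diff).unique
      ((hasDerivAt_d3 (contDiffAt_d3 (he.smooth_f _ (hN₂Ω hP))).diff).div_const (dx e.g (t, x)))
    rw [h1]
    exact div_ne_zero (hN₂F _ hP) (hN₂K _ hP))
  have hbΩ : ∀ t ∈ I, ∀ x ∈ A, ∀ u ∈ C, (t, x, u) ∈ N₂ := fun t ht x hx u hu =>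
    hsub ⟨ht, hx, hu⟩
  obtain ⟨u₁, hu₁⟩ := hC.nonempty
  set k := d3 e.f (t₀, x₀, u₀) / dx e.g (base (t₀, x₀, u₀)) with hk
  have hg : ∀ t ∈ I, ∀ x ∈ A, ContDiffAt ℝ ∞ e.g (t, x) := fun t ht x hx =>
    he.smooth_g _ (hN₂Ω (hbΩ t ht x hx u₁ hu₁))
  have hf : ∀ t ∈ I, ∀ x ∈ A, ∀ u ∈ C, ContDiffAt ℝ ∞ e.f (t, x, u) :=
    fun t ht x hx u hu => he.smooth_f _ (hN₂Ω (hbΩ t ht x hx u hu))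
  have hgx : ∀ t ∈ I, ∀ x ∈ A, dx e.g (t, x) ≠ 0 := fun t ht x hx =>
    hN₂K _ (hbΩ t ht x hx u₁ hu₁)
  have hfuu : ∀ t ∈ I, ∀ x ∈ A, ∀ u ∈ C, d3 (d3 e.f) (t, x, u) ≠ 0 :=
    fun t ht x hx u hu => hN₂F _ (hbΩ t ht x hx u hu)
  have hJ : ∀ t ∈ I, ∀ x ∈ A, d3 e.f (t, x, σ (t, x)) = k * dx e.g (t, x) := by
    intro t ht x hx
    have := (hσ t ht x hx).2.2
    exact (div_eq_iff (hgx t ht x hx)).1 this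
  refine ⟨I, A, C, σ, fun z => Real.log (d3 (d3 e.f) (z.1, z.2, σ z) / dx e.g z),
    fun P hP => (hN₁ (hN₂ (hsub hP)).2).2, hI, hA, hC, hg, hf, hgx, hfuu,
    fun t ht x hx => (hσ t ht x hx).1, fun t ht x hx => ?_, fun Q hQ => ?_⟩
  · have hσC := (hσ t ht x hx).2.1
    have c1 : ContDiffAt ℝ ∞ (fun z : ℝ × ℝ => ((z.1, z.2, σ z) : Pt)) (t, x) :=
      contDiffAt_fst.prodMk (contDiffAt_snd.prodMk (hσ t ht x hx).1)
    have c2 : ContDiffAt ℝ ∞ (fun z : ℝ × ℝ => d3 (d3 e.f) (z.1, z.2, σ z)) (t, x) :=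
      ContDiffAt.comp (f := fun z : ℝ × ℝ => ((z.1, z.2, σ z) : Pt)) (t, x)
        (contDiffAt_d3 (contDiffAt_d3 (hf t ht x hx _ hσC))) c1
    exact (c2.div (contDiffAt_dx (hg t ht x hx)) (hgx t ht x hx)).log
      (div_ne_zero (hfuu t ht x hx _ hσC) (hgx t ht x hx))
  · obtain ⟨τ, ξ, h, μ, b⟩ := exists_boxForm hQ hI hA hC
      fun t ht x hx u hu => hN₂Ω (hbΩ t ht x hx u hu)
    exact ⟨τ, ξ, h, b.chartForm hI.isOpen hA.isOpen hC.isOpen hg hf hgx hfuu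
      (fun t ht x hx => (hσ t ht x hx).1) (fun t ht x hx => (hσ t ht x hx).2.1) hJ⟩

end

/-! ### Relative invariants of fields in the `(t, x)`-plane -/

section

/-- `B` is a relative invariant of weight `(a, b)` of the field `τ(t) ∂_t + ξ(x) ∂_x`. -/
def RelInv (B : ℝ × ℝ → ℝ) (a b : ℝ) (I A : Set ℝ) (τ ξ : ℝ → ℝ) : Prop :=
  ∀ t ∈ I, ∀ x ∈ A, τ t * dt B (t, x) + ξ x * dx B (t, x)
    + (a * deriv τ t + b * deriv ξ x) * B (t, x) = 0

/-- The bracket of fields on the line. -/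
def bracket (τ₁ τ₂ : ℝ → ℝ) (t : ℝ) : ℝ := τ₁ t * deriv τ₂ t - τ₂ t * deriv τ₁ t

theorem contDiffAt_bracket {τ₁ τ₂ : ℝ → ℝ} {t : ℝ} (h₁ : ContDiffAt ℝ ∞ τ₁ t)
    (h₂ : ContDiffAt ℝ ∞ τ₂ t) : ContDiffAt ℝ ∞ (bracket τ₁ τ₂) t :=
  (h₁.mul (contDiffAt_deriv h₂)).sub (h₂.mul (contDiffAt_deriv h₁))

theorem deriv_bracket {τ₁ τ₂ : ℝ → ℝ} {t : ℝ} (h₁ : ContDiffAt ℝ ∞ τ₁ t)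
    (h₂ : ContDiffAt ℝ ∞ τ₂ t) :
    deriv (bracket τ₁ τ₂) t = τ₁ t * deriv (deriv τ₂) t - τ₂ t * deriv (deriv τ₁) t := by
  have h := (h₁.diff.hasDerivAt.fun_mul (contDiffAt_deriv h₂).diff.hasDerivAt).fun_sub
    (h₂.diff.hasDerivAt.fun_mul (contDiffAt_deriv h₁).diff.hasDerivAt)
  have : deriv (bracket τ₁ τ₂) t = _ := h.deriv
  rw [this]
  ring

/-- The commutator of two Lie derivatives is the Lie derivative along the bracket: apply each field
to the other's equation and subtract. The second derivatives of `B` cancel by symmetry. -/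
theorem RelInv.bracket {B : ℝ × ℝ → ℝ} {a b : ℝ} {I A : Set ℝ} {τ₁ ξ₁ τ₂ ξ₂ : ℝ → ℝ}
    (h₁ : RelInv B a b I A τ₁ ξ₁) (h₂ : RelInv B a b I A τ₂ ξ₂) (hI : IsOpen I) (hA : IsOpen A)
    (hB : ∀ t ∈ I, ∀ x ∈ A, ContDiffAt ℝ ∞ B (t, x))
    (hτ₁ : ∀ t ∈ I, ContDiffAt ℝ ∞ τ₁ t) (hξ₁ : ∀ x ∈ A, ContDiffAt ℝ ∞ ξ₁ x)
    (hτ₂ : ∀ t ∈ I, ContDiffAt ℝ ∞ τ₂ t) (hξ₂ : ∀ x ∈ A, ContDiffAt ℝ ∞ ξ₂ x) :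
    RelInv B a b I A (GroupClass.bracket τ₁ τ₂) (GroupClass.bracket ξ₁ ξ₂) := by
  intro t ht x hx
  have hBx := hB t ht x hx
  have ddt : ∀ {τ ξ : ℝ → ℝ}, RelInv B a b I A τ ξ → ContDiffAt ℝ ∞ τ t →
      deriv τ t * dt B (t, x) + τ t * dt (dt B) (t, x) + ξ x * dt (dx B) (t, x)
      + (a * deriv (deriv τ) t * B (t, x) + (a * deriv τ t + b * deriv ξ x) * dt B (t, x))
      = 0 := by
    intro τ ξ h hτ
    exact (((hτ.diff.hasDerivAt.fun_mul (hasDerivAt_dt (contDiffAt_dt hBx).diff)).fun_add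
      ((hasDerivAt_dt (contDiffAt_dx hBx).diff).const_mul (ξ x))).fun_add
      ((((contDiffAt_deriv hτ).diff.hasDerivAt.const_mul a).add_const (b * deriv ξ x)).fun_mul
        (hasDerivAt_dt hBx.diff))).eq_zero_of_eqOn hI ht (fun s hs => h s hs x hx)
  have ddx : ∀ {τ ξ : ℝ → ℝ}, RelInv B a b I A τ ξ → ContDiffAt ℝ ∞ ξ x →
      τ t * dx (dt B) (t, x) + (deriv ξ x * dx B (t, x) + ξ x * dx (dx B) (t, x))
      + (b * deriv (deriv ξ) x * B (t, x) + (a * deriv τ t + b * deriv ξ x) * dx B (t, x))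
      = 0 := by
    intro τ ξ h hξ
    exact (((((hasDerivAt_dx (contDiffAt_dt hBx).diff)).const_mul (τ t)).fun_add
      (hξ.diff.hasDerivAt.fun_mul (hasDerivAt_dx (contDiffAt_dx hBx).diff))).fun_add
      ((((contDiffAt_deriv hξ).diff.hasDerivAt.const_mul b).const_add (a * deriv τ t)).fun_mul
        (hasDerivAt_dx hBx.diff))).eq_zero_of_eqOn hA hx (fun s hs => h t ht s hs)
  have e1 := ddt h₁ (hτ₁ t ht)
  have e2 := ddt h₂ (hτ₂ t ht)
  have e3 := ddx h₁ (hξ₁ x hx)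
  have e4 := ddx h₂ (hξ₂ x hx)
  have e5 := h₁ t ht x hx
  have e6 := h₂ t ht x hx
  rw [deriv_bracket (hτ₁ t ht) (hτ₂ t ht), deriv_bracket (hξ₁ x hx) (hξ₂ x hx)]
  rw [dt_dx hBx] at e1 e2
  unfold GroupClass.bracket
  linear_combination τ₁ t * e2 + ξ₁ x * e4 - τ₂ t * e1 - ξ₂ x * e3
    - (a * deriv τ₂ t + b * deriv ξ₂ x) * e5 + (a * deriv τ₁ t + b * deriv ξ₁ x) * e6

theorem deriv_comb {τ₁ τ₂ τ₃ : ℝ → ℝ} {a b c t : ℝ} (h₁ : ContDiffAt ℝ ∞ τ₁ t)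
    (h₂ : ContDiffAt ℝ ∞ τ₂ t) (h₃ : ContDiffAt ℝ ∞ τ₃ t) :
    deriv (fun s => a * τ₁ s + b * τ₂ s + c * τ₃ s) t
      = a * deriv τ₁ t + b * deriv τ₂ t + c * deriv τ₃ t :=
  (((h₁.diff.hasDerivAt.const_mul a).fun_add (h₂.diff.hasDerivAt.const_mul b)).fun_add
    (h₃.diff.hasDerivAt.const_mul c)).deriv

/-- `τ(t) ∂_t + ξ(x) ∂_x` preserves the forms `γ dt`, `β dx` and `K dt dx`. -/
structure Preserves (β γ K : ℝ × ℝ → ℝ) (I A : Set ℝ) (τ ξ : ℝ → ℝ) : Prop where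
  smooth_τ : ∀ t ∈ I, ContDiffAt ℝ ∞ τ t
  smooth_ξ : ∀ x ∈ A, ContDiffAt ℝ ∞ ξ x
  rel_β : RelInv β 0 1 I A τ ξ
  rel_γ : RelInv γ 1 0 I A τ ξ
  rel_K : RelInv K 1 1 I A τ ξ

namespace Preserves

variable {β γ K : ℝ × ℝ → ℝ} {I A : Set ℝ} {τ ξ τ₁ ξ₁ τ₂ ξ₂ τ₃ ξ₃ : ℝ → ℝ}

/-- Three summands allow a bracket to be compared with a combination of two fields. -/
theorem comb (h₁ : Preserves β γ K I A τ₁ ξ₁) (h₂ : Preserves β γ K I A τ₂ ξ₂)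
    (h₃ : Preserves β γ K I A τ₃ ξ₃) (a b c : ℝ) :
    Preserves β γ K I A (fun s => a * τ₁ s + b * τ₂ s + c * τ₃ s)
      (fun s => a * ξ₁ s + b * ξ₂ s + c * ξ₃ s) := by
  have key : ∀ (B : ℝ × ℝ → ℝ) (p q : ℝ), RelInv B p q I A τ₁ ξ₁ → RelInv B p q I A τ₂ ξ₂ →
      RelInv B p q I A τ₃ ξ₃ → RelInv B p q I A (fun s => a * τ₁ s + b * τ₂ s + c * τ₃ s)
      (fun s => a * ξ₁ s + b * ξ₂ s + c * ξ₃ s) := by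
    intro B p q e₁ e₂ e₃ t ht x hx
    rw [deriv_comb (h₁.smooth_τ t ht) (h₂.smooth_τ t ht) (h₃.smooth_τ t ht),
      deriv_comb (h₁.smooth_ξ x hx) (h₂.smooth_ξ x hx) (h₃.smooth_ξ x hx)]
    linear_combination a * e₁ t ht x hx + b * e₂ t ht x hx + c * e₃ t ht x hx
  exact
  { smooth_τ := fun t ht => ((contDiffAt_const.mul (h₁.smooth_τ t ht)).add
      (contDiffAt_const.mul (h₂.smooth_τ t ht))).add (contDiffAt_const.mul (h₃.smooth_τ t ht))
    smooth_ξ := fun x hx => ((contDiffAt_const.mul (h₁.smooth_ξ x hx)).add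
      (contDiffAt_const.mul (h₂.smooth_ξ x hx))).add (contDiffAt_const.mul (h₃.smooth_ξ x hx))
    rel_β := key _ _ _ h₁.rel_β h₂.rel_β h₃.rel_β
    rel_γ := key _ _ _ h₁.rel_γ h₂.rel_γ h₃.rel_γ
    rel_K := key _ _ _ h₁.rel_K h₂.rel_K h₃.rel_K }

theorem brac (h₁ : Preserves β γ K I A τ₁ ξ₁) (h₂ : Preserves β γ K I A τ₂ ξ₂)
    (hI : IsOpen I) (hA : IsOpen A)
    (hβ : ∀ t ∈ I, ∀ x ∈ A, ContDiffAt ℝ ∞ β (t, x))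
    (hγ : ∀ t ∈ I, ∀ x ∈ A, ContDiffAt ℝ ∞ γ (t, x))
    (hK : ∀ t ∈ I, ∀ x ∈ A, ContDiffAt ℝ ∞ K (t, x)) :
    Preserves β γ K I A (bracket τ₁ τ₂) (bracket ξ₁ ξ₂) where
  smooth_τ t ht := contDiffAt_bracket (h₁.smooth_τ t ht) (h₂.smooth_τ t ht)
  smooth_ξ x hx := contDiffAt_bracket (h₁.smooth_ξ x hx) (h₂.smooth_ξ x hx)
  rel_β := h₁.rel_β.bracket h₂.rel_β hI hA hβ h₁.smooth_τ h₁.smooth_ξ h₂.smooth_τ h₂.smooth_ξ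
  rel_γ := h₁.rel_γ.bracket h₂.rel_γ hI hA hγ h₁.smooth_τ h₁.smooth_ξ h₂.smooth_τ h₂.smooth_ξ
  rel_K := h₁.rel_K.bracket h₂.rel_K hI hA hK h₁.smooth_τ h₁.smooth_ξ h₂.smooth_τ h₂.smooth_ξ

/-- A field that vanishes at a point and preserves a nonzero one-form and an area form
vanishes. -/
theorem eq_zero (h : Preserves β γ K I A τ ξ) (hI : IsIntvl I) (hA : IsIntvl A)
    (hβ : ∀ t ∈ I, ∀ x ∈ A, ContDiffAt ℝ ∞ β (t, x))
    (hγ : ∀ t ∈ I, ∀ x ∈ A, ContDiffAt ℝ ∞ γ (t, x))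
    (hK : ∀ t ∈ I, ∀ x ∈ A, ContDiffAt ℝ ∞ K (t, x))
    (hK0 : ∀ t ∈ I, ∀ x ∈ A, K (t, x) ≠ 0)
    (hgood : (∀ t ∈ I, ∀ x ∈ A, β (t, x) ≠ 0) ∨ ∀ t ∈ I, ∀ x ∈ A, γ (t, x) ≠ 0)
    {t₀ x₀ : ℝ} (ht₀ : t₀ ∈ I) (hx₀ : x₀ ∈ A) (hτ : τ t₀ = 0) (hξ : ξ x₀ = 0) :
    (∀ t ∈ I, τ t = 0) ∧ ∀ x ∈ A, ξ x = 0 := by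
  -- On the line `x = x₀` the assumption on `B` says that `τ B` is constant; it is zero at `t₀`, and
  -- `B` has no zeros.
  have inT : ∀ B : ℝ × ℝ → ℝ, (∀ t ∈ I, ∀ x ∈ A, ContDiffAt ℝ ∞ B (t, x)) →
      (∀ t ∈ I, ∀ x ∈ A, B (t, x) ≠ 0) →
      (∀ t ∈ I, deriv τ t * B (t, x₀) + τ t * dt B (t, x₀) = 0) → ∀ t ∈ I, τ t = 0 := by
    intro B hB hB0 hz t ht
    have := eq_of_hasDerivAt_zero (f := fun s => τ s * B (s, x₀)) hI.isOpen hI.conn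
      (fun s hs => hz s hs ▸ (h.smooth_τ s hs).diff.hasDerivAt.fun_mul
        (hasDerivAt_dt (hB s hs x₀ hx₀).diff)) ht ht₀
    simp only [hτ, zero_mul] at this
    exact (mul_eq_zero.1 this).resolve_right (hB0 t ht x₀ hx₀)
  have inX : ∀ B : ℝ × ℝ → ℝ, (∀ t ∈ I, ∀ x ∈ A, ContDiffAt ℝ ∞ B (t, x)) →
      (∀ t ∈ I, ∀ x ∈ A, B (t, x) ≠ 0) →
      (∀ x ∈ A, deriv ξ x * B (t₀, x) + ξ x * dx B (t₀, x) = 0) → ∀ x ∈ A, ξ x = 0 := by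
    intro B hB hB0 hz x hx
    have := eq_of_hasDerivAt_zero (f := fun s => ξ s * B (t₀, s)) hA.isOpen hA.conn
      (fun s hs => hz s hs ▸ (h.smooth_ξ s hs).diff.hasDerivAt.fun_mul
        (hasDerivAt_dx (hB t₀ ht₀ s hs).diff)) hx hx₀
    simp only [hξ, zero_mul] at this
    exact (mul_eq_zero.1 this).resolve_right (hB0 t₀ ht₀ x hx)
  -- Since `τ(t₀) = 0`, invariance of `β dx` on the line `t = t₀` gives `(ξ β)_x = 0` and hence `ξ =
  -- 0`. The area form then gives `(τ K)_t = 0` on `x = x₀`. The case of `γ dt` is symmetric.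
  rcases hgood with hg | hg
  · have h1 := inX β hβ hg fun x hx => by
      have := h.rel_β t₀ ht₀ x hx
      rw [hτ] at this
      linarith
    refine ⟨inT K hK hK0 fun t ht => ?_, h1⟩
    have := h.rel_K t ht x₀ hx₀
    rw [hξ, (h.smooth_ξ x₀ hx₀).diff.hasDerivAt.eq_zero_of_eqOn hA.isOpen hx₀ h1] at this
    linarith
  · have h1 := inT γ hγ hg fun t ht => by
      have := h.rel_γ t ht x₀ hx₀
      rw [hξ] at this
      linarith
    refine ⟨h1, inX K hK hK0 fun x hx => ?_⟩
    have := h.rel_K t₀ ht₀ x hx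
    rw [hτ, (h.smooth_τ t₀ ht₀).diff.hasDerivAt.eq_zero_of_eqOn hI.isOpen ht₀ h1] at this
    linarith

end Preserves

/-! ### Symmetries on a chart -/

/-- The coefficient `ℓ_t + g`. -/
def gam (e : Equation) (ℓ : ℝ × ℝ → ℝ) (z : ℝ × ℝ) : ℝ := dt ℓ z + e.g z

variable {e : Equation} {L : Submodule ℝ (Pt → Pt)} {I A C : Set ℝ} {σ ℓ : ℝ × ℝ → ℝ}
  {Q : Pt → Pt} {τ ξ h : ℝ → ℝ}

theorem Chart.smooth_gam (c : Chart e L I A C σ ℓ) :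
    ∀ t ∈ I, ∀ x ∈ A, ContDiffAt ℝ ∞ (gam e ℓ) (t, x) := fun t ht x hx =>
  (contDiffAt_dt (c.smooth_ℓ t ht x hx)).add (c.smooth_g t ht x hx)

/-- This identity links the three invariant forms. Because `g_x ≠ 0`, it prevents both one-forms
from vanishing, and later it excludes commutative two-dimensional algebras. -/
theorem Chart.dx_gam (c : Chart e L I A C σ ℓ) {t x : ℝ} (ht : t ∈ I) (hx : x ∈ A) :
    dx (gam e ℓ) (t, x) = dt (dx ℓ) (t, x) + dx e.g (t, x) := by
  rw [dt_dx (c.smooth_ℓ t ht x hx)]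
  exact (hasDerivAt_dx (c.smooth_gam t ht x hx).diff).unique
    ((hasDerivAt_dx (contDiffAt_dt (c.smooth_ℓ t ht x hx)).diff).fun_add
      (hasDerivAt_dx (c.smooth_g t ht x hx).diff))

theorem Chart.deriv_log (c : Chart e L I A C σ ℓ) (f : ChartForm e Q I A C σ ℓ τ ξ h)
    {t x : ℝ} (ht : t ∈ I) (hx : x ∈ A) :
    deriv h t = -(deriv τ t * dt ℓ (t, x) + τ t * dt (dt ℓ) (t, x)
      + ξ x * dt (dx ℓ) (t, x)) := by
  have hl := c.smooth_ℓ t ht x hx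
  have := ((f.smooth_h t ht).diff.hasDerivAt.fun_add
    (((f.smooth_τ t ht).diff.hasDerivAt.fun_mul (hasDerivAt_dt (contDiffAt_dt hl).diff)).fun_add
      ((hasDerivAt_dt (contDiffAt_dx hl).diff).const_mul (ξ x)))).eq_zero_of_eqOn
      c.intvl_I.isOpen ht (fun s hs => by rw [f.log s hs x hx]; ring)
  linarith

/-- The function `h` does not depend on `x`, so the `x`-derivative of `τ ℓ_t + ξ ℓ_x` vanishes. -/
theorem Chart.dx_log (c : Chart e L I A C σ ℓ) (f : ChartForm e Q I A C σ ℓ τ ξ h)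
    {t x : ℝ} (ht : t ∈ I) (hx : x ∈ A) :
    τ t * dt (dx ℓ) (t, x) + (deriv ξ x * dx ℓ (t, x) + ξ x * dx (dx ℓ) (t, x)) = 0 := by
  have hl := c.smooth_ℓ t ht x hx
  rw [dt_dx hl]
  exact ((((hasDerivAt_dx (contDiffAt_dt hl).diff).const_mul (τ t)).fun_add
    ((f.smooth_ξ x hx).diff.hasDerivAt.fun_mul
      (hasDerivAt_dx (contDiffAt_dx hl).diff))).const_add (h t)).eq_zero_of_eqOn
      c.intvl_A.isOpen hx (fun s hs => by rw [f.log t ht s hs]; ring)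

/-- Invariance of `ℓ_x dx` is `Chart.dx_log`. That of `(ℓ_t + g) dt` follows by equating two
expressions for `h'`: the one in the determining equation for `g`, and the `t`-derivative of `-(τ
ℓ_t + ξ ℓ_x)`. -/
theorem Chart.preserves (c : Chart e L I A C σ ℓ) (f : ChartForm e Q I A C σ ℓ τ ξ h) :
    Preserves (dx ℓ) (gam e ℓ) (dx e.g) I A τ ξ where
  smooth_τ := f.smooth_τ
  smooth_ξ := f.smooth_ξ
  rel_β t ht x hx := by
    have := c.dx_log f ht hx
    linarith
  rel_γ t ht x hx := by
    have e1 := c.deriv_log f ht hx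
    rw [f.det_g t ht x hx] at e1
    have e2 : dt (gam e ℓ) (t, x) = dt (dt ℓ) (t, x) + dt e.g (t, x) :=
      (hasDerivAt_dt (c.smooth_gam t ht x hx).diff).unique
        ((hasDerivAt_dt (contDiffAt_dt (c.smooth_ℓ t ht x hx)).diff).fun_add
          (hasDerivAt_dt (c.smooth_g t ht x hx).diff))
    rw [e2, c.dx_gam ht hx, gam]
    linear_combination e1
  rel_K t ht x hx := by
    have := density_of_det c.intvl_A.isOpen f.smooth_ξ c.smooth_g f.det_g ht hx
    linarith

/-- One of the invariant one-forms vanishes nowhere on the chart. -/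
def Good (e : Equation) (I A : Set ℝ) (ℓ : ℝ × ℝ → ℝ) : Prop :=
  (∀ t ∈ I, ∀ x ∈ A, dx ℓ (t, x) ≠ 0) ∨ ∀ t ∈ I, ∀ x ∈ A, gam e ℓ (t, x) ≠ 0

theorem Good.mono {I' A' : Set ℝ} (hg : Good e I A ℓ) (hI : I' ⊆ I) (hA : A' ⊆ A) :
    Good e I' A' ℓ :=
  hg.imp (fun h t ht x hx => h t (hI ht) x (hA hx)) fun h t ht x hx => h t (hI ht) x (hA hx)

theorem Chart.exists_good (c : Chart e L I A C σ ℓ) : ∃ I' A', I' ⊆ I ∧ A' ⊆ A ∧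
    Chart e L I' A' C σ ℓ ∧ Good e I' A' ℓ := by
  have shrink : ∀ B : ℝ × ℝ → ℝ, (∀ t ∈ I, ∀ x ∈ A, ContDiffAt ℝ ∞ B (t, x)) →
      ∀ t ∈ I, ∀ x ∈ A, B (t, x) ≠ 0 → ∃ I' A', IsIntvl I' ∧ IsIntvl A' ∧ I' ⊆ I ∧ A' ⊆ A ∧
        ∀ t ∈ I', ∀ x ∈ A', B (t, x) ≠ 0 := by
    intro B hB t ht x hx hne
    obtain ⟨I', A', hI', hA', ht', hx', hsub⟩ := exists_box_subset₂
      (((hB t ht x hx).continuousAt.eventually_ne hne).and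
        ((c.intvl_I.isOpen.prod c.intvl_A.isOpen).mem_nhds ⟨ht, hx⟩))
    exact ⟨I', A', hI', hA', fun s hs => (hsub (show (s, x) ∈ I' ×ˢ A' from ⟨hs, hx'⟩)).2.1,
      fun s hs => (hsub (show (t, s) ∈ I' ×ˢ A' from ⟨ht', hs⟩)).2.2,
      fun s hs r hr => (hsub (show (s, r) ∈ I' ×ˢ A' from ⟨hs, hr⟩)).1⟩
  by_cases hβ : ∃ t ∈ I, ∃ x ∈ A, dx ℓ (t, x) ≠ 0
  · obtain ⟨t, ht, x, hx, hne⟩ := hβ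
    obtain ⟨I', A', hI', hA', hI, hA, hne⟩ := shrink _
      (fun t ht x hx => contDiffAt_dx (c.smooth_ℓ t ht x hx)) t ht x hx hne
    exact ⟨I', A', hI, hA, c.mono hI' hA' c.intvl_C hI hA subset_rfl, Or.inl hne⟩
  · push Not at hβ
    by_cases hγ : ∃ t ∈ I, ∃ x ∈ A, gam e ℓ (t, x) ≠ 0
    · obtain ⟨t, ht, x, hx, hne⟩ := hγ
      obtain ⟨I', A', hI', hA', hI, hA, hne⟩ := shrink _ c.smooth_gam t ht x hx hne
      exact ⟨I', A', hI, hA, c.mono hI' hA' c.intvl_C hI hA subset_rfl, Or.inr hne⟩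
    · push Not at hγ
      obtain ⟨t, ht⟩ := c.intvl_I.nonempty
      obtain ⟨x, hx⟩ := c.intvl_A.nonempty
      -- If both coefficients vanished identically, so would `∂_x (ℓ_t + g)` and `∂_t ℓ_x`, whose
      -- difference is `g_x`.
      refine absurd ?_ (c.gx_ne t ht x hx)
      have e1 := c.dx_gam ht hx
      have e2 := (hasDerivAt_dx (c.smooth_gam t ht x hx).diff).eq_zero_of_eqOn
        c.intvl_A.isOpen hx (fun s hs => hγ t ht s hs)
      have e3 := (hasDerivAt_dt (contDiffAt_dx (c.smooth_ℓ t ht x hx)).diff).eq_zero_of_eqOn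
        c.intvl_I.isOpen ht (fun s hs => hβ s hs x hx)
      linarith

theorem Chart.isOpen_box (c : Chart e L I A C σ ℓ) : IsOpen (I ×ˢ A ×ˢ C) :=
  c.intvl_I.isOpen.prod (c.intvl_A.isOpen.prod c.intvl_C.isOpen)

theorem Chart.box_nonempty (c : Chart e L I A C σ ℓ) : (I ×ˢ A ×ˢ C).Nonempty :=
  c.intvl_I.nonempty.prod (c.intvl_A.nonempty.prod c.intvl_C.nonempty)

/-- The plane components vanish by rigidity, and then the vertical one does too, since `h` is
expressed through `τ`, `ξ` and `ℓ`. -/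
theorem Chart.eq_zero_of_apply (c : Chart e L I A C σ ℓ) (hg : Good e I A ℓ)
    (f : ChartForm e Q I A C σ ℓ τ ξ h) {t₀ x₀ : ℝ} (ht₀ : t₀ ∈ I) (hx₀ : x₀ ∈ A)
    (hτ : τ t₀ = 0) (hξ : ξ x₀ = 0) {P : Pt} (hP : P ∈ I ×ˢ A ×ˢ C) : Q P = 0 := by
  obtain ⟨h1, h2⟩ := (c.preserves f).eq_zero c.intvl_I c.intvl_A
    (fun t ht x hx => contDiffAt_dx (c.smooth_ℓ t ht x hx)) c.smooth_gam
    (fun t ht x hx => contDiffAt_dx (c.smooth_g t ht x hx)) c.gx_ne hg ht₀ hx₀ hτ hξ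
  obtain ⟨t, x, u⟩ := P
  obtain ⟨ht, hx, hu⟩ := hP
  rw [f.eq t ht x hx u hu, f.log t ht x hx, h1 t ht, h2 x hx]
  simp

variable {Ω : TopologicalSpace.Opens Pt}

/-- The evaluation `Q ↦ (τ, ξ)` at a point. -/
def evalAt (L : Submodule ℝ (Pt → Pt)) (P : Pt) : L →ₗ[ℝ] ℝ × ℝ where
  toFun Q := base (Q.1 P)
  map_add' _ _ := rfl
  map_smul' _ _ := rfl

/-- Rigidity on the chart gives zero on an open set, and unique continuation extends it to the
connected domain. The bound on the dimension follows at once. -/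
theorem evalAt_injective (hΩ : IsConnected (Ω : Set Pt)) (he : e.InClass Ω)
    (c : Chart e (symAlg e Ω) I A C σ ℓ) (hB : I ×ˢ A ×ˢ C ⊆ Ω) (hg : Good e I A ℓ) {P : Pt}
    (hP : P ∈ I ×ˢ A ×ˢ C) : Function.Injective (evalAt (symAlg e Ω) P) := by
  rw [← LinearMap.ker_eq_bot, LinearMap.ker_eq_bot']
  rintro ⟨Q, hQ⟩ h0
  obtain ⟨τ, ξ, h, f⟩ := c.sym Q hQ
  obtain ⟨t, x, u⟩ := P
  obtain ⟨ht, hx, hu⟩ := hP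
  have h0' : base (Q (t, x, u)) = 0 := h0
  rw [f.eq t ht x hx u hu] at h0'
  have : Q = 0 := symAlg_eq_zero_of_eqOn hΩ he hQ c.isOpen_box c.box_nonempty hB
    fun R hR => c.eq_zero_of_apply hg f ht hx (congrArg Prod.fst h0') (congrArg Prod.snd h0') hR
  exact Subtype.ext this

theorem exists_good_chart (he : e.InClass Ω) {N : Set Pt} (hN : IsOpen N) (hne : N.Nonempty)
    (hNΩ : N ⊆ Ω) :
    ∃ I A C σ ℓ, I ×ˢ A ×ˢ C ⊆ N ∧ Chart e (symAlg e Ω) I A C σ ℓ ∧ Good e I A ℓ := by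
  obtain ⟨I, A, C, σ, ℓ, hsub, c⟩ := exists_chart he hN hne hNΩ
  obtain ⟨I', A', hI, hA, c', hg⟩ := c.exists_good
  exact ⟨I', A', C, σ, ℓ, (prod_mono hI (prod_mono hA subset_rfl)).trans hsub, c', hg⟩

theorem rank_symAlg_le (hΩ : IsConnected (Ω : Set Pt)) (he : e.InClass Ω) :
    Module.rank ℝ (symAlg e Ω) ≤ 2 := by
  obtain ⟨I, A, C, σ, ℓ, hB, c, hg⟩ :=
    exists_good_chart he Ω.isOpen hΩ.nonempty subset_rfl
  obtain ⟨P, hP⟩ := c.box_nonempty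
  have := LinearMap.rank_le_of_injective _ (evalAt_injective hΩ he c hB hg hP)
  refine this.trans (le_of_eq ?_)
  rw [rank_prod']
  simp only [Module.rank_self]
  norm_num

/-! ### Two-dimensional algebras -/

/-- The components of a linear combination. -/
theorem Chart.comb (c : Chart e L I A C σ ℓ) {Q₁ Q₂ : Pt → Pt} {a b : ℝ}
    {τ₁ ξ₁ h₁ τ₂ ξ₂ h₂ : ℝ → ℝ} (f₁ : ChartForm e Q₁ I A C σ ℓ τ₁ ξ₁ h₁)
    (f₂ : ChartForm e Q₂ I A C σ ℓ τ₂ ξ₂ h₂)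
    (f : ChartForm e (a • Q₁ + b • Q₂) I A C σ ℓ τ ξ h) :
    (∀ t ∈ I, τ t = a * τ₁ t + b * τ₂ t) ∧ ∀ x ∈ A, ξ x = a * ξ₁ x + b * ξ₂ x := by
  obtain ⟨t₀, ht₀⟩ := c.intvl_I.nonempty
  obtain ⟨x₀, hx₀⟩ := c.intvl_A.nonempty
  obtain ⟨u₀, hu₀⟩ := c.intvl_C.nonempty
  have key : ∀ t ∈ I, ∀ x ∈ A, τ t = a * τ₁ t + b * τ₂ t ∧ ξ x = a * ξ₁ x + b * ξ₂ x := by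
    intro t ht x hx
    have h1 := f.eq t ht x hx u₀ hu₀
    simp only [Pi.add_apply, Pi.smul_apply, f₁.eq t ht x hx u₀ hu₀, f₂.eq t ht x hx u₀ hu₀,
      Prod.smul_mk, Prod.mk_add_mk, smul_eq_mul, Prod.mk.injEq] at h1
    exact ⟨h1.1.symm, h1.2.1.symm⟩
  exact ⟨fun t ht => (key t ht x₀ hx₀).1, fun x hx => (key t₀ ht₀ x hx).2⟩

theorem bracket_comb {τ₁ τ₂ τ τ' : ℝ → ℝ} {a b a' b' t : ℝ} (hI : IsOpen I) (ht : t ∈ I)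
    (h₁ : ContDiffAt ℝ ∞ τ₁ t) (h₂ : ContDiffAt ℝ ∞ τ₂ t)
    (hτ : ∀ t ∈ I, τ t = a * τ₁ t + b * τ₂ t) (hτ' : ∀ t ∈ I, τ' t = a' * τ₁ t + b' * τ₂ t) :
    bracket τ τ' t = (a * b' - b * a') * bracket τ₁ τ₂ t := by
  have hd : ∀ {a b : ℝ} {τ : ℝ → ℝ}, (∀ t ∈ I, τ t = a * τ₁ t + b * τ₂ t) →
      deriv τ t = a * deriv τ₁ t + b * deriv τ₂ t := by
    intro a b τ hτ
    have h := ((h₁.diff.hasDerivAt.const_mul a).fun_add (h₂.diff.hasDerivAt.const_mul b))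
    exact (h.congr_of_eventuallyEq (Filter.eventually_of_mem (hI.mem_nhds ht) hτ)).deriv
  rw [bracket, bracket, hd hτ, hd hτ', hτ t ht, hτ' t ht]
  ring

/-- A two-dimensional symmetry algebra acts transitively on the `(t, x)`-plane of the chart and has
a basis with `[Q₁, Q₂] = Q₂`. -/
theorem exists_nonabelian_basis (hΩ : IsConnected (Ω : Set Pt)) (he : e.InClass Ω)
    (hrank : Module.rank ℝ (symAlg e Ω) = 2)
    (c : Chart e (symAlg e Ω) I A C σ ℓ) (hB : I ×ˢ A ×ˢ C ⊆ Ω) (hg : Good e I A ℓ) :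
    ∃ (Q₁ Q₂ : Pt → Pt) (τ₁ ξ₁ h₁ τ₂ ξ₂ h₂ : ℝ → ℝ), Q₁ ∈ symAlg e Ω ∧ Q₂ ∈ symAlg e Ω ∧
      (∀ Q ∈ symAlg e Ω, ∃ a b : ℝ, Q = a • Q₁ + b • Q₂) ∧
      ChartForm e Q₁ I A C σ ℓ τ₁ ξ₁ h₁ ∧ ChartForm e Q₂ I A C σ ℓ τ₂ ξ₂ h₂ ∧
      (∀ t ∈ I, bracket τ₁ τ₂ t = τ₂ t) ∧ (∀ x ∈ A, bracket ξ₁ ξ₂ x = ξ₂ x) ∧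
      ∀ t ∈ I, ∀ x ∈ A, τ₁ t * ξ₂ x - τ₂ t * ξ₁ x ≠ 0 := by
  obtain ⟨⟨t₀, x₀, u₀⟩, ht₀, hx₀, hu₀⟩ := c.box_nonempty
  have hinj := evalAt_injective hΩ he c hB hg (P := (t₀, x₀, u₀)) ⟨ht₀, hx₀, hu₀⟩
  have hfin : Module.finrank ℝ (symAlg e Ω) = 2 := by
    rw [Module.finrank, hrank]; simp
  have hff : FiniteDimensional ℝ (symAlg e Ω) := Module.finite_of_finrank_pos (by omega)
  have hsurj : Function.Surjective (evalAt (symAlg e Ω) (t₀, x₀, u₀)) :=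
    (LinearMap.injective_iff_surjective_of_finrank_eq_finrank (by
      rw [hfin, Module.finrank_prod]; simp)).1 hinj
  -- An injective map between spaces of equal finite dimension is onto, so there is a basis with
  -- values `∂_t` and `∂_x` at the chosen point.
  obtain ⟨⟨R₁, hR₁⟩, hv₁⟩ := hsurj (1, 0)
  obtain ⟨⟨R₂, hR₂⟩, hv₂⟩ := hsurj (0, 1)
  have hspan : ∀ Q ∈ symAlg e Ω, ∃ a b : ℝ, Q = a • R₁ + b • R₂ := by
    intro Q hQ
    set v := evalAt (symAlg e Ω) (t₀, x₀, u₀) ⟨Q, hQ⟩ with hv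
    refine ⟨v.1, v.2, ?_⟩
    have : (⟨Q, hQ⟩ : symAlg e Ω) = v.1 • ⟨R₁, hR₁⟩ + v.2 • ⟨R₂, hR₂⟩ := by
      apply hinj
      rw [map_add, map_smul, map_smul, hv₁, hv₂, ← hv]
      ext <;> simp
    exact congrArg Subtype.val this
  obtain ⟨ρ₁, ζ₁, η₁, f₁⟩ := c.sym R₁ hR₁
  obtain ⟨ρ₂, ζ₂, η₂, f₂⟩ := c.sym R₂ hR₂
  have hv₁' : base (R₁ (t₀, x₀, u₀)) = (1, 0) := hv₁
  have hv₂' : base (R₂ (t₀, x₀, u₀)) = (0, 1) := hv₂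
  rw [f₁.eq t₀ ht₀ x₀ hx₀ u₀ hu₀] at hv₁'
  rw [f₂.eq t₀ ht₀ x₀ hx₀ u₀ hu₀] at hv₂'
  obtain ⟨v1, v2⟩ : ρ₁ t₀ = 1 ∧ ζ₁ x₀ = 0 := by simpa [base] using hv₁'
  obtain ⟨v3, v4⟩ : ρ₂ t₀ = 0 ∧ ζ₂ x₀ = 1 := by simpa [base] using hv₂'
  have p₁ := c.preserves f₁
  have p₂ := c.preserves f₂
  have sβ := fun t ht x hx => contDiffAt_dx (c.smooth_ℓ t ht x hx)
  have sK := fun t ht x hx => contDiffAt_dx (c.smooth_g t ht x hx)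
  have p₃ := p₁.brac p₂ c.intvl_I.isOpen c.intvl_A.isOpen sβ c.smooth_gam sK
  set c₁ := bracket ρ₁ ρ₂ t₀ with hc₁
  set c₂ := bracket ζ₁ ζ₂ x₀ with hc₂
  -- The field `c₁ R₁ + c₂ R₂ - [R₁, R₂]` has plane components that vanish at the chosen point and
  -- preserve the forms, hence are zero. Closure of the symmetry algebra under brackets is thus not
  -- required.
  obtain ⟨z1, z2⟩ := (p₁.comb p₂ p₃ c₁ c₂ (-1)).eq_zero c.intvl_I c.intvl_A sβ c.smooth_gam sK
    c.gx_ne hg ht₀ hx₀ (by rw [v1, v3]; ring) (by rw [v2, v4]; ring)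
  have b1 : ∀ t ∈ I, bracket ρ₁ ρ₂ t = c₁ * ρ₁ t + c₂ * ρ₂ t := fun t ht => by
    have := z1 t ht; linarith
  have b2 : ∀ x ∈ A, bracket ζ₁ ζ₂ x = c₁ * ζ₁ x + c₂ * ζ₂ x := fun x hx => by
    have := z2 x hx; linarith
  -- A zero of the determinant would let the combinations with coefficients `(ρ₂, -ρ₁)` and `(ζ₂,
  -- -ζ₁)` vanish at that point, hence be trivial. All four components would then be zero there, and
  -- so `R₁` itself would have zero plane part.
  have hdelta : ∀ t ∈ I, ∀ x ∈ A, ρ₁ t * ζ₂ x - ρ₂ t * ζ₁ x ≠ 0 := by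
    intro t ht x hx hz
    have hcomb : ∀ a b : ℝ, a * ρ₁ t + b * ρ₂ t = 0 → a * ζ₁ x + b * ζ₂ x = 0 →
        a = 0 ∧ b = 0 := by
      intro a b hab hab'
      obtain ⟨w1, w2⟩ := (p₁.comb p₂ p₃ a b 0).eq_zero c.intvl_I c.intvl_A sβ c.smooth_gam sK
        c.gx_ne hg ht hx (by linarith) (by linarith)
      have w1' := w1 t₀ ht₀
      have w2' := w2 x₀ hx₀
      simp only [v1, v2, v3, v4] at w1' w2'
      constructor <;> linarith
    obtain ⟨h1, h2⟩ := hcomb (ρ₂ t) (-ρ₁ t) (by ring) (by linarith)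
    obtain ⟨h3, h4⟩ := hcomb (ζ₂ x) (-ζ₁ x) (by linarith) (by ring)
    obtain ⟨h5, -⟩ := hcomb 1 0 (by linarith) (by linarith)
    exact one_ne_zero h5
  -- For commuting fields `ρ₂'` and `ζ₁'` vanish at the point. Invariance of `β` under `R₁` and of
  -- `γ` under `R₂` then gives `β_t = 0` and `γ_x = 0`, contradicting `γ_x = β_t + g_x`.
  have hne : c₁ ^ 2 + c₂ ^ 2 ≠ 0 := by
    intro h0
    have k1 : c₁ = 0 := by nlinarith [sq_nonneg c₁, sq_nonneg c₂]
    have k2 : c₂ = 0 := by nlinarith [sq_nonneg c₁, sq_nonneg c₂]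
    refine c.gx_ne t₀ ht₀ x₀ hx₀ ?_
    have e1 := p₁.rel_β t₀ ht₀ x₀ hx₀
    have e2 := p₂.rel_β t₀ ht₀ x₀ hx₀
    have e3 := p₁.rel_γ t₀ ht₀ x₀ hx₀
    have e4 := p₂.rel_γ t₀ ht₀ x₀ hx₀
    have e5 := c.dx_gam ht₀ hx₀
    rw [bracket, v1, v3] at hc₁
    rw [bracket, v2, v4] at hc₂
    rw [v1, v2] at e1 e3
    rw [v3, v4] at e2 e4
    have k3 : deriv ρ₂ t₀ = 0 := by linarith
    have k4 : deriv ζ₁ x₀ = 0 := by linarith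
    rw [k3] at e4
    rw [k4] at e1
    linarith
  set N := c₁ ^ 2 + c₂ ^ 2 with hN
  -- With `Q₂ = c₁ R₁ + c₂ R₂` one has `[a R₁ + b R₂, Q₂] = (a c₂ - b c₁) Q₂`; this choice of `a`,
  -- `b` makes the factor one.
  set a := c₂ / N with ha
  set b := -c₁ / N with hb
  have hdet : a * c₂ - b * c₁ = 1 := by
    rw [ha, hb]; field_simp; rw [hN]; ring
  have m₁ : a • R₁ + b • R₂ ∈ symAlg e Ω :=
    add_mem (Submodule.smul_mem _ _ hR₁) (Submodule.smul_mem _ _ hR₂)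
  have m₂ : c₁ • R₁ + c₂ • R₂ ∈ symAlg e Ω :=
    add_mem (Submodule.smul_mem _ _ hR₁) (Submodule.smul_mem _ _ hR₂)
  obtain ⟨τ₁, ξ₁, h₁, g₁⟩ := c.sym _ m₁
  obtain ⟨τ₂, ξ₂, h₂, g₂⟩ := c.sym _ m₂
  obtain ⟨k1, k2⟩ := c.comb f₁ f₂ g₁
  obtain ⟨k3, k4⟩ := c.comb f₁ f₂ g₂
  refine ⟨_, _, τ₁, ξ₁, h₁, τ₂, ξ₂, h₂, m₁, m₂, fun Q hQ => ?_, g₁, g₂, fun t ht => ?_,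
    fun x hx => ?_, fun t ht x hx => ?_⟩
  · obtain ⟨p, q, rfl⟩ := hspan Q hQ
    refine ⟨p * c₂ - q * c₁, q * a - p * b, ?_⟩
    have e1 : p = (p * c₂ - q * c₁) * a + (q * a - p * b) * c₁ := by
      linear_combination -p * hdet
    have e2 : q = (p * c₂ - q * c₁) * b + (q * a - p * b) * c₂ := by
      linear_combination -q * hdet
    have e3 : (p * c₂ - q * c₁) • (a • R₁ + b • R₂) + (q * a - p * b) • (c₁ • R₁ + c₂ • R₂)
        = ((p * c₂ - q * c₁) * a + (q * a - p * b) * c₁) • R₁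
          + ((p * c₂ - q * c₁) * b + (q * a - p * b) * c₂) • R₂ := by
      rw [smul_add, smul_add, smul_smul, smul_smul, smul_smul, smul_smul, add_smul, add_smul]
      abel
    rw [e3, ← e1, ← e2]
  · rw [bracket_comb c.intvl_I.isOpen ht (f₁.smooth_τ t ht) (f₂.smooth_τ t ht) k1 k3, hdet,
      one_mul, b1 t ht, k3 t ht]
  · rw [bracket_comb c.intvl_A.isOpen hx (f₁.smooth_ξ x hx) (f₂.smooth_ξ x hx) k2 k4, hdet,
      one_mul, b2 x hx, k4 x hx]
  · rw [k1 t ht, k2 x hx, k3 t ht, k4 x hx]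
    have : (a * ρ₁ t + b * ρ₂ t) * (c₁ * ζ₁ x + c₂ * ζ₂ x)
        - (c₁ * ρ₁ t + c₂ * ρ₂ t) * (a * ζ₁ x + b * ζ₂ x)
        = (a * c₂ - b * c₁) * (ρ₁ t * ζ₂ x - ρ₂ t * ζ₁ x) := by ring
    rw [this, hdet, one_mul]
    exact hdelta t ht x hx

/-- The vertical parts satisfy the same commutation relation. -/
theorem Chart.bracket_h (c : Chart e L I A C σ ℓ) {Q₁ Q₂ : Pt → Pt}
    {τ₁ ξ₁ h₁ τ₂ ξ₂ h₂ : ℝ → ℝ} (f₁ : ChartForm e Q₁ I A C σ ℓ τ₁ ξ₁ h₁)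
    (f₂ : ChartForm e Q₂ I A C σ ℓ τ₂ ξ₂ h₂) (hτ : ∀ t ∈ I, bracket τ₁ τ₂ t = τ₂ t)
    (hξ : ∀ x ∈ A, bracket ξ₁ ξ₂ x = ξ₂ x) {t : ℝ} (ht : t ∈ I) :
    τ₁ t * deriv h₂ t - τ₂ t * deriv h₁ t = h₂ t := by
  obtain ⟨x, hx⟩ := c.intvl_A.nonempty
  have e1 := c.dx_log f₁ ht hx
  have e2 := c.dx_log f₂ ht hx
  have e3 := hτ t ht
  have e4 := hξ x hx
  rw [bracket] at e3 e4
  rw [c.deriv_log f₁ ht hx, c.deriv_log f₂ ht hx, f₂.log t ht x hx]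
  linear_combination ξ₁ x * e2 - ξ₂ x * e1 - dt ℓ (t, x) * e3 - dx ℓ (t, x) * e4

end

/-! ### Equivalence transformations of the first kind -/

section

/-- The transformation `(T(t), X(x), U(t) (u - σ(t, x)))`. -/
def normMap (T X U : ℝ → ℝ) (σ : ℝ × ℝ → ℝ) (P : Pt) : Pt :=
  (T P.1, X P.2.1, U P.1 * P.2.2 + -(U P.1 * σ (P.1, P.2.1)))

/-- On the box, `normMap T X U σ` is an invertible transformation that takes `e` to `e'`. -/
structure Pushed (e e' : Equation) (T X U : ℝ → ℝ) (σ : ℝ × ℝ → ℝ) (I A C : Set ℝ) : Prop where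
  isOpen_I : IsOpen I
  isOpen_A : IsOpen A
  isOpen_C : IsOpen C
  smooth_g : ∀ t ∈ I, ∀ x ∈ A, ContDiffAt ℝ ∞ e.g (t, x)
  smooth_f : ∀ t ∈ I, ∀ x ∈ A, ∀ u ∈ C, ContDiffAt ℝ ∞ e.f (t, x, u)
  gx_ne : ∀ t ∈ I, ∀ x ∈ A, dx e.g (t, x) ≠ 0
  fuu_ne : ∀ t ∈ I, ∀ x ∈ A, ∀ u ∈ C, d3 (d3 e.f) (t, x, u) ≠ 0
  smooth_σ : ∀ t ∈ I, ∀ x ∈ A, ContDiffAt ℝ ∞ σ (t, x)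
  smooth_T : ∀ t ∈ I, ContDiffAt ℝ ∞ T t
  smooth_X : ∀ x ∈ A, ContDiffAt ℝ ∞ X x
  smooth_U : ∀ t ∈ I, ContDiffAt ℝ ∞ U t
  T_ne : ∀ t ∈ I, deriv T t ≠ 0
  X_ne : ∀ x ∈ A, deriv X x ≠ 0
  U_ne : ∀ t ∈ I, U t ≠ 0
  injOn : InjOn (normMap T X U σ) (I ×ˢ A ×ˢ C)
  image_nhds : ∀ P ∈ I ×ˢ A ×ˢ C,
    normMap T X U σ '' (I ×ˢ A ×ˢ C) ∈ 𝓝 (normMap T X U σ P)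
  smooth_g' : ∀ t ∈ I, ∀ x ∈ A, ContDiffAt ℝ ∞ e'.g (T t, X x)
  smooth_f' : ∀ t ∈ I, ∀ x ∈ A, ∀ u ∈ C, ContDiffAt ℝ ∞ e'.f (normMap T X U σ (t, x, u))
  g_eq : ∀ t ∈ I, ∀ x ∈ A, e'.g (T t, X x) * deriv T t = e.g (t, x) + deriv U t / U t
  f_eq : ∀ t ∈ I, ∀ x ∈ A, ∀ u ∈ C, e'.f (normMap T X U σ (t, x, u)) * (deriv T t * deriv X x)
    = U t * (e.f (t, x, u) - defect e.g σ (t, x))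

theorem contDiffAt_normMap {T X U : ℝ → ℝ} {σ : ℝ × ℝ → ℝ} {t x u : ℝ}
    (hT : ContDiffAt ℝ ∞ T t) (hX : ContDiffAt ℝ ∞ X x) (hU : ContDiffAt ℝ ∞ U t)
    (hσ : ContDiffAt ℝ ∞ σ (t, x)) : ContDiffAt ℝ ∞ (normMap T X U σ) (t, x, u) := by
  have c1 : ContDiffAt ℝ ∞ (fun P : Pt => T P.1) (t, x, u) :=
    ContDiffAt.comp (f := fun P : Pt => P.1) (t, x, u) hT contDiffAt_fst
  have c2 : ContDiffAt ℝ ∞ (fun P : Pt => X P.2.1) (t, x, u) :=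
    ContDiffAt.comp (f := fun P : Pt => P.2.1) (t, x, u) hX contDiffAt_snd.fst
  have c3 : ContDiffAt ℝ ∞ (fun P : Pt => U P.1) (t, x, u) :=
    ContDiffAt.comp (f := fun P : Pt => P.1) (t, x, u) hU contDiffAt_fst
  have c4 : ContDiffAt ℝ ∞ (fun P : Pt => σ (P.1, P.2.1)) (t, x, u) :=
    ContDiffAt.comp (f := fun P : Pt => (P.1, P.2.1)) (t, x, u) hσ
      (contDiffAt_fst.prodMk contDiffAt_snd.fst)
  exact c1.prodMk (c2.prodMk ((c3.mul contDiffAt_snd.snd).add (c3.mul c4).neg))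

/-- The new equation is found by solving the transformation rules for its coefficients and composing
with the inverse map `Ψ`. The intervals are shrunk so that `T` and `X` become invertible. -/
theorem Chart.exists_pushed {e : Equation} {L : Submodule ℝ (Pt → Pt)} {I A C : Set ℝ}
    {σ ℓ : ℝ × ℝ → ℝ} (c : Chart e L I A C σ ℓ) {T X U : ℝ → ℝ}
    (hT : ∀ t ∈ I, ContDiffAt ℝ ∞ T t) (hX : ∀ x ∈ A, ContDiffAt ℝ ∞ X x)
    (hU : ∀ t ∈ I, ContDiffAt ℝ ∞ U t) (hT' : ∀ t ∈ I, deriv T t ≠ 0)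
    (hX' : ∀ x ∈ A, deriv X x ≠ 0) (hU' : ∀ t ∈ I, U t ≠ 0) :
    ∃ e' I' A', I'.Nonempty ∧ A'.Nonempty ∧ I' ⊆ I ∧ A' ⊆ A ∧ Pushed e e' T X U σ I' A' C := by
  obtain ⟨t₀, ht₀⟩ := c.intvl_I.nonempty
  obtain ⟨x₀, hx₀⟩ := c.intvl_A.nonempty
  obtain ⟨I', J₁, S, hI', hJ₁, ht₀', hII, hT1, hS, hSs⟩ :=
    exists_local_inverse c.intvl_I.isOpen ht₀ hT hT'
  obtain ⟨A', J₂, R, hA', hJ₂, hx₀', hAA, hX1, hR, hRs⟩ :=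
    exists_local_inverse c.intvl_A.isOpen hx₀ hX hX'
  set Ψ : Pt → Pt := fun P => (S P.1, R P.2.1, P.2.2 / U (S P.1) + σ (S P.1, R P.2.1)) with hΨ
  have sΨ : ∀ s ∈ J₁, ∀ y ∈ J₂, ∀ v, ContDiffAt ℝ ∞ Ψ (s, y, v) := by
    intro s hs y hy v
    have c1 : ContDiffAt ℝ ∞ (fun P : Pt => S P.1) (s, y, v) :=
      ContDiffAt.comp (f := fun P : Pt => P.1) (s, y, v) (hSs s hs) contDiffAt_fst
    have c2 : ContDiffAt ℝ ∞ (fun P : Pt => R P.2.1) (s, y, v) :=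
      ContDiffAt.comp (f := fun P : Pt => P.2.1) (s, y, v) (hRs y hy) contDiffAt_snd.fst
    have c3 : ContDiffAt ℝ ∞ (fun P : Pt => U (S P.1)) (s, y, v) :=
      ContDiffAt.comp (f := fun P : Pt => S P.1) (s, y, v) (hU _ (hII (hS s hs).1)) c1
    have c4 : ContDiffAt ℝ ∞ (fun P : Pt => σ (S P.1, R P.2.1)) (s, y, v) :=
      ContDiffAt.comp (f := fun P : Pt => (S P.1, R P.2.1)) (s, y, v)
        (c.smooth_σ _ (hII (hS s hs).1) _ (hAA (hR y hy).1)) (c1.prodMk c2)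
    exact c1.prodMk (c2.prodMk
      ((contDiffAt_snd.snd.div c3 (hU' _ (hII (hS s hs).1))).add c4))
  have hΨΦ : ∀ t ∈ I', ∀ x ∈ A', ∀ u, Ψ (normMap T X U σ (t, x, u)) = (t, x, u) := by
    intro t ht x hx u
    simp only [hΨ, normMap, (hT1 t ht).2, (hX1 x hx).2]
    have := hU' t (hII ht)
    congr 2
    field_simp
    ring
  have hΦΨ : ∀ s ∈ J₁, ∀ y ∈ J₂, ∀ v, normMap T X U σ (Ψ (s, y, v)) = (s, y, v) := by
    intro s hs y hy v
    simp only [hΨ, normMap, (hS s hs).2, (hR y hy).2]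
    have := hU' (S s) (hII (hS s hs).1)
    congr 2
    field_simp
    ring
  refine ⟨⟨fun z => (e.g (S z.1, R z.2) + deriv U (S z.1) / U (S z.1)) / deriv T (S z.1),
    fun P => U (Ψ P).1 * (e.f (Ψ P) - defect e.g σ ((Ψ P).1, (Ψ P).2.1))
      / (deriv T (Ψ P).1 * deriv X (Ψ P).2.1)⟩, I', A', ⟨t₀, ht₀'⟩, ⟨x₀, hx₀'⟩, hII, hAA,
    hI', hA', c.intvl_C.isOpen,
    fun t ht x hx => c.smooth_g t (hII ht) x (hAA hx),
    fun t ht x hx => c.smooth_f t (hII ht) x (hAA hx),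
    fun t ht x hx => c.gx_ne t (hII ht) x (hAA hx),
    fun t ht x hx => c.fuu_ne t (hII ht) x (hAA hx),
    fun t ht x hx => c.smooth_σ t (hII ht) x (hAA hx),
    fun t ht => hT t (hII ht), fun x hx => hX x (hAA hx), fun t ht => hU t (hII ht),
    fun t ht => hT' t (hII ht), fun x hx => hX' x (hAA hx), fun t ht => hU' t (hII ht),
    ?_, ?_, ?_, ?_, ?_, ?_⟩
  · rintro ⟨t, x, u⟩ ⟨ht, hx, -⟩ ⟨t', x', u'⟩ ⟨ht', hx', -⟩ heq
    rw [← hΨΦ t ht x hx u, heq, hΨΦ t' ht' x' hx' u']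
  · rintro ⟨t, x, u⟩ ⟨ht, hx, hu⟩
    have h1 : ∀ᶠ P in 𝓝 (normMap T X U σ (t, x, u)), Ψ P ∈ I' ×ˢ A' ×ˢ C := by
      have hc : ContinuousAt Ψ (normMap T X U σ (t, x, u)) :=
        (sΨ _ (hT1 t ht).1 _ (hX1 x hx).1 _).continuousAt
      refine hc.eventually ((hI'.prod (hA'.prod c.intvl_C.isOpen)).mem_nhds ?_)
      rw [hΨΦ t ht x hx u]
      exact ⟨ht, hx, hu⟩
    have h2 : ∀ᶠ P : Pt in 𝓝 (normMap T X U σ (t, x, u)), P ∈ J₁ ×ˢ J₂ ×ˢ (univ : Set ℝ) :=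
      (hJ₁.prod (hJ₂.prod isOpen_univ)).mem_nhds ⟨(hT1 t ht).1, (hX1 x hx).1, mem_univ _⟩
    filter_upwards [h1, h2] with P hP hP'
    exact ⟨Ψ P, hP, hΦΨ _ hP'.1 _ hP'.2.1 _⟩
  · intro t ht x hx
    have c1 : ContDiffAt ℝ ∞ (fun z : ℝ × ℝ => S z.1) (T t, X x) :=
      ContDiffAt.comp (f := fun z : ℝ × ℝ => z.1) (T t, X x) (hSs _ (hT1 t ht).1) contDiffAt_fst
    have c2 : ContDiffAt ℝ ∞ (fun z : ℝ × ℝ => R z.2) (T t, X x) :=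
      ContDiffAt.comp (f := fun z : ℝ × ℝ => z.2) (T t, X x) (hRs _ (hX1 x hx).1) contDiffAt_snd
    have lift : ∀ F : ℝ → ℝ, ContDiffAt ℝ ∞ F t →
        ContDiffAt ℝ ∞ (fun z : ℝ × ℝ => F (S z.1)) (T t, X x) := fun F hF =>
      ContDiffAt.comp (f := fun z : ℝ × ℝ => S z.1) (T t, X x)
        (by simpa [(hT1 t ht).2] using hF) c1
    have c3 : ContDiffAt ℝ ∞ (fun z : ℝ × ℝ => e.g (S z.1, R z.2)) (T t, X x) :=
      ContDiffAt.comp (f := fun z : ℝ × ℝ => (S z.1, R z.2)) (T t, X x)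
        (by simpa [(hT1 t ht).2, (hX1 x hx).2] using c.smooth_g t (hII ht) x (hAA hx))
        (c1.prodMk c2)
    have hUt := hU t (hII ht)
    exact (c3.add ((lift _ (contDiffAt_deriv hUt)).div (lift _ hUt)
      (by simpa [(hT1 t ht).2] using hU' t (hII ht)))).div
      (lift _ (contDiffAt_deriv (hT t (hII ht))))
      (by simpa [(hT1 t ht).2] using hT' t (hII ht))
  · intro t ht x hx u hu
    have hσx := c.smooth_σ t (hII ht) x (hAA hx)
    have hgx := c.smooth_g t (hII ht) x (hAA hx)
    have c0 : ContDiffAt ℝ ∞ Ψ (normMap T X U σ (t, x, u)) :=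
      sΨ _ (hT1 t ht).1 _ (hX1 x hx).1 _
    have lift : ∀ F : Pt → ℝ, ContDiffAt ℝ ∞ F (t, x, u) →
        ContDiffAt ℝ ∞ (fun P => F (Ψ P)) (normMap T X U σ (t, x, u)) := fun F hF =>
      ContDiffAt.comp (f := Ψ) _ (by rwa [hΨΦ t ht x hx u]) c0
    refine lift (fun P => U P.1 * (e.f P - defect e.g σ (P.1, P.2.1))
      / (deriv T P.1 * deriv X P.2.1)) ?_
    have k1 : ∀ F : ℝ → ℝ, ContDiffAt ℝ ∞ F t →
        ContDiffAt ℝ ∞ (fun P : Pt => F P.1) (t, x, u) := fun F hF =>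
      ContDiffAt.comp (f := fun P : Pt => P.1) (t, x, u) hF contDiffAt_fst
    have k2 : ∀ F : ℝ → ℝ, ContDiffAt ℝ ∞ F x →
        ContDiffAt ℝ ∞ (fun P : Pt => F P.2.1) (t, x, u) := fun F hF =>
      ContDiffAt.comp (f := fun P : Pt => P.2.1) (t, x, u) hF contDiffAt_snd.fst
    have k3 : ContDiffAt ℝ ∞ (fun P : Pt => defect e.g σ (P.1, P.2.1)) (t, x, u) :=
      ContDiffAt.comp (f := fun P : Pt => (P.1, P.2.1)) (t, x, u) (contDiffAt_defect hgx hσx)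
        (contDiffAt_fst.prodMk contDiffAt_snd.fst)
    exact ((k1 _ (hU t (hII ht))).mul ((c.smooth_f t (hII ht) x (hAA hx) u hu).sub k3)).div
      ((k1 _ (contDiffAt_deriv (hT t (hII ht)))).mul (k2 _ (contDiffAt_deriv (hX x (hAA hx)))))
      (mul_ne_zero (hT' t (hII ht)) (hX' x (hAA hx)))
  · intro t ht x hx
    simp only [(hT1 t ht).2, (hX1 x hx).2]
    exact div_mul_cancel₀ _ (hT' t (hII ht))
  · intro t ht x hx u hu
    simp only [hΨΦ t ht x hx u]
    exact div_mul_cancel₀ _ (mul_ne_zero (hT' t (hII ht)) (hX' x (hAA hx)))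

theorem hasDerivAt_affine (a b u : ℝ) : HasDerivAt (fun s => a * s + b) a u := by
  simpa using ((hasDerivAt_id u).const_mul a).add_const b

namespace Pushed

variable {e e' : Equation} {T X U : ℝ → ℝ} {σ ℓ : ℝ × ℝ → ℝ} {I A C : Set ℝ}

theorem contDiffAt (p : Pushed e e' T X U σ I A C) {t x u : ℝ} (ht : t ∈ I) (hx : x ∈ A) :
    ContDiffAt ℝ ∞ (normMap T X U σ) (t, x, u) :=
  contDiffAt_normMap (p.smooth_T t ht) (p.smooth_X x hx) (p.smooth_U t ht) (p.smooth_σ t ht x hx)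

theorem isFirstKind (p : Pushed e e' T X U σ I A C) {W : Set Pt} (hW : W ⊆ I ×ˢ A ×ˢ C) :
    IsFirstKind (normMap T X U σ) W := by
  refine ⟨T, X, U, fun z => -(U z.1 * σ z), fun t x u h => ?_⟩
  obtain ⟨ht, hx, hu⟩ := hW h
  have c3 : ContDiffAt ℝ ∞ (fun z : ℝ × ℝ => U z.1) (t, x) :=
    ContDiffAt.comp (f := fun z : ℝ × ℝ => z.1) (t, x) (p.smooth_U t ht) contDiffAt_fst
  exact ⟨p.smooth_T t ht, p.smooth_X x hx, p.smooth_U t ht,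
    (c3.mul (p.smooth_σ t ht x hx)).neg, p.T_ne t ht, p.X_ne x hx, p.U_ne t ht, rfl⟩

/-- For `v(T, X) = U (u - σ)` the residuals of the two equations are proportional: `T' X'` times the
new one equals `U` times the old one, and both factors are nonzero. -/
theorem transformsInto (p : Pushed e e' T X U σ I A C) {W : Set Pt} (hW : W ⊆ I ×ˢ A ×ˢ C) :
    TransformsInto (normMap T X U σ) W e e' := by
  rintro u v D D' hD hD' hu hv hgr himg ⟨t, x⟩ hz ⟨t', x'⟩ hz' heq
  have hmem : ∀ s y, (s, y) ∈ D → s ∈ I ∧ y ∈ A ∧ u (s, y) ∈ C := fun s y hs =>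
    hW (hgr ⟨(s, y), hs, rfl⟩)
  -- The image of the whole graph lies on the graph of `v`, so the relation between `u` and `v`
  -- holds throughout `D` and may be differentiated.
  have hval : ∀ s y, (s, y) ∈ D → (T s, X y) ∈ D' ∧
      v (T s, X y) = U s * u (s, y) + -(U s * σ (s, y)) := by
    intro s y hs
    have h1 : normMap T X U σ (s, y, u (s, y)) ∈ graphOver v D' :=
      himg ▸ mem_image_of_mem _ ⟨(s, y), hs, rfl⟩
    obtain ⟨⟨a, b⟩, hab, h2⟩ := h1
    simp only [normMap, Prod.mk.injEq] at h2
    obtain ⟨rfl, rfl, h2⟩ := h2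
    exact ⟨hab, h2⟩
  have hus : ∀ w ∈ D, ContDiffAt ℝ ∞ u w := fun w hw => hu.contDiffAt (hD.mem_nhds hw)
  have hvs : ∀ w ∈ D', ContDiffAt ℝ ∞ v w := fun w hw => hv.contDiffAt (hD'.mem_nhds hw)
  obtain ⟨I₂, A₂, hI₂, hA₂, ht₂, hx₂, hsub⟩ := exists_box_subset₂ (hD.mem_nhds hz)
  have hvx : ∀ s ∈ I₂, ∀ y ∈ A₂, deriv X y * dx v (T s, X y)
      = U s * (dx u (s, y) - dx σ (s, y)) := by
    intro s hs y hy
    obtain ⟨m1, m2, -⟩ := hmem s y (hsub ⟨hs, hy⟩)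
    have h1 := hasDerivAt_curve (a := fun _ => T s) (hvs _ (hval s y (hsub ⟨hs, hy⟩)).1).diff
      (hasDerivAt_const y (T s)) (p.smooth_X y m2).diff.hasDerivAt
    have h2 := ((hasDerivAt_dx (hus _ (hsub ⟨hs, hy⟩)).diff).const_mul (U s)).fun_add
      (((hasDerivAt_dx (p.smooth_σ s m1 y m2).diff).const_mul (U s)).fun_neg)
    have h3 := (h1.fun_sub h2).eq_zero_of_eqOn hA₂.isOpen hy
      (fun r hr => sub_eq_zero.2 (hval s r (hsub ⟨hs, hr⟩)).2)
    linarith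
  obtain ⟨m1, m2, m3⟩ := hmem t x hz
  obtain ⟨n1, n2⟩ := hval t x hz
  have hvtx : deriv X x * (deriv T t * dt (dx v) (T t, X x))
      = deriv U t * (dx u (t, x) - dx σ (t, x))
        + U t * (dt (dx u) (t, x) - dt (dx σ) (t, x)) := by
    have h1 := (hasDerivAt_curve (b := fun _ => X x) (contDiffAt_dx (hvs _ n1)).diff
      (p.smooth_T t m1).diff.hasDerivAt (hasDerivAt_const t (X x))).const_mul (deriv X x)
    have h2 := (p.smooth_U t m1).diff.hasDerivAt.fun_mul
      ((hasDerivAt_dt (contDiffAt_dx (hus _ hz)).diff).fun_sub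
        (hasDerivAt_dt (contDiffAt_dx (p.smooth_σ t m1 x m2)).diff))
    have h3 := (h1.fun_sub h2).eq_zero_of_eqOn hI₂.isOpen ht₂
      (fun r hr => sub_eq_zero.2 (hvx r hr x hx₂))
    linarith
  simp only [normMap, Prod.mk.injEq] at heq
  obtain ⟨rfl, rfl, -⟩ := heq
  have hT := p.T_ne t m1
  have hX := p.X_ne x m2
  have hU := p.U_ne t m1
  have hg := p.g_eq t m1 x m2
  have hf := p.f_eq t m1 x m2 _ m3
  simp only [normMap, defect] at hf
  rw [← n2] at hf
  have hUU : deriv U t / U t * U t = deriv U t := div_mul_cancel₀ _ hU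
  have key : deriv T t * deriv X x * (dt (dx v) (T t, X x)
      - (e'.g (T t, X x) * dx v (T t, X x) + e'.f (T t, X x, v (T t, X x))))
      = U t * (dt (dx u) (t, x) - (e.g (t, x) * dx u (t, x) + e.f (t, x, u (t, x)))) := by
    linear_combination hvtx - hf - (deriv X x * dx v (T t, X x)) * hg
      - (e.g (t, x) + deriv U t / U t) * hvx t ht₂ x hx₂
      - (dx u (t, x) - dx σ (t, x)) * hUU
  change dt (dx u) (t, x) = e.g (t, x) * dx u (t, x) + e.f (t, x, u (t, x)) ↔
    dt (dx v) (T t, X x)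
      = e'.g (T t, X x) * dx v (T t, X x) + e'.f (T t, X x, v (T t, X x))
  rw [← sub_eq_zero, ← sub_eq_zero (a := dt (dx v) (T t, X x))]
  constructor
  · intro h
    rw [h, mul_zero] at key
    exact (mul_eq_zero.1 key).resolve_left (mul_ne_zero hT hX)
  · intro h
    rw [h, mul_zero] at key
    exact (mul_eq_zero.1 key.symm).resolve_left hU

theorem isEquivalence (p : Pushed e e' T X U σ I A C) {W : Set Pt} (hW : W ⊆ I ×ˢ A ×ˢ C) :
    IsEquivalence (normMap T X U σ) W e e' :=
  ⟨p.injOn.mono hW, Or.inl (p.isFirstKind hW), p.transformsInto hW⟩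

theorem dx_g' (p : Pushed e e' T X U σ I A C) {t x : ℝ} (ht : t ∈ I) (hx : x ∈ A) :
    deriv X x * dx e'.g (T t, X x) * deriv T t = dx e.g (t, x) := by
  have h1 := ((hasDerivAt_curve (a := fun _ => T t) (p.smooth_g' t ht x hx).diff
    (hasDerivAt_const x (T t)) (p.smooth_X x hx).diff.hasDerivAt).mul_const (deriv T t)).fun_sub
    ((hasDerivAt_dx (p.smooth_g t ht x hx).diff).add_const (deriv U t / U t))
  have h2 := h1.eq_zero_of_eqOn p.isOpen_A hx (fun s hs => sub_eq_zero.2 (p.g_eq t ht s hs))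
  linarith

theorem d3_f' (p : Pushed e e' T X U σ I A C) {t x u : ℝ} (ht : t ∈ I) (hx : x ∈ A)
    (hu : u ∈ C) :
    d3 e'.f (normMap T X U σ (t, x, u)) * (deriv T t * deriv X x) = d3 e.f (t, x, u) := by
  have h1 := ((hasDerivAt_curve₃ (a := fun _ => T t) (b := fun _ => X x)
    (c := fun s => U t * s + -(U t * σ (t, x))) (s := u)
    (p.smooth_f' t ht x hx u hu).diff
    (hasDerivAt_const u (T t)) (hasDerivAt_const u (X x)) (hasDerivAt_affine _ _ _)).mul_const
      (deriv T t * deriv X x)).fun_sub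
    (((hasDerivAt_d3 (p.smooth_f t ht x hx u hu).diff).sub_const
      (defect e.g σ (t, x))).const_mul (U t))
  have h2 := h1.eq_zero_of_eqOn p.isOpen_C hu
    (fun s hs => sub_eq_zero.2 (p.f_eq t ht x hx s hs))
  have h3 : U t * (d3 e'.f (normMap T X U σ (t, x, u)) * (deriv T t * deriv X x)
      - d3 e.f (t, x, u)) = 0 := by
    unfold normMap
    linear_combination h2
  linarith [(mul_eq_zero.1 h3).resolve_left (p.U_ne t ht)]

theorem gx'_ne (p : Pushed e e' T X U σ I A C) {t x : ℝ} (ht : t ∈ I) (hx : x ∈ A) :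
    dx e'.g (T t, X x) ≠ 0 := by
  intro h
  have := p.dx_g' ht hx
  rw [h] at this
  exact p.gx_ne t ht x hx (by linarith)

theorem fuu'_ne (p : Pushed e e' T X U σ I A C) {t x u : ℝ} (ht : t ∈ I) (hx : x ∈ A)
    (hu : u ∈ C) : d3 (d3 e'.f) (normMap T X U σ (t, x, u)) ≠ 0 := by
  intro h
  have h1 := ((hasDerivAt_curve₃ (a := fun _ => T t) (b := fun _ => X x)
    (c := fun s => U t * s + -(U t * σ (t, x))) (s := u)
    (contDiffAt_d3 (p.smooth_f' t ht x hx u hu)).diff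
    (hasDerivAt_const u (T t)) (hasDerivAt_const u (X x)) (hasDerivAt_affine _ _ _)).mul_const
      (deriv T t * deriv X x)).fun_sub
    (hasDerivAt_d3 (contDiffAt_d3 (p.smooth_f t ht x hx u hu)).diff)
  have h2 := h1.eq_zero_of_eqOn p.isOpen_C hu
    (fun s hs => sub_eq_zero.2 (p.d3_f' ht hx hs))
  simp only [normMap] at h
  rw [h] at h2
  exact p.fuu_ne t ht x hx u hu (by linarith)

end Pushed

/-- The determining equations of the field `τ(t) ∂_t + ξ(x) ∂_x + h(t) u ∂_u` on `B`. -/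
structure Reduced (e : Equation) (B : Set Pt) (τ ξ h : ℝ → ℝ) : Prop where
  det_g : ∀ t x u, (t, x, u) ∈ B → deriv h t
    = τ t * dt e.g (t, x) + ξ x * dx e.g (t, x) + deriv τ t * e.g (t, x)
  det_f : ∀ t x u, (t, x, u) ∈ B →
    τ t * d1 e.f (t, x, u) + ξ x * d2 e.f (t, x, u) + h t * u * d3 e.f (t, x, u)
      = (h t - deriv ξ x - deriv τ t) * e.f (t, x, u)

/-- The field `τ ∂_t + ξ ∂_x + h u ∂_u` on `(t, x, u)`-space. -/
def field (τ ξ h : ℝ → ℝ) (P : Pt) : Pt := (τ P.1, ξ P.2.1, h P.1 * P.2.2)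

/-- The map with components `T`, `X`, `U` takes the field with components `τ, ξ, h` to the one with
components `τ', ξ', h'`. -/
structure Related (T X U τ ξ h τ' ξ' h' : ℝ → ℝ) (I A : Set ℝ) : Prop where
  diff_τ : Differentiable ℝ τ'
  diff_ξ : Differentiable ℝ ξ'
  diff_h : Differentiable ℝ h'
  rel_T : ∀ t ∈ I, τ t * deriv T t = τ' (T t)
  rel_X : ∀ x ∈ A, ξ x * deriv X x = ξ' (X x)
  rel_U : ∀ t ∈ I, τ t * deriv U t + h t * U t = h' (T t) * U t

theorem Related.mono {T X U τ ξ h τ' ξ' h' : ℝ → ℝ} {I A I' A' : Set ℝ}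
    (r : Related T X U τ ξ h τ' ξ' h' I A) (hI : I' ⊆ I) (hA : A' ⊆ A) :
    Related T X U τ ξ h τ' ξ' h' I' A' where
  diff_τ := r.diff_τ
  diff_ξ := r.diff_ξ
  diff_h := r.diff_h
  rel_T t ht := r.rel_T t (hI ht)
  rel_X x hx := r.rel_X x (hA hx)
  rel_U t ht := r.rel_U t (hI ht)

/-! ### Transport of symmetries and determining equations -/

namespace Pushed

variable {e e' : Equation} {T X U : ℝ → ℝ} {σ ℓ : ℝ × ℝ → ℝ} {I A C : Set ℝ} {Q : Pt → Pt}
  {τ ξ h τ' ξ' h' : ℝ → ℝ}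

theorem fderiv_normMap (p : Pushed e e' T X U σ I A C) (f : ChartForm e Q I A C σ ℓ τ ξ h)
    (r : Related T X U τ ξ h τ' ξ' h' I A) {P : Pt} (hP : P ∈ I ×ˢ A ×ˢ C) :
    fderiv ℝ (normMap T X U σ) P (Q P) = field τ' ξ' h' (normMap T X U σ P) := by
  obtain ⟨t, x, u⟩ := P
  obtain ⟨ht, hx, hu⟩ := hP
  simp only at ht hx hu
  have hc := p.contDiffAt (u := u) ht hx
  have hT := (p.smooth_T t ht).diff.hasDerivAt
  have hX := (p.smooth_X x hx).diff.hasDerivAt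
  have hU := (p.smooth_U t ht).diff.hasDerivAt
  have hσ := (p.smooth_σ t ht x hx).diff
  have e11 := (hasDerivAt_d1 (contDiffAt_comp₁ hc).diff).unique hT
  have e12 := (hasDerivAt_d2 (contDiffAt_comp₁ hc).diff).unique (hasDerivAt_const x (T t))
  have e13 := (hasDerivAt_d3 (contDiffAt_comp₁ hc).diff).unique (hasDerivAt_const u (T t))
  have e21 := (hasDerivAt_d1 (contDiffAt_comp₂ hc).diff).unique (hasDerivAt_const t (X x))
  have e22 := (hasDerivAt_d2 (contDiffAt_comp₂ hc).diff).unique hX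
  have e23 := (hasDerivAt_d3 (contDiffAt_comp₂ hc).diff).unique (hasDerivAt_const u (X x))
  have e31 := (hasDerivAt_d1 (contDiffAt_comp₃ hc).diff).unique
    ((hU.mul_const u).fun_add (hU.fun_mul (hasDerivAt_dt hσ)).fun_neg)
  have e32 := (hasDerivAt_d2 (contDiffAt_comp₃ hc).diff).unique
    (((hasDerivAt_dx hσ).const_mul (U t)).fun_neg.const_add (U t * u))
  have e33 := (hasDerivAt_d3 (contDiffAt_comp₃ hc).diff).unique
    (hasDerivAt_affine (U t) (-(U t * σ (t, x))) u)
  rw [f.eq t ht x hx u hu]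
  refine Prod.ext ?_ (Prod.ext ?_ ?_)
  · rw [fderiv_comp₁ hc, fderiv_eq_d, e11, e12, e13]
    simp only [field, normMap, ← r.rel_T t ht]
    ring
  · rw [fderiv_comp₂ hc, fderiv_eq_d, e21, e22, e23]
    simp only [field, normMap, ← r.rel_X x hx]
    ring
  · rw [fderiv_comp₃ hc, fderiv_eq_d, e31, e32, e33]
    simp only [field, normMap]
    linear_combination (u - σ (t, x)) * r.rel_U t ht

/-- Differentiating the transformation rules for `g` and `f` and the relations between the
components turns the old determining equations, up to nonzero factors, into the new ones. The
surface `σ` becomes `u = 0`, so no inhomogeneous vertical term is left. -/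
theorem reduced (p : Pushed e e' T X U σ I A C) (f : ChartForm e Q I A C σ ℓ τ ξ h)
    (r : Related T X U τ ξ h τ' ξ' h' I A) :
    Reduced e' (normMap T X U σ '' (I ×ˢ A ×ˢ C)) τ' ξ' h' := by
  have dτ : ∀ t ∈ I, deriv τ t * deriv T t + τ t * deriv (deriv T) t
      = deriv τ' (T t) * deriv T t := by
    intro t ht
    have hT := p.smooth_T t ht
    have h1 := ((f.smooth_τ t ht).diff.hasDerivAt.fun_mul
      (contDiffAt_deriv hT).diff.hasDerivAt).fun_sub
      ((r.diff_τ (T t)).hasDerivAt.comp t hT.diff.hasDerivAt)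
    have h2 := h1.eq_zero_of_eqOn p.isOpen_I ht (fun s hs => sub_eq_zero.2 (r.rel_T s hs))
    linarith
  have dξ : ∀ x ∈ A, deriv ξ x * deriv X x + ξ x * deriv (deriv X) x
      = deriv ξ' (X x) * deriv X x := by
    intro x hx
    have hX := p.smooth_X x hx
    have h1 := ((f.smooth_ξ x hx).diff.hasDerivAt.fun_mul
      (contDiffAt_deriv hX).diff.hasDerivAt).fun_sub
      ((r.diff_ξ (X x)).hasDerivAt.comp x hX.diff.hasDerivAt)
    have h2 := h1.eq_zero_of_eqOn p.isOpen_A hx (fun s hs => sub_eq_zero.2 (r.rel_X s hs))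
    linarith
  have rU : ∀ t ∈ I, τ t * (deriv U t / U t) + h t = h' (T t) := by
    intro t ht
    have := p.U_ne t ht
    have h1 := r.rel_U t ht
    field_simp
    linarith
  constructor
  · rintro _ _ _ ⟨⟨t, x, u⟩, ⟨ht, hx, hu⟩, heq⟩
    simp only at ht hx hu
    simp only [normMap, Prod.mk.injEq] at heq
    obtain ⟨rfl, rfl, -⟩ := heq
    have hT := p.smooth_T t ht
    have hU := p.smooth_U t ht
    have hlog : HasDerivAt (fun s => deriv U s / U s) (deriv (fun s => deriv U s / U s) t) t :=
      ((contDiffAt_deriv hU).div hU (p.U_ne t ht)).diff.hasDerivAt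
    have dh := ((((f.smooth_τ t ht).diff.hasDerivAt.fun_mul hlog).fun_add
      (f.smooth_h t ht).diff.hasDerivAt).fun_sub
      ((r.diff_h (T t)).hasDerivAt.comp t hT.diff.hasDerivAt)).eq_zero_of_eqOn p.isOpen_I ht
      (fun s hs => sub_eq_zero.2 (rU s hs))
    have gt := (((hasDerivAt_curve (b := fun _ => X x) (p.smooth_g' t ht x hx).diff
      hT.diff.hasDerivAt (hasDerivAt_const t (X x))).fun_mul
      (contDiffAt_deriv hT).diff.hasDerivAt).fun_sub
      ((hasDerivAt_dt (p.smooth_g t ht x hx).diff).fun_add hlog)).eq_zero_of_eqOn p.isOpen_I ht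
      (fun s hs => sub_eq_zero.2 (p.g_eq s hs x hx))
    have gx := p.dx_g' ht hx
    have key : deriv T t * (deriv h' (T t) - (τ' (T t) * dt e'.g (T t, X x)
        + ξ' (X x) * dx e'.g (T t, X x) + deriv τ' (T t) * e'.g (T t, X x))) = 0 := by
      rw [← r.rel_T t ht, ← r.rel_X x hx]
      linear_combination -dh + e'.g (T t, X x) * dτ t ht - τ t * gt - ξ x * gx
        + f.det_g t ht x hx - deriv τ t * p.g_eq t ht x hx
    linarith [(mul_eq_zero.1 key).resolve_left (p.T_ne t ht)]
  · rintro _ _ _ ⟨⟨t, x, u⟩, ⟨ht, hx, hu⟩, heq⟩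
    simp only at ht hx hu
    simp only [normMap, Prod.mk.injEq] at heq
    obtain ⟨rfl, rfl, rfl⟩ := heq
    have hT := p.smooth_T t ht
    have hX := p.smooth_X x hx
    have hU := p.smooth_U t ht
    have hσ := (p.smooth_σ t ht x hx).diff
    have hd := (contDiffAt_defect (p.smooth_g t ht x hx) (p.smooth_σ t ht x hx)).diff
    have hf := (p.smooth_f t ht x hx u hu).diff
    have hf' := (p.smooth_f' t ht x hx u hu).diff
    have vt := (hU.diff.hasDerivAt.mul_const u).fun_add
      (hU.diff.hasDerivAt.fun_mul (hasDerivAt_dt hσ)).fun_neg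
    have vx := ((hasDerivAt_dx hσ).const_mul (U t)).fun_neg.const_add (U t * u)
    have ft := (((hasDerivAt_curve₃ (b := fun _ => X x) hf' hT.diff.hasDerivAt
      (hasDerivAt_const t (X x)) vt).fun_mul
      ((contDiffAt_deriv hT).diff.hasDerivAt.mul_const (deriv X x))).fun_sub
      (hU.diff.hasDerivAt.fun_mul ((hasDerivAt_d1 hf).fun_sub (hasDerivAt_dt hd)))
      ).eq_zero_of_eqOn p.isOpen_I ht (fun s hs => sub_eq_zero.2 (p.f_eq s hs x hx u hu))
    have fx := (((hasDerivAt_curve₃ (a := fun _ => T t) hf' (hasDerivAt_const x (T t))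
      hX.diff.hasDerivAt vx).fun_mul
      ((contDiffAt_deriv hX).diff.hasDerivAt.const_mul (deriv T t))).fun_sub
      (((hasDerivAt_d2 hf).fun_sub (hasDerivAt_dx hd)).const_mul (U t))
      ).eq_zero_of_eqOn p.isOpen_A hx (fun s hs => sub_eq_zero.2 (p.f_eq t ht s hs u hu))
    have fu := p.d3_f' ht hx hu
    have fe := p.f_eq t ht x hx u hu
    simp only [normMap] at fu fe
    have hdet := f.det_f t ht x hx u hu
    have hUU : deriv U t / U t * U t = deriv U t := div_mul_cancel₀ _ (p.U_ne t ht)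
    set F := e'.f (T t, X x, U t * u + -(U t * σ (t, x))) with hF
    set F1 := d1 e'.f (T t, X x, U t * u + -(U t * σ (t, x))) with hF1
    set F2 := d2 e'.f (T t, X x, U t * u + -(U t * σ (t, x))) with hF2
    set F3 := d3 e'.f (T t, X x, U t * u + -(U t * σ (t, x))) with hF3
    have key : deriv T t * deriv X x * (τ' (T t) * F1 + ξ' (X x) * F2
        + h' (T t) * (U t * u + -(U t * σ (t, x))) * F3
        - (h' (T t) - deriv ξ' (X x) - deriv τ' (T t)) * F) = 0 := by
      rw [← r.rel_T t ht, ← r.rel_X x hx, ← rU t ht]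
      linear_combination τ t * ft + ξ x * fx + U t * hdet
        + (τ t * U t * dt σ (t, x) + ξ x * U t * dx σ (t, x)
          + h t * U t * (u - σ (t, x))) * fu
        + τ t * (u - σ (t, x)) * F3 * deriv T t * deriv X x * hUU
        - (h t + τ t * (deriv U t / U t) - deriv ξ x - deriv τ t) * fe
        - (deriv X x * F) * dτ t ht - (deriv T t * F) * dξ x hx
        - τ t * (e.f (t, x, u) - defect e.g σ (t, x)) * hUU
    linarith [(mul_eq_zero.1 key).resolve_left (mul_ne_zero (p.T_ne t ht) (p.X_ne x hx))]

end Pushed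

end

/-! ### Invariant equations -/

section

/-- The equation is smooth on `B`, and `g_x`, `f_uu` vanish nowhere there. -/
structure Regular (e : Equation) (B : Set Pt) : Prop where
  smooth_g : ∀ t x u, (t, x, u) ∈ B → ContDiffAt ℝ ∞ e.g (t, x)
  smooth_f : ∀ t x u, (t, x, u) ∈ B → ContDiffAt ℝ ∞ e.f (t, x, u)
  gx_ne : ∀ t x u, (t, x, u) ∈ B → dx e.g (t, x) ≠ 0
  fuu_ne : ∀ t x u, (t, x, u) ∈ B → d3 (d3 e.f) (t, x, u) ≠ 0

theorem Pushed.regular {e e' : Equation} {T X U : ℝ → ℝ} {σ : ℝ × ℝ → ℝ} {I A C : Set ℝ}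
    (p : Pushed e e' T X U σ I A C) :
    Regular e' (normMap T X U σ '' (I ×ˢ A ×ˢ C)) := by
  refine ⟨?_, ?_, ?_, ?_⟩ <;>
  · rintro _ _ _ ⟨⟨t, x, u⟩, ⟨ht, hx, hu⟩, heq⟩
    simp only at ht hx hu
    simp only [normMap, Prod.mk.injEq] at heq
    obtain ⟨rfl, rfl, rfl⟩ := heq
    first
    | exact p.smooth_g' t ht x hx
    | exact p.smooth_f' t ht x hx u hu
    | exact p.gx'_ne ht hx
    | exact p.fuu'_ne ht hx hu

/-- This transfers `f_uu ≠ 0` to the function of one invariant in a normal form, where `u` is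
rescaled by `b`. -/
theorem iteratedDeriv_two_slice {H : Pt → ℝ} {t x a b u : ℝ} {C : Set ℝ} (hC : IsOpen C)
    (hu : u ∈ C) (hH : ∀ s ∈ C, ContDiffAt ℝ ∞ H (t, x, b * s)) :
    iteratedDeriv 2 (fun s => a * H (t, x, b * s)) u = a * b ^ 2 * d3 (d3 H) (t, x, b * u) := by
  have h1 : ∀ (K : Pt → ℝ) (d s : ℝ), ContDiffAt ℝ ∞ K (t, x, b * s) →
      deriv (fun s => d * K (t, x, b * s)) s = d * b * d3 K (t, x, b * s) := by
    intro K d s hK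
    have hb : HasDerivAt (fun s => b * s) b s := by simpa using hasDerivAt_affine b 0 s
    have h := (hasDerivAt_curve₃ (a := fun _ => t) (b := fun _ => x) (c := fun s => b * s) (s := s)
      hK.diff (hasDerivAt_const s t) (hasDerivAt_const s x) hb).const_mul d
    rw [h.deriv]
    ring
  rw [iteratedDeriv_succ, iteratedDeriv_one]
  have h2 : deriv (fun s => a * H (t, x, b * s)) =ᶠ[𝓝 u] fun s => a * b * d3 H (t, x, b * s) :=
    Filter.eventually_of_mem (hC.mem_nhds hu) fun s hs => h1 H a s (hH s hs)
  rw [h2.deriv_eq, h1 _ _ _ (contDiffAt_d3 (hH u hu))]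
  ring

variable {e : Equation} {B : Set Pt}

theorem exists_formA12 (reg : Regular e B)
    (red : Reduced e B (fun _ => 1) (fun _ => 0) (fun _ => 0)) {P : Pt} (hB : B ∈ 𝓝 P) :
    ∃ W, IsOpen W ∧ P ∈ W ∧ W ⊆ B ∧ FormA12 e W := by
  obtain ⟨t₀, x₀, u₀⟩ := P
  obtain ⟨I, A, C, hI, hA, hC, ht₀, hx₀, hu₀, hsub⟩ := exists_box_subset₃ hB
  have m : ∀ t ∈ I, ∀ x ∈ A, ∀ u ∈ C, (t, x, u) ∈ B := fun t ht x hx u hu => hsub ⟨ht, hx, hu⟩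
  refine ⟨I ×ˢ A ×ˢ C, hI.isOpen.prod (hA.isOpen.prod hC.isOpen), ⟨ht₀, hx₀, hu₀⟩, hsub,
    fun x => e.g (t₀, x), fun x u => e.f (t₀, x, u), fun t x u hP => ?_⟩
  obtain ⟨ht, hx, hu⟩ := hP
  simp only at ht hx hu
  have m₀ := m t₀ ht₀ x hx u hu
  refine ⟨?_, ?_, ?_, ?_, ?_, ?_⟩
  · exact ContDiffAt.comp (f := fun s : ℝ => ((t₀, s) : ℝ × ℝ)) x (reg.smooth_g _ _ _ m₀)
      (contDiffAt_const.prodMk contDiffAt_id)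
  · rw [(hasDerivAt_dx (reg.smooth_g _ _ _ m₀).diff).deriv]
    exact reg.gx_ne _ _ _ m₀
  · exact ContDiffAt.comp (f := fun z : ℝ × ℝ => ((t₀, z.1, z.2) : Pt)) (x, u)
      (reg.smooth_f _ _ _ m₀) (contDiffAt_const.prodMk (contDiffAt_fst.prodMk contDiffAt_snd))
  · have := iteratedDeriv_two_slice (H := e.f) (t := t₀) (x := x) (a := 1) (b := 1) hC.isOpen hu
      (fun s hs => by rw [one_mul]; exact reg.smooth_f _ _ _ (m t₀ ht₀ x hx s hs))
    simp only [one_mul, one_pow] at this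
    rw [this]
    exact reg.fuu_ne _ _ _ m₀
  · refine eq_of_hasDerivAt_zero (f := fun s => e.g (s, x)) hI.isOpen hI.conn
      (fun s hs => ?_) ht ht₀
    have h1 := red.det_g s x u (m s hs x hx u hu)
    simp only [deriv_const'] at h1
    have h2 : dt e.g (s, x) = 0 := by linarith
    exact h2 ▸ hasDerivAt_dt (reg.smooth_g _ _ _ (m s hs x hx u hu)).diff
  · refine eq_of_hasDerivAt_zero (f := fun s => e.f (s, x, u)) hI.isOpen hI.conn
      (fun s hs => ?_) ht ht₀
    have h1 := red.det_f s x u (m s hs x hx u hu)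
    simp only [deriv_const'] at h1
    have h2 : d1 e.f (s, x, u) = 0 := by linarith
    exact h2 ▸ hasDerivAt_d1 (reg.smooth_f _ _ _ (m s hs x hx u hu)).diff

/-- Along the rays `t / x = w` the determining equations say that `t g` and `t² f` are constant, so
their values at `t = t₀` define the functions of the invariants. -/
theorem exists_formA11 (reg : Regular e B)
    (red : Reduced e B (fun t => t) (fun x => x) (fun _ => 0)) {P : Pt} (hB : B ∈ 𝓝 P)
    (h1 : P.1 ≠ 0) (h2 : P.2.1 ≠ 0) :
    ∃ W, IsOpen W ∧ P ∈ W ∧ W ⊆ B ∧ FormA11 e W := by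
  obtain ⟨t₀, x₀, u₀⟩ := P
  simp only at h1 h2
  have hω₀ : t₀ / x₀ ≠ 0 := div_ne_zero h1 h2
  -- For `t ≠ 0` and `x ≠ 0` the map `(t, x) ↦ (t, t / x)` is its own inverse; it serves both as
  -- passage to the coordinates `(t, ω)` and as return from them.
  have hχ : ContinuousAt (fun R : Pt => ((R.1, R.1 / R.2.1, R.2.2) : Pt)) (t₀, t₀ / x₀, u₀) := by
    refine continuousAt_fst.prodMk (ContinuousAt.prodMk ?_ continuousAt_snd.snd)
    exact continuousAt_fst.div continuousAt_snd.fst hω₀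
  have hκ : ContinuousAt (fun R : Pt => ((R.1, R.1 / R.2.1, R.2.2) : Pt)) (t₀, x₀, u₀) := by
    refine continuousAt_fst.prodMk (ContinuousAt.prodMk ?_ continuousAt_snd.snd)
    exact continuousAt_fst.div continuousAt_snd.fst h2
  have hx₀ : t₀ / (t₀ / x₀) = x₀ := by field_simp
  have hS : {R : Pt | R.1 ≠ 0 ∧ R.2.1 ≠ 0 ∧ ((R.1, R.1 / R.2.1, R.2.2) : Pt) ∈ B}
      ∈ 𝓝 ((t₀, t₀ / x₀, u₀) : Pt) := by
    refine (continuousAt_fst.eventually_ne h1).and ((continuousAt_snd.fst.eventually_ne hω₀).and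
      (hχ.preimage_mem_nhds ?_))
    simpa only [hx₀] using hB
  obtain ⟨I, A, C, hI, hA, hC, ht₀, hw₀, hu₀, hsub⟩ := exists_box_subset₃ hS
  have m : ∀ t ∈ I, ∀ w ∈ A, ∀ u ∈ C, t ≠ 0 ∧ w ≠ 0 ∧ (t, t / w, u) ∈ B :=
    fun t ht x hx u hu => hsub (show ((t, x, u) : Pt) ∈ _ from ⟨ht, hx, hu⟩)
  obtain ⟨W, hWS, hWo, hPW⟩ := mem_nhds_iff.1 (Filter.inter_mem hB
    (Filter.inter_mem ((continuousAt_snd.fst (x := ((t₀, x₀, u₀) : Pt))).eventually_ne h2)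
      (hκ.eventually ((hI.isOpen.prod (hA.isOpen.prod hC.isOpen)).mem_nhds ⟨ht₀, hw₀, hu₀⟩))))
  have hdiv : ∀ w : ℝ, w ≠ 0 → HasDerivAt (fun w => t₀ / w) (-t₀ / w ^ 2) w := by
    intro w hw
    have := (hasDerivAt_const w t₀).fun_div (hasDerivAt_id w) hw
    simpa using this
  refine ⟨W, hWo, hPW, fun R hR => (hWS hR).1, fun w => t₀ * e.g (t₀, t₀ / w),
    fun u w => t₀ ^ 2 * e.f (t₀, t₀ / w, u), fun t x u hP => ?_⟩
  obtain ⟨-, hx0, ht, hw, hu⟩ := hWS hP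
  simp only [mem_ofPred_eq] at ht hw hu hx0
  obtain ⟨ht0, hw0, mB⟩ := m t ht _ hw u hu
  obtain ⟨-, -, m₀⟩ := m t₀ ht₀ _ hw u hu
  have hxx : t / (t / x) = x := by field_simp
  refine ⟨ht0, hx0, ?_, ?_, ?_, ?_, ?_, ?_⟩
  · refine contDiffAt_const.mul (ContDiffAt.comp (f := fun w : ℝ => ((t₀, t₀ / w) : ℝ × ℝ)) _
      (reg.smooth_g _ _ _ m₀) (contDiffAt_const.prodMk (contDiffAt_const.div contDiffAt_id hw0)))
  · have h := (hasDerivAt_curve (a := fun _ => t₀) (reg.smooth_g _ _ _ m₀).diff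
      (hasDerivAt_const (t / x) t₀) (hdiv _ hw0)).const_mul t₀
    rw [h.deriv, zero_mul, zero_add]
    exact mul_ne_zero h1 (mul_ne_zero (div_ne_zero (neg_ne_zero.2 h1) (pow_ne_zero 2 hw0))
      (reg.gx_ne _ _ _ m₀))
  · exact contDiffAt_const.mul (ContDiffAt.comp (f := fun z : ℝ × ℝ => ((t₀, t₀ / z.2, z.1) : Pt))
      (u, t / x) (reg.smooth_f _ _ _ m₀) (contDiffAt_const.prodMk
        ((contDiffAt_const.div contDiffAt_snd hw0).prodMk contDiffAt_fst)))
  · have := iteratedDeriv_two_slice (H := e.f) (t := t₀) (x := t₀ / (t / x)) (a := t₀ ^ 2)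
      (b := 1) hC.isOpen hu
      (fun s hs => by rw [one_mul]; exact reg.smooth_f _ _ _ (m t₀ ht₀ _ hw s hs).2.2)
    simp only [one_mul, one_pow, mul_one] at this
    rw [this]
    exact mul_ne_zero (pow_ne_zero 2 h1) (reg.fuu_ne _ _ _ m₀)
  · have := eq_of_hasDerivAt_zero (f := fun s => s * e.g (s, s / (t / x))) hI.isOpen hI.conn
      (fun s hs => ?_) ht ht₀
    · simp only [hxx] at this
      simp only [← this]
      field_simp
    · have mB := (m s hs _ hw u hu).2.2
      have h1 := red.det_g _ _ u mB
      simp only [deriv_const', deriv_id''] at h1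
      have h2 := (hasDerivAt_id s).fun_mul (hasDerivAt_curve (reg.smooth_g _ _ _ mB).diff
        (hasDerivAt_id s) ((hasDerivAt_id s).div_const (t / x)))
      refine h2.congr_deriv ?_
      simp only [id]
      linear_combination -h1
  · have := eq_of_hasDerivAt_zero (f := fun s => s ^ 2 * e.f (s, s / (t / x), u)) hI.isOpen
      hI.conn (fun s hs => ?_) ht ht₀
    · simp only [hxx] at this
      simp only [← this]
      field_simp
    · have mB := (m s hs _ hw u hu).2.2
      have h1 := red.det_f _ _ u mB
      simp only [deriv_id''] at h1
      have h2 := ((hasDerivAt_id s).fun_pow 2).fun_mul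
        (hasDerivAt_curve₃ (c := fun _ => u) (reg.smooth_f _ _ _ mB).diff
        (hasDerivAt_id s) ((hasDerivAt_id s).div_const (t / x)) (hasDerivAt_const s u))
      refine h2.congr_deriv ?_
      simp only [id]
      push_cast
      linear_combination s * h1

/-- In the coordinates `(t, x, e^{-tx} u)` the field is `∂_x`, so `g - x` and `e^{-tx} f` are
constant along its orbits. Their values at `x = x₀` define the normal form. -/
theorem exists_formA13 (reg : Regular e B)
    (red : Reduced e B (fun _ => 0) (fun _ => 1) (fun t => t)) {P : Pt} (hB : B ∈ 𝓝 P) :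
    ∃ W, IsOpen W ∧ P ∈ W ∧ W ⊆ B ∧ FormA13 e W := by
  obtain ⟨t₀, x₀, u₀⟩ := P
  set χ : Pt → Pt := fun R => (R.1, R.2.1, Real.exp (R.1 * R.2.1) * R.2.2) with hχ
  set κ : Pt → Pt := fun R => (R.1, R.2.1, Real.exp (-(R.1 * R.2.1)) * R.2.2) with hκ
  have hχc : Continuous χ := by rw [hχ]; fun_prop
  have hκc : Continuous κ := by rw [hκ]; fun_prop
  have hχκ : ∀ R, χ (κ R) = R := by
    rintro ⟨t, x, u⟩
    simp only [hχ, hκ, ← mul_assoc, ← Real.exp_add, add_neg_cancel, Real.exp_zero, one_mul]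
  have hS : χ ⁻¹' B ∈ 𝓝 (κ (t₀, x₀, u₀)) :=
    hχc.continuousAt.preimage_mem_nhds (by rwa [hχκ])
  obtain ⟨I, A, C, hI, hA, hC, ht₀, hx₀, hu₀, hsub⟩ := exists_box_subset₃ hS
  have m : ∀ t ∈ I, ∀ x ∈ A, ∀ w ∈ C, (t, x, Real.exp (t * x) * w) ∈ B :=
    fun t ht x hx w hw => hsub (show ((t, x, w) : Pt) ∈ _ from ⟨ht, hx, hw⟩)
  have hWB : κ ⁻¹' (I ×ˢ A ×ˢ C) ⊆ B := by
    intro R hR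
    have := hsub hR
    rwa [mem_preimage, hχκ] at this
  refine ⟨κ ⁻¹' (I ×ˢ A ×ˢ C), (hI.isOpen.prod (hA.isOpen.prod hC.isOpen)).preimage hκc,
    ⟨ht₀, hx₀, hu₀⟩, hWB, fun t => e.g (t, x₀) - x₀,
    fun t w => Real.exp (-(t * x₀)) * e.f (t, x₀, Real.exp (t * x₀) * w), fun t x u hP => ?_⟩
  obtain ⟨ht, hx, hw⟩ := hP
  simp only [hκ] at ht hx hw
  have m₀ := m t ht x₀ hx₀ _ hw
  refine ⟨?_, ?_, ?_, ?_, ?_⟩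
  · exact (ContDiffAt.comp (f := fun s : ℝ => ((s, x₀) : ℝ × ℝ)) t (reg.smooth_g _ _ _ m₀)
      (contDiffAt_id.prodMk contDiffAt_const)).sub contDiffAt_const
  · have c1 : ContDiffAt ℝ ∞ (fun z : ℝ × ℝ => Real.exp (-(z.1 * x₀)))
        (t, Real.exp (-(t * x)) * u) := by fun_prop
    have c2 : ContDiffAt ℝ ∞ (fun z : ℝ × ℝ => Real.exp (z.1 * x₀) * z.2)
        (t, Real.exp (-(t * x)) * u) := by fun_prop
    exact c1.mul (ContDiffAt.comp
      (f := fun z : ℝ × ℝ => ((z.1, x₀, Real.exp (z.1 * x₀) * z.2) : Pt))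
      (t, Real.exp (-(t * x)) * u)
      (reg.smooth_f _ _ _ m₀) (contDiffAt_fst.prodMk (contDiffAt_const.prodMk c2)))
  · rw [iteratedDeriv_two_slice hC.isOpen hw
      (fun s hs => reg.smooth_f _ _ _ (m t ht x₀ hx₀ s hs))]
    exact mul_ne_zero (mul_ne_zero (Real.exp_ne_zero _) (pow_ne_zero 2 (Real.exp_ne_zero _)))
      (reg.fuu_ne _ _ _ m₀)
  · have := eq_of_hasDerivAt_zero (f := fun s => e.g (t, s) - s) hA.isOpen hA.conn
      (fun s hs => ?_) hx hx₀
    · linarith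
    · have mB := m t ht s hs _ hw
      have h1 := red.det_g _ _ _ mB
      simp only [deriv_const', deriv_id''] at h1
      refine ((hasDerivAt_dx (reg.smooth_g _ _ _ mB).diff).fun_sub (hasDerivAt_id s)).congr_deriv ?_
      linarith
  · have := eq_of_hasDerivAt_zero (f := fun s => Real.exp (-(t * s)) *
      e.f (t, s, Real.exp (t * s) * (Real.exp (-(t * x)) * u))) hA.isOpen hA.conn
      (fun s hs => ?_) hx hx₀
    · beta_reduce at this ⊢
      rw [← this]
      simp only [← mul_assoc, ← Real.exp_add, add_neg_cancel, Real.exp_zero, one_mul]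
    · have mB := m t ht s hs _ hw
      have h1 := red.det_f _ _ _ mB
      simp only [deriv_const'] at h1
      have hts : HasDerivAt (fun s => t * s) t s := by simpa using hasDerivAt_affine t 0 s
      have h2 := hts.fun_neg.exp.fun_mul
        (hasDerivAt_curve₃ (a := fun _ => t) (b := fun s => s)
        (c := fun s => Real.exp (t * s) * (Real.exp (-(t * x)) * u)) (s := s)
        (reg.smooth_f _ _ _ mB).diff (hasDerivAt_const s t) (hasDerivAt_id s)
        (hts.exp.mul_const _))
      refine h2.congr_deriv ?_
      linear_combination Real.exp (-(t * s)) * h1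

/-! ### Transitive algebras -/

theorem const_of_two_fields {z : ℝ × ℝ → ℝ} {I A : Set ℝ} {τ₁ ξ₁ τ₂ ξ₂ : ℝ → ℝ}
    (hI : IsIntvl I) (hA : IsIntvl A) (hz : ∀ t ∈ I, ∀ x ∈ A, DifferentiableAt ℝ z (t, x))
    (h₁ : ∀ t ∈ I, ∀ x ∈ A, τ₁ t * dt z (t, x) + ξ₁ x * dx z (t, x) = 0)
    (h₂ : ∀ t ∈ I, ∀ x ∈ A, τ₂ t * dt z (t, x) + ξ₂ x * dx z (t, x) = 0)
    (hd : ∀ t ∈ I, ∀ x ∈ A, τ₁ t * ξ₂ x - τ₂ t * ξ₁ x ≠ 0) {t x t₀ x₀ : ℝ}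
    (ht : t ∈ I) (hx : x ∈ A) (ht₀ : t₀ ∈ I) (hx₀ : x₀ ∈ A) : z (t, x) = z (t₀, x₀) := by
  have e1 : ∀ t ∈ I, ∀ x ∈ A, dt z (t, x) = 0 := fun t ht x hx =>
    (mul_eq_zero.1 (show (τ₁ t * ξ₂ x - τ₂ t * ξ₁ x) * dt z (t, x) = 0 by
      linear_combination ξ₂ x * h₁ t ht x hx - ξ₁ x * h₂ t ht x hx)).resolve_left (hd t ht x hx)
  have e2 : ∀ t ∈ I, ∀ x ∈ A, dx z (t, x) = 0 := fun t ht x hx =>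
    (mul_eq_zero.1 (show (τ₁ t * ξ₂ x - τ₂ t * ξ₁ x) * dx z (t, x) = 0 by
      linear_combination τ₁ t * h₂ t ht x hx - τ₂ t * h₁ t ht x hx)).resolve_left (hd t ht x hx)
  have e3 := eq_of_hasDerivAt_zero (f := fun s => z (s, x)) hI.isOpen hI.conn
    (fun s hs => e1 s hs x hx ▸ hasDerivAt_dt (hz s hs x hx)) ht ht₀
  have e4 := eq_of_hasDerivAt_zero (f := fun s => z (t₀, s)) hA.isOpen hA.conn
    (fun s hs => e2 t₀ ht₀ s hs ▸ hasDerivAt_dx (hz t₀ ht₀ s hs)) hx hx₀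
  exact e3.trans e4

/-- The field `τ(t) ∂_t + ξ(x) ∂_x + h(t) u ∂_u` acts on the auxiliary functions `a, b, ε, ν` as it
does on the coefficients of an invariant equation. -/
structure Aux (Z : Set (ℝ × ℝ)) (τ ξ h : ℝ → ℝ) (a b ε ν : ℝ × ℝ → ℝ) : Prop where
  act_a : ∀ t x, (t, x) ∈ Z → τ t * dt a (t, x) + ξ x * dx a (t, x) = deriv τ t * a (t, x)
  act_b : ∀ t x, (t, x) ∈ Z → τ t * dt b (t, x) + ξ x * dx b (t, x) = deriv h t * a (t, x)
  act_ε : ∀ t x, (t, x) ∈ Z → τ t * dt ε (t, x) + ξ x * dx ε (t, x) = h t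
  act_ν : ∀ t x, (t, x) ∈ Z →
    τ t * dt ν (t, x) + ξ x * dx ν (t, x) = h t - deriv ξ x - deriv τ t

/-- An equation invariant under two fields that are transitive on the `(t, x)`-plane. -/
theorem exists_form_of_two_fields (reg : Regular e B) {τ₁ ξ₁ h₁ τ₂ ξ₂ h₂ : ℝ → ℝ}
    (red₁ : Reduced e B τ₁ ξ₁ h₁) (red₂ : Reduced e B τ₂ ξ₂ h₂) {P : Pt} (hB : B ∈ 𝓝 P)
    {Z : Set (ℝ × ℝ)} (hZ : IsOpen Z) (hPZ : base P ∈ Z) {a b ε ν : ℝ × ℝ → ℝ}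
    (sa : ∀ z ∈ Z, DifferentiableAt ℝ a z) (sb : ∀ z ∈ Z, DifferentiableAt ℝ b z)
    (sε : ∀ z ∈ Z, DifferentiableAt ℝ ε z) (sν : ∀ z ∈ Z, DifferentiableAt ℝ ν z)
    (aux₁ : Aux Z τ₁ ξ₁ h₁ a b ε ν) (aux₂ : Aux Z τ₂ ξ₂ h₂ a b ε ν)
    (hd : ∀ t x, (t, x) ∈ Z → τ₁ t * ξ₂ x - τ₂ t * ξ₁ x ≠ 0) :
    ∃ (W : Set Pt) (k : ℝ) (F : ℝ → ℝ), IsOpen W ∧ P ∈ W ∧ W ⊆ B ∧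
      ∀ t x u, (t, x, u) ∈ W → (t, x) ∈ Z ∧ a (t, x) * e.g (t, x) - b (t, x) = k ∧
        ContDiffAt ℝ ∞ F (Real.exp (-ε (t, x)) * u) ∧
        iteratedDeriv 2 F (Real.exp (-ε (t, x)) * u) ≠ 0 ∧
        e.f (t, x, u) = Real.exp (ν (t, x)) * F (Real.exp (-ε (t, x)) * u) := by
  obtain ⟨t₀, x₀, u₀⟩ := P
  -- The invariant `w = e^{-ε} u` is the new vertical coordinate: `κ` introduces it and `χ` returns
  -- to `u`.
  set χ : Pt → Pt := fun R => (R.1, R.2.1, Real.exp (ε (R.1, R.2.1)) * R.2.2) with hχ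
  set κ : Pt → Pt := fun R => (R.1, R.2.1, Real.exp (-ε (R.1, R.2.1)) * R.2.2) with hκ
  have hZb : ∀ u, ∀ᶠ R : Pt in 𝓝 (t₀, x₀, u), (R.1, R.2.1) ∈ Z := fun u =>
    (show Continuous fun R : Pt => (R.1, R.2.1) by fun_prop).continuousAt.eventually
      (hZ.mem_nhds hPZ)
  have hεc : ∀ u, ContinuousAt (fun R : Pt => ε (R.1, R.2.1)) (t₀, x₀, u) := fun u =>
    ContinuousAt.comp (f := fun R : Pt => (R.1, R.2.1)) (sε _ hPZ).continuousAt (by fun_prop)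
  have hχκ : ∀ R, χ (κ R) = R := by
    rintro ⟨t, x, u⟩
    simp only [hχ, hκ, ← mul_assoc, ← Real.exp_add, add_neg_cancel, Real.exp_zero, one_mul]
  have hS : {R : Pt | (R.1, R.2.1) ∈ Z ∧ χ R ∈ B} ∈ 𝓝 (κ (t₀, x₀, u₀)) := by
    have hχc : ContinuousAt χ (κ (t₀, x₀, u₀)) :=
      continuousAt_fst.prodMk (continuousAt_snd.fst.prodMk
      ((Real.continuous_exp.continuousAt.comp (hεc _)).mul continuousAt_snd.snd))
    exact (hZb _).and (hχc.preimage_mem_nhds (by rwa [hχκ]))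
  have hκc : ContinuousAt κ (t₀, x₀, u₀) :=
    continuousAt_fst.prodMk (continuousAt_snd.fst.prodMk
      ((Real.continuous_exp.continuousAt.comp (hεc _).neg).mul continuousAt_snd.snd))
  obtain ⟨I, A, C, hI, hA, hC, ht₀, hx₀, hu₀, hsub⟩ := exists_box_subset₃ hS
  have m : ∀ t ∈ I, ∀ x ∈ A, ∀ w ∈ C,
      (t, x) ∈ Z ∧ (t, x, Real.exp (ε (t, x)) * w) ∈ B :=
    fun t ht x hx w hw => hsub (show ((t, x, w) : Pt) ∈ _ from ⟨ht, hx, hw⟩)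
  obtain ⟨W, hWS, hWo, hPW⟩ := mem_nhds_iff.1 (Filter.inter_mem hB
    (hκc.eventually ((hI.isOpen.prod (hA.isOpen.prod hC.isOpen)).mem_nhds ⟨ht₀, hx₀, hu₀⟩)))
  refine ⟨W, a (t₀, x₀) * e.g (t₀, x₀) - b (t₀, x₀),
    fun w => Real.exp (-ν (t₀, x₀)) * e.f (t₀, x₀, Real.exp (ε (t₀, x₀)) * w), hWo, hPW,
    fun R hR => (hWS hR).1, fun t x u hP => ?_⟩
  obtain ⟨-, ht, hx, hw⟩ := hWS hP
  simp only [hκ] at ht hx hw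
  have m₀ := (m t₀ ht₀ x₀ hx₀ _ hw).2
  refine ⟨(m t ht x hx _ hw).1, ?_, ?_, ?_, ?_⟩
  · have hZ' : ∀ t ∈ I, ∀ x ∈ A, (t, x) ∈ Z := fun t ht x hx => (m t ht x hx _ hw).1
    have hB' : ∀ t ∈ I, ∀ x ∈ A, (t, x, Real.exp (ε (t, x)) * (Real.exp (-ε (t₀, x₀)) * u₀)) ∈ B :=
      fun t ht x hx => (m t ht x hx _ hu₀).2
    have hg : ∀ t ∈ I, ∀ x ∈ A, DifferentiableAt ℝ e.g (t, x) := fun t ht x hx =>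
      (reg.smooth_g _ _ _ (hB' t ht x hx)).diff
    have hz : ∀ t ∈ I, ∀ x ∈ A, DifferentiableAt ℝ (fun z => a z * e.g z - b z) (t, x) :=
      fun t ht x hx => ((sa _ (hZ' t ht x hx)).mul (hg t ht x hx)).sub (sb _ (hZ' t ht x hx))
    -- The actions on `a` and `b` are chosen so that `a g - b` is annihilated by both fields; by
    -- transitivity it is constant.
    have key : ∀ {τ ξ h : ℝ → ℝ}, Reduced e B τ ξ h → Aux Z τ ξ h a b ε ν →
        ∀ t ∈ I, ∀ x ∈ A, τ t * dt (fun z => a z * e.g z - b z) (t, x)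
          + ξ x * dx (fun z => a z * e.g z - b z) (t, x) = 0 := by
      intro τ ξ h red aux t ht x hx
      have e1 := (hasDerivAt_dt (hz t ht x hx)).unique
        (((hasDerivAt_dt (sa _ (hZ' t ht x hx))).fun_mul (hasDerivAt_dt (hg t ht x hx))).fun_sub
          (hasDerivAt_dt (sb _ (hZ' t ht x hx))))
      have e2 := (hasDerivAt_dx (hz t ht x hx)).unique
        (((hasDerivAt_dx (sa _ (hZ' t ht x hx))).fun_mul (hasDerivAt_dx (hg t ht x hx))).fun_sub
          (hasDerivAt_dx (sb _ (hZ' t ht x hx))))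
      rw [e1, e2]
      linear_combination e.g (t, x) * aux.act_a t x (hZ' t ht x hx)
        - aux.act_b t x (hZ' t ht x hx) - a (t, x) * red.det_g _ _ _ (hB' t ht x hx)
    exact const_of_two_fields (z := fun z => a z * e.g z - b z) hI hA hz (key red₁ aux₁)
      (key red₂ aux₂) (fun t ht x hx => hd t x (hZ' t ht x hx)) ht hx ht₀ hx₀
  · exact contDiffAt_const.mul (ContDiffAt.comp
      (f := fun w : ℝ => ((t₀, x₀, Real.exp (ε (t₀, x₀)) * w) : Pt)) _ (reg.smooth_f _ _ _ m₀)
      (contDiffAt_const.prodMk (contDiffAt_const.prodMk (contDiffAt_const.mul contDiffAt_id))))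
  · rw [iteratedDeriv_two_slice hC.isOpen hw
      (fun s hs => reg.smooth_f _ _ _ (m t₀ ht₀ x₀ hx₀ s hs).2)]
    exact mul_ne_zero (mul_ne_zero (Real.exp_ne_zero _) (pow_ne_zero 2 (Real.exp_ne_zero _)))
      (reg.fuu_ne _ _ _ m₀)
  · set w := Real.exp (-ε (t, x)) * u with hwdef
    have hZ' : ∀ t ∈ I, ∀ x ∈ A, (t, x) ∈ Z := fun t ht x hx => (m t ht x hx _ hw).1
    have hB' : ∀ t ∈ I, ∀ x ∈ A, (t, x, Real.exp (ε (t, x)) * w) ∈ B :=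
      fun t ht x hx => (m t ht x hx _ hw).2
    have hf : ∀ t ∈ I, ∀ x ∈ A, DifferentiableAt ℝ e.f (t, x, Real.exp (ε (t, x)) * w) :=
      fun t ht x hx => (reg.smooth_f _ _ _ (hB' t ht x hx)).diff
    have hz : ∀ t ∈ I, ∀ x ∈ A, DifferentiableAt ℝ
        (fun z : ℝ × ℝ => Real.exp (-ν z) * e.f (z.1, z.2, Real.exp (ε z) * w)) (t, x) := by
      intro t ht x hx
      have c1 := sε _ (hZ' t ht x hx)
      have c2 := sν _ (hZ' t ht x hx)
      exact c2.neg.exp.mul (DifferentiableAt.comp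
        (f := fun z : ℝ × ℝ => ((z.1, z.2, Real.exp (ε z) * w) : Pt)) (t, x) (hf t ht x hx)
        (differentiableAt_fst.prodMk (differentiableAt_snd.prodMk (c1.exp.mul_const w))))
    -- At fixed `w`, both fields annihilate `e^{-ν} f(t, x, e^ε w)`: the action on `ε` compensates
    -- the vertical term, the action on `ν` the weight of `f`.
    have key : ∀ {τ ξ h : ℝ → ℝ}, Reduced e B τ ξ h → Aux Z τ ξ h a b ε ν →
        ∀ t ∈ I, ∀ x ∈ A,
        τ t * dt (fun z : ℝ × ℝ => Real.exp (-ν z) * e.f (z.1, z.2, Real.exp (ε z) * w)) (t, x)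
        + ξ x * dx (fun z : ℝ × ℝ => Real.exp (-ν z) * e.f (z.1, z.2, Real.exp (ε z) * w)) (t, x)
          = 0 := by
      intro τ ξ h red aux t ht x hx
      have hεx := sε _ (hZ' t ht x hx)
      have hνx := sν _ (hZ' t ht x hx)
      have e1 := (hasDerivAt_dt (hz t ht x hx)).unique
        ((hasDerivAt_dt hνx).fun_neg.exp.fun_mul (hasDerivAt_curve₃ (b := fun _ => x)
          (c := fun s => Real.exp (ε (s, x)) * w) (s := t) (hf t ht x hx)
          (hasDerivAt_id t) (hasDerivAt_const t x) ((hasDerivAt_dt hεx).exp.mul_const w)))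
      have e2 := (hasDerivAt_dx (hz t ht x hx)).unique
        ((hasDerivAt_dx hνx).fun_neg.exp.fun_mul (hasDerivAt_curve₃ (a := fun _ => t)
          (c := fun s => Real.exp (ε (t, s)) * w) (s := x) (hf t ht x hx)
          (hasDerivAt_const x t) (hasDerivAt_id x) ((hasDerivAt_dx hεx).exp.mul_const w)))
      rw [e1, e2]
      linear_combination Real.exp (-ν (t, x)) * (red.det_f _ _ _ (hB' t ht x hx)
        - e.f (t, x, Real.exp (ε (t, x)) * w) * aux.act_ν t x (hZ' t ht x hx)
        + Real.exp (ε (t, x)) * w * d3 e.f (t, x, Real.exp (ε (t, x)) * w)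
          * aux.act_ε t x (hZ' t ht x hx))
    have h1 := const_of_two_fields
      (z := fun z : ℝ × ℝ => Real.exp (-ν z) * e.f (z.1, z.2, Real.exp (ε z) * w))
      hI hA hz (key red₁ aux₁)
      (key red₂ aux₂) (fun t ht x hx => hd t x (hZ' t ht x hx)) ht hx ht₀ hx₀
    beta_reduce at h1 ⊢
    rw [← h1, hwdef]
    simp only [← mul_assoc, ← Real.exp_add, add_neg_cancel, Real.exp_zero, one_mul]

end

/-! ### The equations with two-dimensional algebras -/

section

variable {e : Equation} {B : Set Pt}

theorem dt_eq {F : ℝ × ℝ → ℝ} {t x c : ℝ} (h : DifferentiableAt ℝ F (t, x))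
    (hc : HasDerivAt (fun s => F (s, x)) c t) : dt F (t, x) = c := (hasDerivAt_dt h).unique hc

theorem dx_eq {F : ℝ × ℝ → ℝ} {t x c : ℝ} (h : DifferentiableAt ℝ F (t, x))
    (hc : HasDerivAt (fun s => F (t, s)) c x) : dx F (t, x) = c := (hasDerivAt_dx h).unique hc

theorem abs_rpow_eq_exp {y : ℝ} (hy : y ≠ 0) (p : ℝ) : |y| ^ p = Real.exp (p * Real.log y) := by
  rw [Real.rpow_def_of_pos (abs_pos.2 hy), Real.log_abs, mul_comm]

theorem hasDerivAt_const_div {c x : ℝ} (hx : x ≠ 0) :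
    HasDerivAt (fun s => c / s) (-c / x ^ 2) x := by
  simpa using (hasDerivAt_const x c).fun_div (hasDerivAt_id x) hx

theorem hasDerivAt_log_sub_left {t x : ℝ} (h : t - x ≠ 0) :
    HasDerivAt (fun s => Real.log (s - x)) (1 / (t - x)) t :=
  ((hasDerivAt_id t).sub_const x).log h

theorem hasDerivAt_log_sub_right {t x : ℝ} (h : t - x ≠ 0) :
    HasDerivAt (fun s => Real.log (t - s)) (-1 / (t - x)) x :=
  ((hasDerivAt_id x).const_sub t).log h

theorem hasDerivAt_log' {x : ℝ} (h : x ≠ 0) : HasDerivAt Real.log (1 / x) x := by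
  simpa using Real.hasDerivAt_log h

theorem deriv_mul_id (m t : ℝ) : deriv (fun s => m * s) t = m := by
  simp

theorem deriv_sq (t : ℝ) : deriv (fun s : ℝ => s ^ 2) t = 2 * t := by
  simp

theorem exists_formA221 {m : ℝ} (reg : Regular e B)
    (red₁ : Reduced e B (fun t => t) (fun x => x) (fun _ => 0))
    (red₂ : Reduced e B (fun t => t ^ 2) (fun x => x ^ 2) (fun t => m * t)) {P : Pt}
    (hB : B ∈ 𝓝 P) (ht₀ : P.1 ≠ 0) (hx₀ : P.2.1 ≠ 0) (htx₀ : P.1 ≠ P.2.1) :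
    ∃ W, IsOpen W ∧ P ∈ W ∧ W ⊆ B ∧ ∃ k ≠ 0, FormA221 m k e W := by
  set Z : Set (ℝ × ℝ) := {z | z.1 ≠ 0 ∧ z.2 ≠ 0 ∧ z.1 - z.2 ≠ 0} with hZ
  have hZo : IsOpen Z := (isOpen_ne_fun continuous_fst continuous_const).inter
    ((isOpen_ne_fun continuous_snd continuous_const).inter
      (isOpen_ne_fun (continuous_fst.sub continuous_snd) continuous_const))
  set a : ℝ × ℝ → ℝ := fun z => z.1 ^ 2 / z.2 - z.1 with ha
  set b : ℝ × ℝ → ℝ := fun z => m * z.1 / z.2 with hb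
  -- `Real.log y` is `log |y|` for `y ≠ 0`, so these formulas hold for all signs and produce the
  -- powers of absolute values in the normal form.
  set ε : ℝ × ℝ → ℝ := fun z => m * Real.log (z.1 - z.2) - m * Real.log z.2 with hε
  set ν : ℝ × ℝ → ℝ := fun z => (m - 2) * Real.log (z.1 - z.2) - m * Real.log z.2 with hν
  have haa : ∀ t x, a (t, x) = t ^ 2 / x - t := fun _ _ => rfl
  have sa : ∀ z ∈ Z, DifferentiableAt ℝ a z := fun z ⟨_, h2, _⟩ => by fun_prop (disch := exact h2)
  have sb : ∀ z ∈ Z, DifferentiableAt ℝ b z := fun z ⟨_, h2, _⟩ => by fun_prop (disch := exact h2)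
  have sε : ∀ z ∈ Z, DifferentiableAt ℝ ε z := fun z ⟨_, h2, h3⟩ => by
    fun_prop (disch := first | exact h2 | exact h3)
  have sν : ∀ z ∈ Z, DifferentiableAt ℝ ν z := fun z ⟨_, h2, h3⟩ => by
    fun_prop (disch := first | exact h2 | exact h3)
  have at' : ∀ t x, (t, x) ∈ Z → dt a (t, x) = 2 * t / x - 1 := fun t x h => by
    refine dt_eq (sa _ h) ((((hasDerivAt_pow 2 t).div_const x).fun_sub
      (hasDerivAt_id t)).congr_deriv ?_)
    simp
  have ax : ∀ t x, (t, x) ∈ Z → dx a (t, x) = -t ^ 2 / x ^ 2 := fun t x h =>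
    dx_eq (sa _ h) ((hasDerivAt_const_div (c := t ^ 2) h.2.1).sub_const t)
  have bt : ∀ t x, (t, x) ∈ Z → dt b (t, x) = m / x := fun t x h => by
    refine dt_eq (sb _ h) ((((hasDerivAt_id t).const_mul m).div_const x).congr_deriv ?_)
    simp
  have bx : ∀ t x, (t, x) ∈ Z → dx b (t, x) = -(m * t) / x ^ 2 := fun t x h =>
    dx_eq (sb _ h) (hasDerivAt_const_div (c := m * t) h.2.1)
  have εt : ∀ t x, (t, x) ∈ Z → dt ε (t, x) = m * (1 / (t - x)) := fun t x h =>
    dt_eq (sε _ h) (((hasDerivAt_log_sub_left h.2.2).const_mul m).sub_const (m * Real.log x))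
  have εx : ∀ t x, (t, x) ∈ Z → dx ε (t, x) = m * (-1 / (t - x)) - m * (1 / x) := fun t x h =>
    dx_eq (sε _ h) (((hasDerivAt_log_sub_right h.2.2).const_mul m).fun_sub
      ((hasDerivAt_log' h.2.1).const_mul m))
  have νt : ∀ t x, (t, x) ∈ Z → dt ν (t, x) = (m - 2) * (1 / (t - x)) := fun t x h =>
    dt_eq (sν _ h) (((hasDerivAt_log_sub_left h.2.2).const_mul (m - 2)).sub_const (m * Real.log x))
  have νx : ∀ t x, (t, x) ∈ Z → dx ν (t, x) = (m - 2) * (-1 / (t - x)) - m * (1 / x) :=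
    fun t x h => dx_eq (sν _ h) (((hasDerivAt_log_sub_right h.2.2).const_mul (m - 2)).fun_sub
      ((hasDerivAt_log' h.2.1).const_mul m))
  have aux₁ : Aux Z (fun t => t) (fun x => x) (fun _ => 0) a b ε ν := by
    constructor <;>
    · intro t x h
      simp only [at' t x h, ax t x h, bt t x h, bx t x h, εt t x h, εx t x h, νt t x h, νx t x h,
        deriv_id'', deriv_const', haa]
      obtain ⟨h1, h2, h3⟩ := h
      simp only at h1 h2 h3
      field_simp
      try ring
  have aux₂ : Aux Z (fun t => t ^ 2) (fun x => x ^ 2) (fun t => m * t) a b ε ν := by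
    constructor <;>
    · intro t x h
      simp only [at' t x h, ax t x h, bt t x h, bx t x h, εt t x h, εx t x h, νt t x h, νx t x h,
        deriv_sq, deriv_mul_id, haa]
      obtain ⟨h1, h2, h3⟩ := h
      simp only at h1 h2 h3
      field_simp
      try ring
  have hPZ : base P ∈ Z := ⟨ht₀, hx₀, sub_ne_zero.2 htx₀⟩
  obtain ⟨W, k, F, hW, hPW, hWB, hF⟩ := exists_form_of_two_fields reg red₁ red₂ hB hZo hPZ
    sa sb sε sν aux₁ aux₂ (fun t x ⟨h1, h2, h3⟩ h0 => mul_ne_zero (mul_ne_zero h1 h2) h3 (by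
      simp only at h0 ⊢; linear_combination -h0))
  -- The constant value of `a g - b` is the coefficient `k - m` of the normal form, whence the shift
  -- by `m`.
  refine ⟨W, hW, hPW, hWB, k + m, fun hk => ?_, F, fun t x u hP => ?_⟩
  · obtain ⟨t, x, u⟩ := P
    obtain ⟨⟨h1, h2, h3⟩, hg, -⟩ := hF t x u hPW
    have r1 := red₁.det_g t x u (hWB hPW)
    have r2 := red₂.det_g t x u (hWB hPW)
    simp only [deriv_sq, deriv_mul_id, deriv_id'', deriv_const', ha, hb] at h1 h2 h3 hg r1 r2
    refine mul_ne_zero (mul_ne_zero h2 h3) (reg.gx_ne t x u (hWB hPW)) ?_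
    -- With the parameter of the normal form equal to zero, `t g = m`. The two determining equations
    -- combine to `x (t - x) g_x = t g - m`, so `g_x` would vanish.
    have hg' : (t - x) * (t * e.g (t, x) - m) = 0 := by
      field_simp at hg
      linear_combination hg + x * hk
    have := (mul_eq_zero.1 hg').resolve_left h3
    linear_combination r2 - t * r1 + this
  · obtain ⟨⟨h1, h2, h3⟩, hg, hFs, hFu, hf⟩ := hF t x u hP
    simp only at h1 h2 h3
    have hω : u * |t - x| ^ (-m) * |x| ^ m = Real.exp (-ε (t, x)) * u := by
      rw [abs_rpow_eq_exp h3, abs_rpow_eq_exp h2, mul_assoc, ← Real.exp_add, mul_comm]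
      congr 2
      simp only [hε]
      ring
    have hN : |t - x| ^ (m - 2) * |x| ^ (-m) = Real.exp (ν (t, x)) := by
      rw [abs_rpow_eq_exp h3, abs_rpow_eq_exp h2, ← Real.exp_add]
      congr 1
      simp only [hν]
      ring
    rw [hω, hN]
    refine ⟨h1, h2, sub_ne_zero.1 h3, hFs, hFu, ?_, hf⟩
    simp only [ha, hb] at hg
    field_simp at hg ⊢
    linear_combination hg

theorem exists_formA222 {m : ℝ} (reg : Regular e B)
    (red₁ : Reduced e B (fun t => t) (fun x => x) (fun _ => 0))
    (red₂ : Reduced e B (fun t => t ^ 2) (fun _ => 0) (fun t => m * t)) {P : Pt}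
    (hB : B ∈ 𝓝 P) (ht₀ : P.1 ≠ 0) (hx₀ : P.2.1 ≠ 0) :
    ∃ W, IsOpen W ∧ P ∈ W ∧ W ⊆ B ∧ ∃ k ≠ 0, FormA222 m k e W := by
  set Z : Set (ℝ × ℝ) := {z | z.1 ≠ 0 ∧ z.2 ≠ 0} with hZ
  have hZo : IsOpen Z := (isOpen_ne_fun continuous_fst continuous_const).inter
    (isOpen_ne_fun continuous_snd continuous_const)
  set a : ℝ × ℝ → ℝ := fun z => z.1 ^ 2 / z.2 with ha
  set b : ℝ × ℝ → ℝ := fun z => m * z.1 / z.2 with hb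
  set ε : ℝ × ℝ → ℝ := fun z => m * Real.log z.1 - m * Real.log z.2 with hε
  set ν : ℝ × ℝ → ℝ := fun z => (m - 2) * Real.log z.1 - m * Real.log z.2 with hν
  have haa : ∀ t x, a (t, x) = t ^ 2 / x := fun _ _ => rfl
  have sa : ∀ z ∈ Z, DifferentiableAt ℝ a z := fun z ⟨_, h2⟩ => by fun_prop (disch := exact h2)
  have sb : ∀ z ∈ Z, DifferentiableAt ℝ b z := fun z ⟨_, h2⟩ => by fun_prop (disch := exact h2)
  have sε : ∀ z ∈ Z, DifferentiableAt ℝ ε z := fun z ⟨h1, h2⟩ => by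
    fun_prop (disch := first | exact h1 | exact h2)
  have sν : ∀ z ∈ Z, DifferentiableAt ℝ ν z := fun z ⟨h1, h2⟩ => by
    fun_prop (disch := first | exact h1 | exact h2)
  have at' : ∀ t x, (t, x) ∈ Z → dt a (t, x) = 2 * t / x := fun t x h => by
    refine dt_eq (sa _ h) (((hasDerivAt_pow 2 t).div_const x).congr_deriv ?_)
    simp
  have ax : ∀ t x, (t, x) ∈ Z → dx a (t, x) = -t ^ 2 / x ^ 2 := fun t x h =>
    dx_eq (sa _ h) (hasDerivAt_const_div (c := t ^ 2) h.2)
  have bt : ∀ t x, (t, x) ∈ Z → dt b (t, x) = m / x := fun t x h => by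
    refine dt_eq (sb _ h) ((((hasDerivAt_id t).const_mul m).div_const x).congr_deriv ?_)
    simp
  have bx : ∀ t x, (t, x) ∈ Z → dx b (t, x) = -(m * t) / x ^ 2 := fun t x h =>
    dx_eq (sb _ h) (hasDerivAt_const_div (c := m * t) h.2)
  have εt : ∀ t x, (t, x) ∈ Z → dt ε (t, x) = m * (1 / t) := fun t x h =>
    dt_eq (sε _ h) (((hasDerivAt_log' h.1).const_mul m).sub_const (m * Real.log x))
  have εx : ∀ t x, (t, x) ∈ Z → dx ε (t, x) = -(m * (1 / x)) := fun t x h =>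
    dx_eq (sε _ h) (((hasDerivAt_log' h.2).const_mul m).const_sub (m * Real.log t))
  have νt : ∀ t x, (t, x) ∈ Z → dt ν (t, x) = (m - 2) * (1 / t) := fun t x h =>
    dt_eq (sν _ h) (((hasDerivAt_log' h.1).const_mul (m - 2)).sub_const (m * Real.log x))
  have νx : ∀ t x, (t, x) ∈ Z → dx ν (t, x) = -(m * (1 / x)) :=
    fun t x h => dx_eq (sν _ h) (((hasDerivAt_log' h.2).const_mul m).const_sub ((m - 2) * Real.log t))
  have aux₁ : Aux Z (fun t => t) (fun x => x) (fun _ => 0) a b ε ν := by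
    constructor <;>
    · intro t x h
      simp only [at' t x h, ax t x h, bt t x h, bx t x h, εt t x h, εx t x h, νt t x h, νx t x h,
        deriv_id'', deriv_const', haa]
      obtain ⟨h1, h2⟩ := h
      simp only at h1 h2
      field_simp
      try ring
  have aux₂ : Aux Z (fun t => t ^ 2) (fun _ => 0) (fun t => m * t) a b ε ν := by
    constructor <;>
    · intro t x h
      simp only [at' t x h, ax t x h, bt t x h, bx t x h, εt t x h, εx t x h, νt t x h, νx t x h,
        deriv_sq, deriv_mul_id, deriv_const', haa]
      obtain ⟨h1, h2⟩ := h
      simp only at h1 h2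
      field_simp
      try ring
  obtain ⟨W, k, F, hW, hPW, hWB, hF⟩ := exists_form_of_two_fields reg red₁ red₂ hB hZo
    (⟨ht₀, hx₀⟩ : base P ∈ Z)
    sa sb sε sν aux₁ aux₂ (fun t x ⟨h1, h2⟩ h0 => mul_ne_zero (mul_ne_zero h1 h1) h2 (by
      simp only at h0 ⊢; linear_combination -h0))
  refine ⟨W, hW, hPW, hWB, k, fun hk => ?_, F, fun t x u hP => ?_⟩
  · obtain ⟨t, x, u⟩ := P
    obtain ⟨⟨h1, h2⟩, hg, -⟩ := hF t x u hPW
    have r1 := red₁.det_g t x u (hWB hPW)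
    have r2 := red₂.det_g t x u (hWB hPW)
    simp only [deriv_sq, deriv_mul_id, deriv_id'', deriv_const', ha, hb] at h1 h2 hg r1 r2
    refine mul_ne_zero (mul_ne_zero h1 h2) (reg.gx_ne t x u (hWB hPW)) ?_
    -- For `k = 0` again `t g = m`, and the two determining equations give `t x g_x = t g - m = 0`,
    -- which is excluded.
    have hg' : t * (t * e.g (t, x) - m) = 0 := by
      field_simp at hg
      linear_combination hg + x * hk
    have := (mul_eq_zero.1 hg').resolve_left h1
    linear_combination r2 - t * r1 + this
  · obtain ⟨⟨h1, h2⟩, hg, hFs, hFu, hf⟩ := hF t x u hP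
    simp only at h1 h2
    have hω : |t| ^ (-m) * |x| ^ m * u = Real.exp (-ε (t, x)) * u := by
      rw [abs_rpow_eq_exp h1, abs_rpow_eq_exp h2, ← Real.exp_add]
      congr 2
      simp only [hε]
      ring
    have hN : |t| ^ (m - 2) * |x| ^ (-m) = Real.exp (ν (t, x)) := by
      rw [abs_rpow_eq_exp h1, abs_rpow_eq_exp h2, ← Real.exp_add]
      congr 1
      simp only [hν]
      ring
    rw [hω, hN]
    refine ⟨h1, h2, hFs, hFu, ?_, hf⟩
    simp only [ha, hb] at hg
    field_simp at hg ⊢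
    linear_combination hg

theorem exists_formA223 (reg : Regular e B)
    (red₁ : Reduced e B (fun t => t) (fun x => x) (fun _ => 0))
    (red₂ : Reduced e B (fun _ => 0) (fun x => x ^ 2) (fun t => t)) {P : Pt}
    (hB : B ∈ 𝓝 P) (ht₀ : P.1 ≠ 0) (hx₀ : P.2.1 ≠ 0) :
    ∃ W, IsOpen W ∧ P ∈ W ∧ W ⊆ B ∧ ∃ m, FormA223 m e W := by
  set Z : Set (ℝ × ℝ) := {z | z.1 ≠ 0 ∧ z.2 ≠ 0} with hZ
  have hZo : IsOpen Z := (isOpen_ne_fun continuous_fst continuous_const).inter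
    (isOpen_ne_fun continuous_snd continuous_const)
  set a : ℝ × ℝ → ℝ := fun z => z.1 with ha
  -- For both fields `h' a = h`, so the same function can play the roles of `b` and `ε`.
  set b : ℝ × ℝ → ℝ := fun z => -(z.1 / z.2) with hb
  set ν : ℝ × ℝ → ℝ := fun z => -(z.1 / z.2) - 2 * Real.log z.2 with hν
  have haa : ∀ t x, a (t, x) = t := fun _ _ => rfl
  have sa : ∀ z ∈ Z, DifferentiableAt ℝ a z := fun z _ => differentiableAt_fst
  have sb : ∀ z ∈ Z, DifferentiableAt ℝ b z := fun z ⟨_, h2⟩ => by fun_prop (disch := exact h2)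
  have sν : ∀ z ∈ Z, DifferentiableAt ℝ ν z := fun z ⟨_, h2⟩ => by fun_prop (disch := exact h2)
  have at' : ∀ t x, (t, x) ∈ Z → dt a (t, x) = 1 := fun t x h =>
    dt_eq (sa _ h) (hasDerivAt_id t)
  have ax : ∀ t x, (t, x) ∈ Z → dx a (t, x) = 0 := fun t x h =>
    dx_eq (sa _ h) (hasDerivAt_const x t)
  have bt : ∀ t x, (t, x) ∈ Z → dt b (t, x) = -(1 / x) := fun t x h =>
    dt_eq (sb _ h) ((hasDerivAt_id t).div_const x).fun_neg
  have bx : ∀ t x, (t, x) ∈ Z → dx b (t, x) = -(-t / x ^ 2) := fun t x h =>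
    dx_eq (sb _ h) (hasDerivAt_const_div (c := t) h.2).fun_neg
  have νt : ∀ t x, (t, x) ∈ Z → dt ν (t, x) = -(1 / x) := fun t x h =>
    dt_eq (sν _ h) (((hasDerivAt_id t).div_const x).fun_neg.sub_const (2 * Real.log x))
  have νx : ∀ t x, (t, x) ∈ Z → dx ν (t, x) = -(-t / x ^ 2) - 2 * (1 / x) := fun t x h =>
    dx_eq (sν _ h) ((hasDerivAt_const_div h.2).fun_neg.fun_sub
      ((hasDerivAt_log' h.2).const_mul 2))
  have aux₁ : Aux Z (fun t => t) (fun x => x) (fun _ => 0) a b b ν := by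
    constructor <;>
    · intro t x h
      simp only [at' t x h, ax t x h, bt t x h, bx t x h, νt t x h, νx t x h,
        deriv_id'', deriv_const', haa]
      obtain ⟨h1, h2⟩ := h
      simp only at h1 h2
      field_simp
      try ring
  have aux₂ : Aux Z (fun _ => 0) (fun x => x ^ 2) (fun t => t) a b b ν := by
    constructor <;>
    · intro t x h
      simp only [at' t x h, ax t x h, bt t x h, bx t x h, νt t x h, νx t x h,
        deriv_sq, deriv_id'', deriv_const', haa]
      obtain ⟨h1, h2⟩ := h
      simp only at h1 h2
      field_simp
      try ring
  obtain ⟨W, k, F, hW, hPW, hWB, hF⟩ := exists_form_of_two_fields reg red₁ red₂ hB hZo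
    (⟨ht₀, hx₀⟩ : base P ∈ Z)
    sa sb sb sν aux₁ aux₂ (fun t x ⟨h1, h2⟩ h0 => mul_ne_zero (mul_ne_zero h1 h2) h2 (by
      simp only at h0 ⊢; linear_combination h0))
  refine ⟨W, hW, hPW, hWB, k, F, fun t x u hP => ?_⟩
  obtain ⟨⟨h1, h2⟩, hg, hFs, hFu, hf⟩ := hF t x u hP
  simp only at h1 h2
  have hω : u * Real.exp (t / x) = Real.exp (-b (t, x)) * u := by
    simp only [hb, neg_neg, mul_comm]
  have hN : (x ^ 2)⁻¹ * Real.exp (-(t / x)) = Real.exp (ν (t, x)) := by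
    have h3 : Real.exp (2 * Real.log x) = x ^ 2 := by
      rw [two_mul, Real.exp_add, Real.exp_log_eq_abs h2, ← sq, sq_abs]
    simp only [hν]
    rw [Real.exp_sub, h3, div_eq_mul_inv (Real.exp _), mul_comm]
  rw [hω, hN]
  refine ⟨h1, h2, hFs, hFu, ?_, hf⟩
  simp only [ha, hb] at hg
  field_simp at hg ⊢
  linear_combination hg

end

/-! ### Local normal forms -/

section

variable {e : Equation} {Ω : TopologicalSpace.Opens Pt} {L : Submodule ℝ (Pt → Pt)}
  {I A C : Set ℝ} {σ ℓ : ℝ × ℝ → ℝ}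

/-- The transformation with components `T`, `X`, `U` brings `e`, near some point of the chart, into
the form `Form`. -/
theorem Chart.exists_normal_form (c : Chart e L I A C σ ℓ) {T X U : ℝ → ℝ}
    (hT : ∀ t ∈ I, ContDiffAt ℝ ∞ T t) (hX : ∀ x ∈ A, ContDiffAt ℝ ∞ X x)
    (hU : ∀ t ∈ I, ContDiffAt ℝ ∞ U t) (hT' : ∀ t ∈ I, deriv T t ≠ 0)
    (hX' : ∀ x ∈ A, deriv X x ≠ 0) (hU' : ∀ t ∈ I, U t ≠ 0) {Form : Equation → Set Pt → Prop}
    (hmono : ∀ e' {W W' : Set Pt}, W' ⊆ W → Form e' W → Form e' W')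
    (hform : ∀ e' I' A', I' ⊆ I → A' ⊆ A → Pushed e e' T X U σ I' A' C →
      ∀ t ∈ I', ∀ x ∈ A', ∀ u ∈ C, ∃ W, IsOpen W ∧ normMap T X U σ (t, x, u) ∈ W ∧
        W ⊆ normMap T X U σ '' (I' ×ˢ A' ×ˢ C) ∧ Form e' W) :
    ∃ W e', IsOpen W ∧ W.Nonempty ∧ W ⊆ I ×ˢ A ×ˢ C ∧
      IsEquivalence (normMap T X U σ) W e e' ∧ Form e' (normMap T X U σ '' W) ∧
      ∀ {Q : Pt → Pt} {τ ξ h τ' ξ' h' : ℝ → ℝ}, ChartForm e Q I A C σ ℓ τ ξ h →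
        Related T X U τ ξ h τ' ξ' h' I A → ∀ P ∈ W,
          fderiv ℝ (normMap T X U σ) P (Q P) = field τ' ξ' h' (normMap T X U σ P) := by
  obtain ⟨e', I', A', ⟨t, ht⟩, ⟨x, hx⟩, hI, hA, p⟩ := c.exists_pushed hT hX hU hT' hX' hU'
  obtain ⟨u, hu⟩ := c.intvl_C.nonempty
  obtain ⟨W, hW, hPW, -, hF⟩ := hform e' I' A' hI hA p t ht x hx u hu
  have hcont : ContinuousOn (normMap T X U σ) (I' ×ˢ A' ×ˢ C) := fun P hP =>
    (p.contDiffAt (u := P.2.2) hP.1 hP.2.1).continuousAt.continuousWithinAt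
  have hsub : (I' ×ˢ A' ×ˢ C) ⊆ I ×ˢ A ×ˢ C := prod_mono hI (prod_mono hA subset_rfl)
  refine ⟨(I' ×ˢ A' ×ˢ C) ∩ normMap T X U σ ⁻¹' W, e',
    hcont.isOpen_inter_preimage (p.isOpen_I.prod (p.isOpen_A.prod p.isOpen_C)) hW,
    ⟨(t, x, u), ⟨ht, hx, hu⟩, hPW⟩, inter_subset_left.trans hsub,
    p.isEquivalence inter_subset_left, hmono e' ?_ hF, fun f r P hP => ?_⟩
  · rintro _ ⟨P, hP, rfl⟩
    exact hP.2
  · exact p.fderiv_normMap (f.mono hI hA subset_rfl) (r.mono hI hA) hP.1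

theorem carriesOnto_span_singleton {Φ Q R : Pt → Pt} {W : Set Pt} (hQ : Q ∈ L)
    (hL : ∀ S ∈ L, ∃ a : ℝ, S = a • Q) (h : ∀ P ∈ W, fderiv ℝ Φ P (Q P) = R (Φ P)) :
    CarriesOnto Φ W L (Submodule.span ℝ {R}) := by
  constructor
  · intro S hS
    obtain ⟨a, rfl⟩ := hL S hS
    refine ⟨a • R, Submodule.smul_mem _ _ (Submodule.mem_span_singleton_self R), fun P hP => ?_⟩
    simp only [Pi.smul_apply, map_smul, h P hP]
  · intro S hS
    obtain ⟨a, rfl⟩ := Submodule.mem_span_singleton.1 hS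
    refine ⟨a • Q, Submodule.smul_mem _ _ hQ, fun P hP => ?_⟩
    simp only [Pi.smul_apply, map_smul, h P hP]

theorem carriesOnto_span_pair {Φ Q₁ Q₂ R₁ R₂ : Pt → Pt} {W : Set Pt} (hQ₁ : Q₁ ∈ L)
    (hQ₂ : Q₂ ∈ L) (hL : ∀ S ∈ L, ∃ a b : ℝ, S = a • Q₁ + b • Q₂)
    (h₁ : ∀ P ∈ W, fderiv ℝ Φ P (Q₁ P) = R₁ (Φ P))
    (h₂ : ∀ P ∈ W, fderiv ℝ Φ P (Q₂ P) = R₂ (Φ P)) :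
    CarriesOnto Φ W L (Submodule.span ℝ {R₁, R₂}) := by
  constructor
  · intro S hS
    obtain ⟨a, b, rfl⟩ := hL S hS
    refine ⟨a • R₁ + b • R₂, Submodule.mem_span_pair.2 ⟨a, b, rfl⟩, fun P hP => ?_⟩
    simp only [Pi.add_apply, Pi.smul_apply, map_add, map_smul, h₁ P hP, h₂ P hP]
  · intro S hS
    obtain ⟨a, b, rfl⟩ := Submodule.mem_span_pair.1 hS
    refine ⟨a • Q₁ + b • Q₂, add_mem (Submodule.smul_mem _ _ hQ₁) (Submodule.smul_mem _ _ hQ₂),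
      fun P hP => ?_⟩
    simp only [Pi.add_apply, Pi.smul_apply, map_add, map_smul, h₁ P hP, h₂ P hP]

/-- The dense open set is the union of all admissible neighbourhoods; it meets every open set
because one of them can be found inside any given nonempty open subset of `Ω`. -/
theorem locallyListed_of {Listed : Equation → Set Pt → Submodule ℝ (Pt → Pt) → Prop}
    (H : ∀ N : Set Pt, IsOpen N → N.Nonempty → N ⊆ Ω →
      ∃ (W : Set Pt) (Φ : Pt → Pt) (e' : Equation) (V : Submodule ℝ (Pt → Pt)),
        IsOpen W ∧ W.Nonempty ∧ W ⊆ N ∧ IsEquivalence Φ W e e' ∧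
        Listed e' (Φ '' W) V ∧ CarriesOnto Φ W (symAlg e Ω) V) :
    LocallyListed Listed e Ω := by
  set S : Set (Set Pt) := {W | IsOpen W ∧ W ⊆ Ω ∧
    ∃ (Φ : Pt → Pt) (e' : Equation) (V : Submodule ℝ (Pt → Pt)), IsEquivalence Φ W e e' ∧
        Listed e' (Φ '' W) V ∧ CarriesOnto Φ W (symAlg e Ω) V} with hS
  refine ⟨⋃₀ S, isOpen_sUnion fun W hW => hW.1, sUnion_subset fun W hW => hW.2.1,
    fun P hP => mem_closure_iff.2 fun N hN hPN => ?_, ?_⟩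
  · obtain ⟨W, Φ, e', V, hWo, ⟨R, hR⟩, hWN, h⟩ :=
      H (N ∩ Ω) (hN.inter Ω.isOpen) ⟨P, hPN, hP⟩ inter_subset_right
    exact ⟨R, (hWN hR).1, W, ⟨hWo, hWN.trans inter_subset_right, Φ, e', V, h⟩, hR⟩
  · rintro P ⟨W, ⟨hWo, hWΩ, Φ, e', V, h⟩, hPW⟩
    exact ⟨W, Φ, e', V, hWo, hPW, hWΩ, h⟩

/-! ### Functions of one variable -/

theorem IsIntvl.exists_zero_or_ne {τ : ℝ → ℝ} (hI : IsIntvl I)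
    (hτ : ∀ t ∈ I, ContDiffAt ℝ ∞ τ t) :
    ∃ I', IsIntvl I' ∧ I' ⊆ I ∧ ((∀ t ∈ I', τ t = 0) ∨ ∀ t ∈ I', τ t ≠ 0) := by
  by_cases h : ∀ t ∈ I, τ t = 0
  · exact ⟨I, hI, subset_rfl, Or.inl h⟩
  · push Not at h
    obtain ⟨t, ht, hne⟩ := h
    obtain ⟨I', hI', -, hsub⟩ := exists_intvl_subset
      (Filter.inter_mem (hI.isOpen.mem_nhds ht) ((hτ t ht).continuousAt.eventually_ne hne))
    exact ⟨I', hI', fun s hs => (hsub hs).1, Or.inr fun s hs => (hsub hs).2⟩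

theorem exists_exp_primitive (hI : IsIntvl I) {f : ℝ → ℝ} (hf : ∀ t ∈ I, ContDiffAt ℝ ∞ f t) :
    ∃ p : ℝ → ℝ, (∀ t ∈ I, ContDiffAt ℝ ∞ p t) ∧ (∀ t ∈ I, deriv p t = f t * p t) ∧
      ∀ t, p t ≠ 0 := by
  obtain ⟨q, hq, hq'⟩ := exists_primitive hI hf
  refine ⟨fun t => Real.exp (q t), fun t ht => (hq t ht).exp, fun t ht => ?_,
    fun t => Real.exp_ne_zero _⟩
  rw [((hq t ht).diff.hasDerivAt.exp).deriv, hq' t ht, mul_comm]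

/-- On the line, `[τ₁ ∂, τ₂ ∂] = τ₂ ∂` makes `T = τ₂ / τ₁` a coordinate in which the fields become
`t ∂_t` and `t² ∂_t`, wherever `τ₂ ≠ 0`. -/
theorem deriv_div_of_bracket {τ₁ τ₂ : ℝ → ℝ} {t : ℝ} (h₁ : ContDiffAt ℝ ∞ τ₁ t)
    (h₂ : ContDiffAt ℝ ∞ τ₂ t) (hne : τ₁ t ≠ 0) (hb : bracket τ₁ τ₂ t = τ₂ t) :
    deriv (fun s => τ₂ s / τ₁ s) t = τ₂ t / τ₁ t ^ 2 := by
  rw [(h₂.diff.hasDerivAt.fun_div h₁.diff.hasDerivAt hne).deriv]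
  rw [bracket] at hb
  congr 1
  linear_combination hb

theorem eq_zero_of_bracket {τ₁ τ₂ : ℝ → ℝ} (hI : IsOpen I) (h₁ : ∀ t ∈ I, ContDiffAt ℝ ∞ τ₁ t)
    (hb : ∀ t ∈ I, bracket τ₁ τ₂ t = τ₂ t) (hz : ∀ t ∈ I, τ₁ t = 0) : ∀ t ∈ I, τ₂ t = 0 := by
  intro t ht
  rw [← hb t ht, bracket, hz t ht, (h₁ t ht).diff.hasDerivAt.eq_zero_of_eqOn hI ht hz]
  ring

/-! ### One-dimensional algebras -/

theorem field_dilation : field (fun t => t) (fun x => x) (fun _ => 0) = dilation := by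
  funext P
  simp [field, dilation]

theorem exists_listedOne (hΩ : IsConnected (Ω : Set Pt)) (he : e.InClass Ω) {Q : Pt → Pt}
    (hQ : Q ∈ symAlg e Ω) (hQ0 : Q ≠ 0) (hL : ∀ R ∈ symAlg e Ω, ∃ a : ℝ, R = a • Q)
    {N : Set Pt} (hN : IsOpen N) (hne : N.Nonempty) (hNΩ : N ⊆ Ω) :
    ∃ (W : Set Pt) (Φ : Pt → Pt) (e' : Equation) (V : Submodule ℝ (Pt → Pt)),
      IsOpen W ∧ W.Nonempty ∧ W ⊆ N ∧ IsEquivalence Φ W e e' ∧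
      ListedOne e' (Φ '' W) V ∧ CarriesOnto Φ W (symAlg e Ω) V := by
  obtain ⟨I₀, A₀, C, σ, ℓ, hB₀, c₀, hg₀⟩ := exists_good_chart he hN hne hNΩ
  obtain ⟨τ, ξ, h, f₀⟩ := c₀.sym Q hQ
  obtain ⟨I, hI, hII, hτ⟩ := c₀.intvl_I.exists_zero_or_ne f₀.smooth_τ
  obtain ⟨A, hA, hAA, hξ⟩ := c₀.intvl_A.exists_zero_or_ne f₀.smooth_ξ
  have c := c₀.mono hI hA c₀.intvl_C hII hAA subset_rfl
  have f := f₀.mono hII hAA (subset_refl C)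
  have hB : I ×ˢ A ×ˢ C ⊆ N := (prod_mono hII (prod_mono hAA subset_rfl)).trans hB₀
  have hinv : ∀ {F : Set ℝ} {φ : ℝ → ℝ}, (∀ t ∈ F, ContDiffAt ℝ ∞ φ t) → (∀ t ∈ F, φ t ≠ 0) →
      ∀ t ∈ F, ContDiffAt ℝ ∞ (fun s => (φ s)⁻¹) t := fun h1 h2 t ht => (h1 t ht).inv (h2 t ht)
  rcases hτ with hτ | hτ <;> rcases hξ with hξ | hξ
  · obtain ⟨t, ht⟩ := hI.nonempty
    obtain ⟨x, hx⟩ := hA.nonempty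
    exact absurd (symAlg_eq_zero_of_eqOn hΩ he hQ c.isOpen_box c.box_nonempty (hB.trans hNΩ)
      fun R hR => c.eq_zero_of_apply (hg₀.mono hII hAA) f ht hx (hτ t ht) (hξ x hx) hR) hQ0
  · obtain ⟨X, hX, hX'⟩ := exists_primitive hA (hinv f.smooth_ξ hξ)
    -- With `τ = 0` the equation for `g` reduces to `h' = ξ g_x`, which is nonzero; so `h` itself is
    -- the new coordinate `t`, and the vertical part becomes `t u ∂_u`.
    have hT' : ∀ t ∈ I, deriv h t ≠ 0 := by
      intro t ht h0
      obtain ⟨x, hx⟩ := hA.nonempty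
      have h1 := f.det_g t ht x hx
      rw [hτ t ht, (f.smooth_τ t ht).diff.hasDerivAt.eq_zero_of_eqOn hI.isOpen ht hτ, h0] at h1
      exact mul_ne_zero (hξ x hx) (c.gx_ne t ht x hx) (by linarith)
    have r : Related h X (fun _ => 1) τ ξ h (fun _ => 0) (fun _ => 1) (fun t => t) I A :=
      { diff_τ := differentiable_const _
        diff_ξ := differentiable_const _
        diff_h := differentiable_id
        rel_T := fun t ht => by rw [hτ t ht, zero_mul]
        rel_X := fun x hx => by rw [hX' x hx, mul_inv_cancel₀ (hξ x hx)]
        rel_U := fun t ht => by rw [hτ t ht, zero_mul, zero_add] }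
    obtain ⟨W, e', hW, hWne, hWB, heq, hF, hd⟩ := c.exists_normal_form (U := fun _ => 1)
      f.smooth_h hX (fun _ _ => contDiffAt_const) hT'
      (fun x hx => by rw [hX' x hx]; exact inv_ne_zero (hξ x hx)) (fun _ _ => one_ne_zero)
      (Form := FormA13) (fun e' W W' hs ⟨G, F, hF⟩ => ⟨G, F, fun t x u hP => hF t x u (hs hP)⟩)
      (fun e' I' A' hI' hA' p t ht x hx u hu => exists_formA13 p.regular
        (p.reduced (f.mono hI' hA' subset_rfl) (r.mono hI' hA')) (p.image_nhds _ ⟨ht, hx, hu⟩))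
    exact ⟨W, _, e', _, hW, hWne, hWB.trans hB, heq, Or.inr (Or.inr ⟨hF, rfl⟩),
      carriesOnto_span_singleton hQ hL (hd f r)⟩
  -- Here `T' = 1/τ` straightens the field to `∂_t`, and `U' = -(h/τ) U` removes the vertical part.
  · obtain ⟨T, hT, hT'⟩ := exists_primitive hI (hinv f.smooth_τ hτ)
    obtain ⟨U, hU, hU', hU0⟩ := exists_exp_primitive hI (f := fun t => -(h t / τ t))
      (fun t ht => ((f.smooth_h t ht).div (f.smooth_τ t ht) (hτ t ht)).neg)
    have r : Related T (fun x => x) U τ ξ h (fun _ => 1) (fun _ => 0) (fun _ => 0) I A :=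
      { diff_τ := differentiable_const _
        diff_ξ := differentiable_const _
        diff_h := differentiable_const _
        rel_T := fun t ht => by rw [hT' t ht, mul_inv_cancel₀ (hτ t ht)]
        rel_X := fun x hx => by rw [hξ x hx, zero_mul]
        rel_U := fun t ht => by
          have := hτ t ht
          rw [hU' t ht]
          field_simp
          ring }
    obtain ⟨W, e', hW, hWne, hWB, heq, hF, hd⟩ := c.exists_normal_form
      hT (X := fun x => x) (fun _ _ => contDiffAt_id) hU
      (fun t ht => by rw [hT' t ht]; exact inv_ne_zero (hτ t ht))
      (fun x _ => by rw [deriv_id'']; exact one_ne_zero) (fun t _ => hU0 t)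
      (Form := FormA12) (fun e' W W' hs ⟨G, F, hF⟩ => ⟨G, F, fun t x u hP => hF t x u (hs hP)⟩)
      (fun e' I' A' hI' hA' p t ht x hx u hu => exists_formA12 p.regular
        (p.reduced (f.mono hI' hA' subset_rfl) (r.mono hI' hA')) (p.image_nhds _ ⟨ht, hx, hu⟩))
    refine ⟨W, _, e', _, hW, hWne, hWB.trans hB, heq, Or.inr (Or.inl ⟨hF, rfl⟩),
      carriesOnto_span_singleton hQ hL fun P hP => (hd f r P hP).trans ?_⟩
    simp [field]
  -- Exponentials of primitives of `1/τ` and `1/ξ` satisfy `τ T' = T` and `ξ X' = X`, so the field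
  -- becomes the dilation, on a region where `t` and `x` do not vanish.
  · obtain ⟨T, hT, hT', hT0⟩ := exists_exp_primitive hI (hinv f.smooth_τ hτ)
    obtain ⟨X, hX, hX', hX0⟩ := exists_exp_primitive hA (hinv f.smooth_ξ hξ)
    obtain ⟨U, hU, hU', hU0⟩ := exists_exp_primitive hI (f := fun t => -(h t / τ t))
      (fun t ht => ((f.smooth_h t ht).div (f.smooth_τ t ht) (hτ t ht)).neg)
    have r : Related T X U τ ξ h (fun t => t) (fun x => x) (fun _ => 0) I A :=
      { diff_τ := differentiable_id
        diff_ξ := differentiable_id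
        diff_h := differentiable_const _
        rel_T := fun t ht => by rw [hT' t ht, mul_inv_cancel_left₀ (hτ t ht)]
        rel_X := fun x hx => by rw [hX' x hx, mul_inv_cancel_left₀ (hξ x hx)]
        rel_U := fun t ht => by
          have := hτ t ht
          rw [hU' t ht]
          field_simp
          ring }
    obtain ⟨W, e', hW, hWne, hWB, heq, hF, hd⟩ := c.exists_normal_form hT hX hU
      (fun t ht => by rw [hT' t ht]; exact mul_ne_zero (inv_ne_zero (hτ t ht)) (hT0 t))
      (fun x hx => by rw [hX' x hx]; exact mul_ne_zero (inv_ne_zero (hξ x hx)) (hX0 x))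
      (fun t _ => hU0 t)
      (Form := FormA11) (fun e' W W' hs ⟨G, F, hF⟩ => ⟨G, F, fun t x u hP => hF t x u (hs hP)⟩)
      (fun e' I' A' hI' hA' p t ht x hx u hu => exists_formA11 p.regular
        (p.reduced (f.mono hI' hA' subset_rfl) (r.mono hI' hA')) (p.image_nhds _ ⟨ht, hx, hu⟩)
        (hT0 t) (hX0 x))
    exact ⟨W, _, e', _, hW, hWne, hWB.trans hB, heq, Or.inl ⟨hF, rfl⟩,
      carriesOnto_span_singleton hQ hL fun P hP => field_dilation ▸ hd f r P hP⟩

/-! ### Normalisation of two-dimensional algebras -/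

/-- After shrinking, `τ₂` and `ξ₂` are each identically zero or nowhere zero, and transitivity rules
out that both are zero. The three remaining cases are the three equations of the list; in all of
them `Q₁` becomes the dilation. -/
theorem exists_listedTwo (hΩ : IsConnected (Ω : Set Pt)) (he : e.InClass Ω)
    (hrank : Module.rank ℝ (symAlg e Ω) = 2)
    {N : Set Pt} (hN : IsOpen N) (hne : N.Nonempty) (hNΩ : N ⊆ Ω) :
    ∃ (W : Set Pt) (Φ : Pt → Pt) (e' : Equation) (V : Submodule ℝ (Pt → Pt)),
      IsOpen W ∧ W.Nonempty ∧ W ⊆ N ∧ IsEquivalence Φ W e e' ∧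
      ListedTwo e' (Φ '' W) V ∧ CarriesOnto Φ W (symAlg e Ω) V := by
  obtain ⟨I₀, A₀, C, σ, ℓ, hB₀, c₀, hg₀⟩ := exists_good_chart he hN hne hNΩ
  obtain ⟨Q₁, Q₂, τ₁, ξ₁, h₁, τ₂, ξ₂, h₂, hQ₁, hQ₂, hL, f₁₀, f₂₀, hbτ₀, hbξ₀, hδ₀⟩ :=
    exists_nonabelian_basis hΩ he hrank c₀ (hB₀.trans hNΩ) hg₀
  obtain ⟨I₁, hI₁, hII₁, hτ₂⟩ := c₀.intvl_I.exists_zero_or_ne f₂₀.smooth_τ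
  obtain ⟨A₁, hA₁, hAA₁, hξ₂⟩ := c₀.intvl_A.exists_zero_or_ne f₂₀.smooth_ξ
  obtain ⟨I, hI, hII₂, hτ₁⟩ := hI₁.exists_zero_or_ne (fun t ht => f₁₀.smooth_τ t (hII₁ ht))
  obtain ⟨A, hA, hAA₂, hξ₁⟩ := hA₁.exists_zero_or_ne (fun t ht => f₁₀.smooth_ξ t (hAA₁ ht))
  have hII := hII₂.trans hII₁
  have hAA := hAA₂.trans hAA₁
  replace hτ₂ : (∀ t ∈ I, τ₂ t = 0) ∨ ∀ t ∈ I, τ₂ t ≠ 0 :=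
    hτ₂.imp (fun h t ht => h t (hII₂ ht)) fun h t ht => h t (hII₂ ht)
  replace hξ₂ : (∀ t ∈ A, ξ₂ t = 0) ∨ ∀ t ∈ A, ξ₂ t ≠ 0 :=
    hξ₂.imp (fun h t ht => h t (hAA₂ ht)) fun h t ht => h t (hAA₂ ht)
  have c := c₀.mono hI hA c₀.intvl_C hII hAA subset_rfl
  have f₁ := f₁₀.mono hII hAA (subset_refl C)
  have f₂ := f₂₀.mono hII hAA (subset_refl C)
  have hB : I ×ˢ A ×ˢ C ⊆ N := (prod_mono hII (prod_mono hAA subset_rfl)).trans hB₀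
  have hbτ : ∀ t ∈ I, bracket τ₁ τ₂ t = τ₂ t := fun t ht => hbτ₀ t (hII ht)
  have hbξ : ∀ x ∈ A, bracket ξ₁ ξ₂ x = ξ₂ x := fun x hx => hbξ₀ x (hAA hx)
  have hδ : ∀ t ∈ I, ∀ x ∈ A, τ₁ t * ξ₂ x - τ₂ t * ξ₁ x ≠ 0 :=
    fun t ht x hx => hδ₀ t (hII ht) x (hAA hx)
  have hbh := fun t ht => c.bracket_h f₁ f₂ hbτ hbξ (t := t) ht
  obtain ⟨t₀, ht₀⟩ := hI.nonempty
  obtain ⟨x₀, hx₀⟩ := hA.nonempty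
  -- If `τ₁` vanished on the interval, then so would `τ₂`, being the bracket of the two, and the
  -- determinant would be zero.
  replace hτ₁ : ∀ t ∈ I, τ₁ t ≠ 0 := by
    refine hτ₁.resolve_left fun hz => hδ t₀ ht₀ x₀ hx₀ ?_
    rw [hz t₀ ht₀, eq_zero_of_bracket hI.isOpen f₁.smooth_τ hbτ hz t₀ ht₀]
    ring
  replace hξ₁ : ∀ x ∈ A, ξ₁ x ≠ 0 := by
    refine hξ₁.resolve_left fun hz => hδ t₀ ht₀ x₀ hx₀ ?_
    rw [hz x₀ hx₀, eq_zero_of_bracket hA.isOpen f₁.smooth_ξ hbξ hz x₀ hx₀]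
    ring
  obtain ⟨U, hU, hU', hU0⟩ := exists_exp_primitive hI (f := fun t => -(h₁ t / τ₁ t))
    (fun t ht => ((f₁.smooth_h t ht).div (f₁.smooth_τ t ht) (hτ₁ t ht)).neg)
  have relU₁ : ∀ t ∈ I, τ₁ t * deriv U t + h₁ t * U t = 0 * U t := fun t ht => by
    have := hτ₁ t ht
    rw [hU' t ht]
    field_simp
    ring
  have hTd := fun t ht => deriv_div_of_bracket (f₁.smooth_τ t ht) (f₂.smooth_τ t ht) (hτ₁ t ht)
    (hbτ t ht)
  have hXd := fun x hx => deriv_div_of_bracket (f₁.smooth_ξ x hx) (f₂.smooth_ξ x hx) (hξ₁ x hx)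
    (hbξ x hx)
  have hTs : ∀ t ∈ I, ContDiffAt ℝ ∞ (fun s => τ₂ s / τ₁ s) t :=
    fun t ht => (f₂.smooth_τ t ht).div (f₁.smooth_τ t ht) (hτ₁ t ht)
  have hXs : ∀ x ∈ A, ContDiffAt ℝ ∞ (fun s => ξ₂ s / ξ₁ s) x :=
    fun x hx => (f₂.smooth_ξ x hx).div (f₁.smooth_ξ x hx) (hξ₁ x hx)
  have relT₁ : ∀ t ∈ I, τ₁ t * deriv (fun s => τ₂ s / τ₁ s) t = τ₂ t / τ₁ t := fun t ht => by
    have := hτ₁ t ht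
    rw [hTd t ht]
    field_simp
  have relX₁ : ∀ x ∈ A, ξ₁ x * deriv (fun s => ξ₂ s / ξ₁ s) x = ξ₂ x / ξ₁ x := fun x hx => by
    have := hξ₁ x hx
    rw [hXd x hx]
    field_simp
  have relT₂ : ∀ t ∈ I, τ₂ t * deriv (fun s => τ₂ s / τ₁ s) t = (τ₂ t / τ₁ t) ^ 2 :=
    fun t ht => by
      rw [hTd t ht]
      ring
  have relX₂ : ∀ x ∈ A, ξ₂ x * deriv (fun s => ξ₂ s / ξ₁ s) x = (ξ₂ x / ξ₁ x) ^ 2 :=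
    fun x hx => by
      rw [hXd x hx]
      ring
  rcases hτ₂ with hτ₂ | hτ₂
  · have hξ₂ : ∀ x ∈ A, ξ₂ x ≠ 0 := fun x hx h0 => hδ t₀ ht₀ x hx (by
      rw [h0, hτ₂ t₀ ht₀]; ring)
    -- With `τ₂ = 0` the quotient `τ₂/τ₁` is useless as a coordinate. The bracket relation for the
    -- vertical parts shows that `h₂` scales under `Q₁` as `t` should, so it takes that place.
    have hT : ∀ t ∈ I, τ₁ t * deriv h₂ t = h₂ t := fun t ht => by
      have := hbh t ht
      rwa [hτ₂ t ht, zero_mul, sub_zero] at this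
    have hT' : ∀ t ∈ I, deriv h₂ t ≠ 0 := by
      intro t ht h0
      have h3 := f₂.det_g t ht x₀ hx₀
      rw [hτ₂ t ht, (f₂.smooth_τ t ht).diff.hasDerivAt.eq_zero_of_eqOn hI.isOpen ht hτ₂, h0] at h3
      exact mul_ne_zero (hξ₂ x₀ hx₀) (c.gx_ne t ht x₀ hx₀) (by linarith)
    have r₁ : Related h₂ (fun s => ξ₂ s / ξ₁ s) U τ₁ ξ₁ h₁ (fun t => t) (fun x => x)
        (fun _ => 0) I A := ⟨differentiable_id, differentiable_id, differentiable_const _, hT,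
      relX₁, relU₁⟩
    have r₂ : Related h₂ (fun s => ξ₂ s / ξ₁ s) U τ₂ ξ₂ h₂ (fun _ => 0) (fun x => x ^ 2)
        (fun t => t) I A := ⟨differentiable_const _, differentiable_pow 2, differentiable_id,
      fun t ht => by rw [hτ₂ t ht, zero_mul], relX₂,
      fun t ht => by rw [hτ₂ t ht, zero_mul, zero_add]⟩
    obtain ⟨W, e', hW, hWne, hWB, heq, ⟨m, hF⟩, hd⟩ := c.exists_normal_form f₂.smooth_h hXs hU hT'
      (fun x hx => by
        rw [hXd x hx]; exact div_ne_zero (hξ₂ x hx) (pow_ne_zero 2 (hξ₁ x hx)))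
      (fun t _ => hU0 t)
      (Form := fun e' W => ∃ m, FormA223 m e' W)
      (fun e' W W' hs ⟨m, F, hF⟩ => ⟨m, F, fun t x u hP => hF t x u (hs hP)⟩)
      (fun e' I' A' hI' hA' p t ht x hx u hu => exists_formA223 p.regular
        (p.reduced (f₁.mono hI' hA' subset_rfl) (r₁.mono hI' hA'))
        (p.reduced (f₂.mono hI' hA' subset_rfl) (r₂.mono hI' hA')) (p.image_nhds _ ⟨ht, hx, hu⟩)
        (show h₂ t ≠ 0 from hT t (hI' ht) ▸ mul_ne_zero (hτ₁ t (hI' ht)) (hT' t (hI' ht)))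
        (div_ne_zero (hξ₂ x (hA' hx)) (hξ₁ x (hA' hx))))
    exact ⟨W, _, e', _, hW, hWne, hWB.trans hB, heq, Or.inr (Or.inr ⟨m, hF, rfl⟩),
      carriesOnto_span_pair hQ₁ hQ₂ hL (fun P hP => field_dilation ▸ hd f₁ r₁ P hP) (hd f₂ r₂)⟩
  -- After `U` has removed `h₁`, the vertical coefficient of `Q₂` is `h₂ - h₁ τ₂/τ₁`. The bracket
  -- relations show that its ratio to `T = τ₂/τ₁` is constant, and this constant is `m`.
  · obtain ⟨m, hm⟩ : ∃ m, ∀ t ∈ I, h₂ t * τ₁ t - h₁ t * τ₂ t = m * τ₂ t := by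
      refine ⟨h₂ t₀ * τ₁ t₀ / τ₂ t₀ - h₁ t₀, fun t ht => ?_⟩
      have := eq_of_hasDerivAt_zero (f := fun s => h₂ s * τ₁ s / τ₂ s - h₁ s) hI.isOpen hI.conn
        (fun s hs => ?_) ht ht₀
      · have hne := hτ₂ t ht
        rw [← this]
        field_simp
      · have hne := hτ₂ s hs
        refine ((((f₂.smooth_h s hs).diff.hasDerivAt.fun_mul
          (f₁.smooth_τ s hs).diff.hasDerivAt).fun_div (f₂.smooth_τ s hs).diff.hasDerivAt
          hne).fun_sub (f₁.smooth_h s hs).diff.hasDerivAt).congr_deriv ?_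
        have e1 := hbτ s hs
        have e2 := hbh s hs
        rw [bracket] at e1
        field_simp
        linear_combination τ₂ s * e2 - h₂ s * e1
    have relU₂ : ∀ t ∈ I, τ₂ t * deriv U t + h₂ t * U t = m * (τ₂ t / τ₁ t) * U t :=
      fun t ht => by
        have := hτ₁ t ht
        rw [hU' t ht]
        field_simp
        linear_combination U t * hm t ht
    have hT0 : ∀ t ∈ I, deriv (fun s => τ₂ s / τ₁ s) t ≠ 0 := fun t ht => by
      rw [hTd t ht]; exact div_ne_zero (hτ₂ t ht) (pow_ne_zero 2 (hτ₁ t ht))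
    have dm : Differentiable ℝ fun t : ℝ => m * t := by fun_prop
    rcases hξ₂ with hξ₂ | hξ₂
    -- With `ξ₂ = 0` only `Q₁` acts on `x`, and any solution of `ξ₁ X' = X` without zeros is
    -- suitable.
    · obtain ⟨X, hX, hX', hX0⟩ := exists_exp_primitive hA (f := fun x => (ξ₁ x)⁻¹)
        (fun x hx => (f₁.smooth_ξ x hx).inv (hξ₁ x hx))
      have r₁ : Related (fun s => τ₂ s / τ₁ s) X U τ₁ ξ₁ h₁ (fun t => t) (fun x => x)
          (fun _ => 0) I A := ⟨differentiable_id, differentiable_id, differentiable_const _, relT₁,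
        fun x hx => by rw [hX' x hx, mul_inv_cancel_left₀ (hξ₁ x hx)], relU₁⟩
      have r₂ : Related (fun s => τ₂ s / τ₁ s) X U τ₂ ξ₂ h₂ (fun t => t ^ 2) (fun _ => 0)
          (fun t => m * t) I A := ⟨differentiable_pow 2, differentiable_const _, dm,
        relT₂, fun x hx => by rw [hξ₂ x hx, zero_mul], relU₂⟩
      obtain ⟨W, e', hW, hWne, hWB, heq, ⟨k, hk, hF⟩, hd⟩ := c.exists_normal_form hTs hX hU hT0
        (fun x hx => by
          rw [hX' x hx]; exact mul_ne_zero (inv_ne_zero (hξ₁ x hx)) (hX0 x))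
        (fun t _ => hU0 t)
        (Form := fun e' W => ∃ k ≠ 0, FormA222 m k e' W)
        (fun e' W W' hs ⟨k, hk, F, hF⟩ => ⟨k, hk, F, fun t x u hP => hF t x u (hs hP)⟩)
        (fun e' I' A' hI' hA' p t ht x hx u hu => exists_formA222 p.regular
          (p.reduced (f₁.mono hI' hA' subset_rfl) (r₁.mono hI' hA'))
          (p.reduced (f₂.mono hI' hA' subset_rfl) (r₂.mono hI' hA')) (p.image_nhds _ ⟨ht, hx, hu⟩)
          (div_ne_zero (hτ₂ t (hI' ht)) (hτ₁ t (hI' ht))) (hX0 x))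
      exact ⟨W, _, e', _, hW, hWne, hWB.trans hB, heq, Or.inr (Or.inl ⟨m, k, hk, hF, rfl⟩),
        carriesOnto_span_pair hQ₁ hQ₂ hL (fun P hP => field_dilation ▸ hd f₁ r₁ P hP) (hd f₂ r₂)⟩
    · have r₁ : Related (fun s => τ₂ s / τ₁ s) (fun s => ξ₂ s / ξ₁ s) U τ₁ ξ₁ h₁ (fun t => t)
          (fun x => x) (fun _ => 0) I A := ⟨differentiable_id, differentiable_id,
        differentiable_const _, relT₁, relX₁, relU₁⟩
      have r₂ : Related (fun s => τ₂ s / τ₁ s) (fun s => ξ₂ s / ξ₁ s) U τ₂ ξ₂ h₂ (fun t => t ^ 2)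
          (fun x => x ^ 2) (fun t => m * t) I A := ⟨differentiable_pow 2, differentiable_pow 2, dm,
        relT₂, relX₂, relU₂⟩
      obtain ⟨W, e', hW, hWne, hWB, heq, ⟨k, hk, hF⟩, hd⟩ := c.exists_normal_form hTs hXs hU hT0
        (fun x hx => by
          rw [hXd x hx]; exact div_ne_zero (hξ₂ x hx) (pow_ne_zero 2 (hξ₁ x hx)))
        (fun t _ => hU0 t)
        (Form := fun e' W => ∃ k ≠ 0, FormA221 m k e' W)
        (fun e' W W' hs ⟨k, hk, F, hF⟩ => ⟨k, hk, F, fun t x u hP => hF t x u (hs hP)⟩)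
        (fun e' I' A' hI' hA' p t ht x hx u hu => exists_formA221 p.regular
          (p.reduced (f₁.mono hI' hA' subset_rfl) (r₁.mono hI' hA'))
          (p.reduced (f₂.mono hI' hA' subset_rfl) (r₂.mono hI' hA')) (p.image_nhds _ ⟨ht, hx, hu⟩)
          (div_ne_zero (hτ₂ t (hI' ht)) (hτ₁ t (hI' ht)))
          (div_ne_zero (hξ₂ x (hA' hx)) (hξ₁ x (hA' hx)))
          -- The condition `t ≠ x` in the new coordinates is the nonvanishing of `τ₁ ξ₂ - τ₂ ξ₁`.
          (fun h0 => hδ t (hI' ht) x (hA' hx) (by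
            have h3 := (div_eq_div_iff (hτ₁ t (hI' ht)) (hξ₁ x (hA' hx))).1 h0
            linarith)))
      exact ⟨W, _, e', _, hW, hWne, hWB.trans hB, heq, Or.inl ⟨m, k, hk, hF, rfl⟩,
        carriesOnto_span_pair hQ₁ hQ₂ hL (fun P hP => field_dilation ▸ hd f₁ r₁ P hP) (hd f₂ r₂)⟩

end

end GroupClass

end

/-! ### The classification by the dimension of the symmetry algebra -/

theorem mainTheorem7 (e : GroupClass.Equation) (Ω : TopologicalSpace.Opens GroupClass.Pt)
    (hΩ : IsConnected (Ω : Set GroupClass.Pt)) (he : e.InClass Ω) :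
    Module.rank ℝ (GroupClass.symAlg e Ω) ≤ 2 ∧
    (GroupClass.symAlg e Ω ≠ ⊥ →
      (Module.rank ℝ (GroupClass.symAlg e Ω) = 1 ∧
        GroupClass.LocallyListed GroupClass.ListedOne e Ω) ∨
      (Module.rank ℝ (GroupClass.symAlg e Ω) = 2 ∧
        GroupClass.LocallyListed GroupClass.ListedTwo e Ω)) := by
  have hle := GroupClass.rank_symAlg_le hΩ he
  refine ⟨hle, fun hbot => ?_⟩
  obtain ⟨n, hn⟩ := Cardinal.lt_aleph0.1 (hle.trans_lt (Cardinal.natCast_lt_aleph0 (n := 2)))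
  rw [hn] at hle
  have hn2 : n ≤ 2 := by exact_mod_cast hle
  have hn0 : n ≠ 0 := by
    rintro rfl
    exact hbot (Submodule.rank_eq_zero.1 (by simpa using hn))
  obtain rfl | rfl : n = 1 ∨ n = 2 := by omega
  · have h1 : Module.rank ℝ (GroupClass.symAlg e Ω) = 1 := by simpa using hn
    refine Or.inl ⟨h1, GroupClass.locallyListed_of fun N hN hne hNΩ => ?_⟩
    obtain ⟨⟨Q, hQ⟩, hQ0, hQs⟩ := rank_eq_one_iff.1 h1
    refine GroupClass.exists_listedOne hΩ he hQ (fun h0 => hQ0 (Subtype.ext h0)) (fun R hR => ?_)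
      hN hne hNΩ
    obtain ⟨a, ha⟩ := hQs ⟨R, hR⟩
    exact ⟨a, (congrArg Subtype.val ha).symm⟩
  · have h2 : Module.rank ℝ (GroupClass.symAlg e Ω) = 2 := by simpa using hn
    exact Or.inr ⟨h2, GroupClass.locallyListed_of fun N hN hne hNΩ =>
      GroupClass.exists_listedTwo hΩ he h2 hN hne hNΩ⟩
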